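/- Let $\gamma:\mathbb R\to\mathbb R^2$ be a $C^\infty$, periodic, regular ($\gamma'\neq0$) parametrization, injective on one period, of a smooth closed plane curve $\Gamma$, let $\mathbf n$ be its unit normal obtained by rotating the unit tangent by $-\pi/2$ (the outward normal when $\gamma$ runs counterclockwise), and let $\sigma$ be arc length. Let $\kappa>2$ and suppose that the curvature of $\Gamma$ vanishes at only finitely many points, and at each of them to order at most $\kappa-2$: for each such point $z$ there is $k\in(2,\kappa]$ (for instance $k=\kappa$ for all $z$) such that, in a suitable orthonormal frame with origin $z$, $\Gamma$ is near $z$ the graph of a function $g$ on some $[-r,r]$, $r>0$, with $g(x)=|x|^{k}H(x)$ or $g(x)=\operatorname{sgn}(x)|x|^{k}H(x)$, where $H\in C^\infty[-r,r]$ has no zeros. Notation. For $\varepsilon>0$ let $T_\varepsilon=\{x\in\mathbb R^2:\operatorname{dist}(x,\Gamma)\le\varepsilon\}$. For $x$ near $\Gamma$ let $P_\Gamma(x)$ be its nearest point on $\Gamma$, $d_\Gamma(x)=\mathbf n(P_\Gamma(x))\cdot(x-P_\Gamma(x))$ the signed distance, and $J(x)=1-d_\Gamma(x)\,\kappa_\Gamma(x)$,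 where $\kappa_\Gamma(x)$ is the signed curvature at $x$ of the level curve of $d_\Gamma$ through $x$, namely $t\mapsto\gamma(t)+\eta\,\mathbf n(t)$ with $\eta=d_\Gamma(x)$ (positive curvature meaning a left turn). A weight of regularity order $q\ge1$ is a function $\theta\in C^{q-1}(\mathbb R)$ with $\operatorname{supp}\theta=[-1,1]$ and $\int_{-1}^1\theta=1$ whose derivative $\theta^{(q)}$ is piecewise $C^1$ (finitely many pieces, with finite one-sided limits of $\theta^{(q)}$ and $\theta^{(q+1)}$ at the break points); put $\theta_\varepsilon(s)=\varepsilon^{-1}\theta(\varepsilon^{-1}s)$. For $f\in C^\infty(\Gamma)$ let $$\mathcal I(f)=\int_\Gamma f\,d\sigma,\qquad \mathcal I_h(f)=h^2\sum_{x\in(h\mathbb Z)^2\cap T_\varepsilon} f(P_\Gamma(x))\,\theta_\varepsilon(d_\Gamma(x))\,J(x).$$ Then there is $\varepsilon_0>0$, depending only on $\Gamma$ and $\kappa$, such that every point of $T_{\varepsilon_0}$ has a unique nearest point on $\Gamma$ and the following holds. For every integer $q\ge1$, every weight $\theta$ of regularity order $q$, every $f\in C^\infty(\Gamma)$, every $\alpha\in[0,1]$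 and every tube width $\varepsilon=\varepsilon(h)$ with $0<\varepsilon(h)\le\varepsilon_0$ for all small $h>0$ and $\varepsilon(h)=\Theta(h^\alpha)$ as $h\to0^+$, $$\mathcal I(f)-\mathcal I_h(f)=O\!\left(h^{\frac1\kappa+(q+1)(1-\alpha)}\right)\qquad(h\to0^+).$$ -/

import Mathlib

open Set Filter Topology Asymptotics MeasureTheory
open scoped ContDiff

noncomputable section

namespace IBIM

/-- The Euclidean plane. -/
abbrev Plane : Type := EuclideanSpace ℝ (Fin 2)

/-- Signed curvature of a parametrized plane curve, `(x' y'' - y' x'') / |c'| ^ 3`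
(positive for counterclockwise convex curves). -/
def signedCurvature (c : ℝ → Plane) (t : ℝ) : ℝ :=
  (deriv c t 0 * deriv (deriv c) t 1 - deriv c t 1 * deriv (deriv c) t 0) / ‖deriv c t‖ ^ 3

/-- A smooth closed curve in the plane (the boundary of a smooth bounded simply connected domain),
given by a smooth, periodic, regular parametrization that is injective on one period. -/
structure SmoothClosedCurve where
  /-- the parametrization -/
  param : ℝ → Plane
  /-- its period -/
  period : ℝ
  period_pos : 0 < period
  smooth : ContDiff ℝ ∞ param
  periodic : Function.Periodic param period
  regular : ∀ t, deriv param t ≠ 0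
  simple : InjOn param (Ico 0 period)

/-- The class of weight profiles of regularity order `q`, before scaling to width `ε`:
`θ` is `C^(q-1)` (no condition if `q = 0`), has support `[-1, 1]` and integral one, and its
`q`-th derivative is piecewise `C^1`: away from finitely many break points `θ` is `C^(q+1)`, and
at the break points the derivatives of orders `q` and `q + 1` have finite one-sided limits. -/
structure IsWeight (q : ℕ) (θ : ℝ → ℝ) : Prop where
  contDiff : ∀ m : ℕ, m < q → ContDiff ℝ m θ
  support : tsupport θ = Icc (-1) 1
  integral : ∫ s in (-1 : ℝ)..1, θ s = 1
  piecewise : ∃ S : Finset ℝ, ContDiffOn ℝ ((q + 1 : ℕ) : WithTop ℕ∞) θ ((S : Set ℝ)ᶜ) ∧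
    ∀ s ∈ S, ∀ m : ℕ, m = q ∨ m = q + 1 →
      (∃ l : ℝ, Tendsto (iteratedDeriv m θ) (𝓝[<] s) (𝓝 l)) ∧
      (∃ l : ℝ, Tendsto (iteratedDeriv m θ) (𝓝[>] s) (𝓝 l))

/-- The curvature of the set `Γ` vanishes at `z` to order `k - 2`: in a suitable orthonormal frame
with origin `z`, near `z` the set `Γ` is the graph of a function `g` on `[-r, r]` with
`g x = |x| ^ k * H x` (no change of sign of the curvature) or `g x = sgn x * |x| ^ k * H x`
(an inflection point), where `H` is smooth without zeros. -/
def CurvatureVanishesToOrder (Γ : Set Plane) (z : Plane) (k : ℝ) : Prop :=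
  ∃ (e : OrthonormalBasis (Fin 2) ℝ Plane) (r : ℝ) (H g : ℝ → ℝ),
    0 < r ∧ ContDiffOn ℝ ∞ H (Icc (-r) r) ∧ (∀ x ∈ Icc (-r) r, H x ≠ 0) ∧
    ((∀ x ∈ Icc (-r) r, g x = |x| ^ k * H x) ∨
      (∀ x ∈ Icc (-r) r, g x = Real.sign x * |x| ^ k * H x)) ∧
    ∀ᶠ p in 𝓝 z, p ∈ Γ ↔ ∃ x ∈ Icc (-r) r, p = z + x • e 0 + g x • e 1

namespace SmoothClosedCurve

variable (γ : SmoothClosedCurve)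

/-- The curve as a set of points. -/
def carrier : Set Plane := range γ.param

/-- The unit normal at parameter `t`: the unit tangent rotated by `-π / 2`. It is the outward
normal if the parametrization is counterclockwise, and the inward one otherwise. -/
def normal (t : ℝ) : Plane :=
  ‖deriv γ.param t‖⁻¹ • !₂[deriv γ.param t 1, -(deriv γ.param t 0)]

/-- The points of the curve at which the curvature vanishes. -/
def flatPoints : Set Plane := γ.param '' {t | signedCurvature γ.param t = 0}

/-- The curvature vanishes at finitely many points only, to order at most `κ - 2`. -/
def HasFlatPointsOfOrder (κ : ℝ) : Prop :=
  γ.flatPoints.Finite ∧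
    ∀ z ∈ γ.flatPoints, ∃ k : ℝ, 2 < k ∧ k ≤ κ ∧ CurvatureVanishesToOrder γ.carrier z k

/-- The two-sided closed tube of width `ε` about the curve. -/
def tube (ε : ℝ) : Set Plane := {x | Metric.infDist x γ.carrier ≤ ε}

/-- A parameter of a point of the curve nearest to `x`. -/
def footParam (x : Plane) : ℝ :=
  Classical.epsilon fun t => dist x (γ.param t) = Metric.infDist x γ.carrier

/-- The nearest-point projection to the curve. -/
def proj (x : Plane) : Plane := γ.param (γ.footParam x)

/-- The signed distance `n(P x) · (x - P x)`. -/
def signedDist (x : Plane) : ℝ := inner ℝ (γ.normal (γ.footParam x)) (x - γ.proj x)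

/-- The level curve of the signed distance at the value `η`, as a parametrized curve. -/
def levelCurve (η : ℝ) (t : ℝ) : Plane := γ.param t + η • γ.normal t

/-- The Jacobian `1 - η * κ(x)`, with `η` the signed distance of `x` and `κ(x)` the signed
curvature at `x` of the level curve through `x`. -/
def jacobian (x : Plane) : ℝ :=
  1 - γ.signedDist x * signedCurvature (γ.levelCurve (γ.signedDist x)) (γ.footParam x)

/-- The integral of `f` over the curve with respect to arc length. -/
def boundaryIntegral (f : Plane → ℝ) : ℝ :=
  ∫ t in (0 : ℝ)..γ.period, f (γ.param t) * ‖deriv γ.param t‖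

/-- The integrand `f(P x) * θ_ε(d x) * J(x)` with `θ_ε s = ε⁻¹ * θ (ε⁻¹ * s)`. -/
def integrand (f : Plane → ℝ) (θ : ℝ → ℝ) (ε : ℝ) (x : Plane) : ℝ :=
  f (γ.proj x) * (ε⁻¹ * θ (ε⁻¹ * γ.signedDist x)) * γ.jacobian x

/-- The implicit boundary integral quadrature: `h ^ 2` times the sum of the integrand over the
points of the lattice `(h ℤ)²` in the tube of width `ε`. -/
def quadrature (f : Plane → ℝ) (θ : ℝ → ℝ) (ε h : ℝ) : ℝ :=
  h ^ 2 * ∑' n : ℤ × ℤ,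
    (γ.tube ε).indicator (γ.integrand f θ ε) !₂[h * (n.1 : ℝ), h * (n.2 : ℝ)]

end SmoothClosedCurve

end IBIM

end

/-! Extend the summand by zero outside the tube. The result is continuous with compact support,
because `θ` vanishes at `±1`, so Poisson summation turns the lattice sum into the sum over `k ∈ ℤ²`
of the Fourier transform at `k / h`. In the coordinates `γ(t) + η n(t)` the area element is `speed *
(1 + η curv)`, while `J = (1 + η curv)⁻¹`. The two cancel, so the transform is that of arc length
times `f`, smeared along the normal by `θ_ε`. Since `θ` has integral one, the frequency `k = 0`
gives exactly the curve integral; the error is the sum over `k ≠ 0`.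

For a frequency `λ ω` with `|ω| = 1`, split the curve by the normal component `w = ω · n`.

Where `|w|` is small, `ω` has a large tangential component, the phase is nonstationary along the
curve, and integration by parts gives any power of `λ⁻¹` (`exists_norm_integral_far_le`).

Where `|w|` is bounded below, the integral across the tube is the Fourier transform of `θ` at `ε λ
w`. This is `(ε λ w)^(-(q+1))` times the transform of a finite measure on `[-1, 1]`
(`IsWeight.exists_fourier`). For each offset in the support of that measure there remains an
oscillatory integral along a parallel curve. Curvature vanishing to order at most `κ - 2` makes the
tangent turn by at least a multiple of `|s - t|^(κ-1)`, and a van der Corput argument then gives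
`λ^(-1/κ)` uniformly in direction and offset (`exists_norm_integral_near_le`).

Altogether the transform at `k / h` is `O((ε |k| / h)^(-(q+1)) (|k| / h)^(-1/κ))`. This is summable
over `k ≠ 0` because `q + 1 + 1/κ > 2`, so the error is `O(ε^(-(q+1)) h^(q+1+1/κ))`, and `ε ~ h^α`
gives the rate. -/

noncomputable section

namespace IBIM

/-! ### Poisson summation for compactly supported continuous functions. -/

section Poisson

variable {d : Type*}

/-- The half-open unit cube with lower corner `a`. -/
def unitCube (a : d → ℝ) : Set (d → ℝ) := {x | ∀ i, x i ∈ Ioc (a i) (a i + 1)}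

lemma measurableSet_unitCube [Fintype d] (a : d → ℝ) : MeasurableSet (unitCube a) :=
  MeasurableSet.univ_pi' fun _ => measurableSet_Ioc

lemma iUnion_unitCube : ⋃ n : d → ℤ, unitCube (fun i => (n i : ℝ)) = univ := by
  refine eq_univ_of_forall fun x => mem_iUnion.2 ⟨fun i => ⌈x i⌉ - 1, fun i => ⟨?_, ?_⟩⟩
  · push_cast; linarith [Int.ceil_lt_add_one (x i)]
  · push_cast; linarith [Int.le_ceil (x i)]

lemma pairwise_disjoint_unitCube :
    Pairwise (Function.onFun Disjoint fun n : d → ℤ => unitCube (fun i => (n i : ℝ))) := by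
  intro m n hmn
  refine Set.disjoint_left.2 fun x hm hn => hmn (funext fun i => ?_)
  obtain ⟨h1, h2⟩ := hm i
  obtain ⟨h3, h4⟩ := hn i
  have h5 : (m i : ℝ) < n i + 1 := h1.trans_le h4
  have h6 : (n i : ℝ) < m i + 1 := h3.trans_le h2
  norm_cast at h5 h6
  omega

lemma finite_int_vector_norm_le [Fintype d] (M : ℝ) :
    {n : d → ℤ | ‖fun i => (n i : ℝ)‖ ≤ M}.Finite := by
  classical
  refine (Set.finite_Icc (fun _ : d => -⌈M⌉) (fun _ : d => ⌈M⌉)).subset fun n hn => ?_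
  have h : ∀ i, |n i| ≤ ⌈M⌉ := fun i => by
    have h1 : |(n i : ℝ)| ≤ M := (norm_le_pi_norm (fun i => (n i : ℝ)) i).trans hn
    exact_mod_cast h1.trans (Int.le_ceil M)
  exact ⟨fun i => (abs_le.1 (h i)).1, fun i => (abs_le.1 (h i)).2⟩

variable {F : (d → ℝ) → ℂ}

lemma exists_finset_support_translate [Fintype d] (hc : HasCompactSupport F) (R : ℝ) :
    ∃ S : Finset (d → ℤ), ∀ x : d → ℝ, ‖x‖ ≤ R → ∀ n ∉ S, F (x + fun i => (n i : ℝ)) = 0 := by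
  obtain ⟨M, hM⟩ := hc.isCompact.isBounded.exists_norm_le
  refine ⟨(finite_int_vector_norm_le (M + R)).toFinset, fun x hx n hn => ?_⟩
  by_contra h
  have h1 := hM _ (subset_tsupport F h)
  simp only [Finite.mem_toFinset, mem_ofPred_eq, not_le] at hn
  have : ‖fun i => (n i : ℝ)‖ ≤ ‖x + fun i => (n i : ℝ)‖ + ‖x‖ := by
    simpa using norm_sub_le (x + fun i => (n i : ℝ)) x
  linarith

lemma locallyFinite_support_translate [Fintype d] (hc : HasCompactSupport F) :
    LocallyFinite fun n : d → ℤ => Function.support fun x => F (x + fun i => (n i : ℝ)) := by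
  intro x
  obtain ⟨S, hS⟩ := exists_finset_support_translate hc (‖x‖ + 1)
  refine ⟨Metric.ball x 1, Metric.ball_mem_nhds x one_pos, S.finite_toSet.subset ?_⟩
  rintro n ⟨y, hy, hyx⟩
  by_contra hn
  refine hy (hS y ?_ n hn)
  have h1 : ‖y - x‖ < 1 := by simpa [dist_eq_norm] using hyx
  have h2 : ‖y‖ ≤ ‖y - x‖ + ‖x‖ := by simpa using norm_add_le (y - x) x
  linarith

/-- The sum of the translates of a function by integer vectors. -/
def periodization (F : (d → ℝ) → ℂ) (x : d → ℝ) : ℂ :=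
  ∑ᶠ n : d → ℤ, F (x + fun i => (n i : ℝ))

lemma continuous_periodization [Fintype d] (hF : Continuous F) (hc : HasCompactSupport F) :
    Continuous (periodization F) :=
  continuous_finsum (fun _ => hF.comp (by fun_prop)) (locallyFinite_support_translate hc)

lemma periodization_add_int (x : d → ℝ) (m : d → ℤ) :
    periodization F (x + fun i => (m i : ℝ)) = periodization F x := by
  unfold periodization
  refine finsum_eq_of_bijective (fun n => m + n) (Equiv.addLeft m).bijective fun n => ?_
  congr 1
  ext i
  simp [add_assoc]

lemma periodization_congr {x y : d → ℝ}
    (h : ∀ i, (x i : UnitAddCircle) = (y i : UnitAddCircle)) :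
    periodization F x = periodization F y := by
  have h1 : ∀ i, ∃ n : ℤ, y i + n = x i := fun i => by
    have h0 : ((x i - y i : ℝ) : UnitAddCircle) = 0 := by
      rw [AddCircle.coe_sub, h i, sub_self]
    obtain ⟨n, hn⟩ := (AddCircle.coe_eq_zero_iff 1).1 h0
    refine ⟨n, ?_⟩
    rw [zsmul_one] at hn
    linarith
  choose n hn using h1
  rw [← periodization_add_int y n]
  congr 1
  ext i
  exact (hn i).symm

lemma isOpenQuotientMap_coe_torus :
    IsOpenQuotientMap (fun (x : d → ℝ) (i : d) => (x i : UnitAddCircle)) :=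
  IsOpenQuotientMap.piMap (f := fun (_ : d) (t : ℝ) => (t : UnitAddCircle)) fun _ =>
    QuotientAddGroup.isOpenQuotientMap_mk

/-- An integer-periodic function factors through the quotient map from `ℝ^d` to the torus, and
continuity descends along a quotient map. -/
lemma exists_torus_periodization [Fintype d] (hF : Continuous F) (hc : HasCompactSupport F) :
    ∃ g : C(UnitAddTorus d, ℂ), ∀ x : d → ℝ,
      g (fun i => (x i : UnitAddCircle)) = periodization F x := by
  have hq := isOpenQuotientMap_coe_torus (d := d)
  have key : ∀ x, periodization F (Function.surjInv hq.surjective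
      (fun i => (x i : UnitAddCircle))) = periodization F x := fun x =>
    periodization_congr fun i =>
      congrFun (Function.surjInv_eq hq.surjective (fun i => (x i : UnitAddCircle))) i
  refine ⟨⟨fun z => periodization F (Function.surjInv hq.surjective z), ?_⟩, key⟩
  rw [hq.isQuotientMap.continuous_iff]
  exact (continuous_periodization hF hc).congr fun x => (key x).symm

/-- The character `x ↦ exp (-2 π i k · x)` of the lattice dual vector `k`. -/
def latticeChar [Fintype d] (k : d → ℤ) (x : d → ℝ) : ℂ :=
  Complex.exp (-(2 * Real.pi * Complex.I * ∑ i, (k i : ℂ) * (x i : ℂ)))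

lemma mFourier_neg_coe [Fintype d] (k : d → ℤ) (x : d → ℝ) :
    UnitAddTorus.mFourier (-k) (fun i => (x i : UnitAddCircle)) = latticeChar k x := by
  simp only [UnitAddTorus.mFourier, ContinuousMap.coe_mk, latticeChar, fourier_coe_apply]
  rw [← Complex.exp_sum, Finset.mul_sum, ← Finset.sum_neg_distrib]
  congr 1
  refine Finset.sum_congr rfl fun i _ => ?_
  simp
  ring

lemma latticeChar_add_int [Fintype d] (k : d → ℤ) (x : d → ℝ) (n : d → ℤ) :
    latticeChar k (x + fun i => (n i : ℝ)) = latticeChar k x := by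
  rw [← mFourier_neg_coe, ← mFourier_neg_coe]
  congr 1
  ext i
  simp

lemma continuous_latticeChar [Fintype d] (k : d → ℤ) : Continuous (latticeChar k) := by
  unfold latticeChar
  fun_prop

/-- Unfolding: the unit cubes at integer corners tile `ℝ^d` and the character is integer-periodic,
so integrating the sum of translates over one cube is integrating `F` over the whole space. Only
finitely many translates meet the cube. -/
lemma mFourierCoeff_periodization [Fintype d] (hF : Continuous F) (hc : HasCompactSupport F)
    {g : C(UnitAddTorus d, ℂ)}
    (hg : ∀ x : d → ℝ, g (fun i => (x i : UnitAddCircle)) = periodization F x) (k : d → ℤ) :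
    UnitAddTorus.mFourierCoeff g k = ∫ x, latticeChar k x * F x := by
  have hi : Integrable fun x => latticeChar k x * F x :=
    ((continuous_latticeChar k).mul hF).integrable_of_hasCompactSupport hc.mul_left
  obtain ⟨S, hS⟩ := exists_finset_support_translate hc 1
  have hnorm : ∀ x ∈ unitCube (fun _ : d => (0 : ℝ)), ‖x‖ ≤ 1 := fun x hx => by
    refine (pi_norm_le_iff_of_nonneg zero_le_one).2 fun i => ?_
    obtain ⟨h1, h2⟩ := hx i
    rw [Real.norm_eq_abs, abs_le]
    constructor <;> linarith
  have htrans : ∀ n : d → ℤ, ∫ x in unitCube (fun i => (n i : ℝ)), latticeChar k x * F x =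
      ∫ x in unitCube (fun _ => (0 : ℝ)), latticeChar k x * F (x + fun i => (n i : ℝ)) := by
    intro n
    rw [← integral_indicator (measurableSet_unitCube _),
      ← integral_indicator (measurableSet_unitCube _),
      ← integral_add_right_eq_self _ (fun i => (n i : ℝ))]
    congr 1
    ext x
    have : x + (fun i => (n i : ℝ)) ∈ unitCube (fun i => (n i : ℝ)) ↔
        x ∈ unitCube (fun _ => (0 : ℝ)) := by
      refine forall_congr' fun i => ?_
      simp only [mem_Ioc, Pi.add_apply]
      constructor <;> rintro ⟨h1, h2⟩ <;> constructor <;> linarith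
    by_cases hx : x ∈ unitCube (fun _ => (0 : ℝ))
    · rw [indicator_of_mem hx, indicator_of_mem (this.2 hx), latticeChar_add_int]
    · rw [indicator_of_notMem hx, indicator_of_notMem (mt this.1 hx)]
  rw [UnitAddTorus.mFourierCoeff_eq_integral _ _ (fun _ => 0),
    ← setIntegral_univ (f := fun x => latticeChar k x * F x), ← iUnion_unitCube, integral_iUnion (fun n => measurableSet_unitCube _)
      pairwise_disjoint_unitCube hi.integrableOn]
  simp_rw [htrans]
  have hzero : ∀ n ∉ S, ∫ x in unitCube (fun _ => (0 : ℝ)),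
      latticeChar k x * F (x + fun i => (n i : ℝ)) = 0 := fun n hn => by
    rw [setIntegral_congr_fun (measurableSet_unitCube _) (g := fun _ => (0 : ℂ))
      (fun x hx => by simp [hS x (hnorm x hx) n hn])]
    simp
  rw [tsum_eq_sum hzero, ← integral_finsetSum]
  · refine setIntegral_congr_fun (measurableSet_unitCube _) fun x hx => ?_
    simp only [mFourier_neg_coe, hg, smul_eq_mul]
    rw [← Finset.mul_sum]
    congr 1
    refine finsum_eq_sum_of_support_subset _ fun n hn => ?_
    by_contra h
    exact hn (hS x (hnorm x hx) n h)
  · intro n _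
    refine Integrable.integrableOn ?_
    exact ((continuous_latticeChar k).mul (hF.comp (by fun_prop))).integrable_of_hasCompactSupport
      (hc.comp_homeomorph (Homeomorph.addRight (fun i => (n i : ℝ)))).mul_left

/-- Poisson summation for continuous functions with compact support on `ℝ^d`. -/
theorem hasSum_integral_latticeChar [Fintype d] (hF : Continuous F) (hc : HasCompactSupport F)
    (hs : Summable fun k : d → ℤ => ∫ x, latticeChar k x * F x) :
    HasSum (fun k : d → ℤ => ∫ x, latticeChar k x * F x)
      (∑' n : d → ℤ, F (fun i => (n i : ℝ))) := by
  obtain ⟨g, hg⟩ := exists_torus_periodization hF hc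
  have hco : UnitAddTorus.mFourierCoeff g = fun k : d → ℤ => ∫ x, latticeChar k x * F x :=
    funext fun k => mFourierCoeff_periodization hF hc hg k
  -- With summable coefficients the Fourier series of the periodization converges pointwise; its
  -- value at the origin is the lattice sum.
  have h := UnitAddTorus.hasSum_mFourier_series_apply_of_summable (f := g) (by rwa [hco])
    (fun i => ((0 : ℝ) : UnitAddCircle))
  rw [hg (fun _ => 0), hco] at h
  obtain ⟨S, hS⟩ := exists_finset_support_translate hc 0
  have hS' : ∀ n ∉ S, F (fun i => (n i : ℝ)) = 0 := fun n hn => by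
    have := hS 0 (by simp) n hn
    rwa [zero_add] at this
  have e : periodization F (fun _ => 0) = ∑' n : d → ℤ, F (fun i => (n i : ℝ)) := by
    rw [tsum_eq_finsum (S.finite_toSet.subset fun n hn => by
      by_contra h; exact hn (hS' n h))]
    unfold periodization
    refine finsum_congr fun n => ?_
    congr 1
    ext i
    simp
  rw [e] at h
  convert h using 2 with k
  simp [UnitAddTorus.mFourier]

end Poisson

/-! ### Piecewise smooth functions against exponentials. -/

/-- An interval property that is additive and holds locally on both sides of every point holds
for all intervals. -/
lemma interval_induction {P : ℝ → ℝ → Prop}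
    (hadd : ∀ a b c, a ≤ b → b ≤ c → P a b → P b c → P a c)
    (hloc : ∀ x, ∃ r > 0, (∀ a, x - r < a → a ≤ x → P a x) ∧ ∀ b, x ≤ b → b < x + r → P x b)
    {a b : ℝ} (hab : a ≤ b) : P a b := by
  set A := {x | x ∈ Icc a b ∧ P a x} with hA
  have haa : a ∈ A := by
    obtain ⟨r, hr, -, h⟩ := hloc a
    exact ⟨left_mem_Icc.2 hab, h a le_rfl (by linarith)⟩
  have hbdd : BddAbove A := ⟨b, fun x hx => hx.1.2⟩
  have has : a ≤ sSup A := le_csSup hbdd haa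
  have hsb : sSup A ≤ b := csSup_le ⟨a, haa⟩ fun x hx => hx.1.2
  obtain ⟨r, hr, hl, hrt⟩ := hloc (sSup A)
  obtain ⟨x, hx, hxs⟩ := exists_lt_of_lt_csSup ⟨a, haa⟩ (show sSup A - r < sSup A by linarith)
  have hx' : x ≤ sSup A := le_csSup hbdd hx
  have hs : P a (sSup A) := hadd a x _ hx.1.1 hx' hx.2 (hl x hxs hx')
  rcases hsb.eq_or_lt with h | h
  · rwa [h] at hs
  · exfalso
    set y := min b (sSup A + r / 2)
    have hy : sSup A < y := lt_min h (by linarith)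
    have hy' : y < sSup A + r := (min_le_right _ _).trans_lt (by linarith)
    have : y ∈ A := ⟨⟨has.trans hy.le, min_le_left _ _⟩, hadd a _ y has hy.le hs (hrt y hy.le hy')⟩
    exact absurd (le_csSup hbdd this) (not_le.2 hy)

/-- The complex number `exp (i x)` for real `x`. -/
def cis (x : ℝ) : ℂ := Complex.exp (x * Complex.I)

@[simp] lemma norm_cis (x : ℝ) : ‖cis x‖ = 1 := Complex.norm_exp_ofReal_mul_I x

lemma cis_add (x y : ℝ) : cis (x + y) = cis x * cis y := by
  simp [cis, add_mul, Complex.exp_add]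

@[fun_prop] lemma continuous_cis : Continuous cis := by unfold cis; fun_prop

lemma hasDerivAt_cis {φ : ℝ → ℝ} {φ' t : ℝ} (h : HasDerivAt φ φ' t) :
    HasDerivAt (fun s => cis (φ s)) (Complex.I * φ' * cis (φ t)) t := by
  unfold cis
  convert! (h.ofReal_comp.mul_const Complex.I).cexp using 1
  ring

/-- The two one-sided limits of `G` at `x` exist. -/
def HasOneSidedLimits (G : ℝ → ℝ) (x : ℝ) : Prop :=
  (∃ l : ℝ, Tendsto G (𝓝[<] x) (𝓝 l)) ∧ ∃ l : ℝ, Tendsto G (𝓝[>] x) (𝓝 l)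

lemma _root_.ContinuousAt.hasOneSidedLimits {G : ℝ → ℝ} {x : ℝ} (h : ContinuousAt G x) :
    HasOneSidedLimits G x :=
  ⟨⟨G x, h.mono_left nhdsWithin_le_nhds⟩, ⟨G x, h.mono_left nhdsWithin_le_nhds⟩⟩

lemma intervalIntegrable_ofReal {G : ℝ → ℝ} {a b : ℝ} (h : IntervalIntegrable G volume a b) :
    IntervalIntegrable (fun s => (G s : ℂ)) volume a b :=
  ⟨h.1.ofReal, h.2.ofReal⟩

lemma intervalIntegrable_of_tendsto {G : ℝ → ℝ} {a b la lb : ℝ} (hab : a ≤ b)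
    (hc : ContinuousOn G (Ioo a b)) (ha : Tendsto G (𝓝[>] a) (𝓝 la))
    (hb : Tendsto G (𝓝[<] b) (𝓝 lb)) : IntervalIntegrable G volume a b := by
  have h := continuousOn_Icc_extendFrom_Ioo hc ha hb
  rw [← uIcc_of_le hab] at h
  refine h.intervalIntegrable.congr_uIoo fun x hx => ?_
  rw [uIoo_of_le hab] at hx
  exact extendFrom_extends hc x hx

lemma exists_forall_notMem_finset (S : Finset ℝ) (x : ℝ) :
    ∃ r > 0, ∀ y, x - r < y → y < x + r → y ≠ x → y ∉ S := by
  have h : ((S.erase x : Finset ℝ) : Set ℝ)ᶜ ∈ 𝓝 x :=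
    (Finset.finite_toSet _).isClosed.isOpen_compl.mem_nhds (by simp)
  obtain ⟨r, hr, hS⟩ := Metric.mem_nhds_iff.1 h
  refine ⟨r, hr, fun y h1 h2 h3 h4 => ?_⟩
  have := hS (show y ∈ Metric.ball x r by
    rw [Metric.mem_ball, Real.dist_eq, abs_lt]; constructor <;> linarith)
  simp [h3, h4] at this

section Piecewise

variable {S : Finset ℝ} {G : ℝ → ℝ}

lemma intervalIntegrable_of_piecewise (hc : ∀ x ∉ S, ContinuousAt G x)
    (hl : ∀ x, HasOneSidedLimits G x) {a b : ℝ} (hab : a ≤ b) :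
    IntervalIntegrable G volume a b := by
  refine interval_induction (P := fun a b => IntervalIntegrable G volume a b)
    (fun a b c _ _ h1 h2 => h1.trans h2) (fun x => ?_) hab
  obtain ⟨r, hr, hS⟩ := exists_forall_notMem_finset S x
  refine ⟨r, hr, fun a h1 h2 => ?_, fun b h1 h2 => ?_⟩
  · obtain ⟨l, h⟩ := (hl x).1
    obtain ⟨m, h'⟩ := (hl a).2
    refine intervalIntegrable_of_tendsto h2 (fun y hy => ?_) h' h
    exact (hc y (hS y (h1.trans hy.1) (by linarith [hy.2]) hy.2.ne)).continuousWithinAt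
  · obtain ⟨l, h⟩ := (hl x).2
    obtain ⟨m, h'⟩ := (hl b).1
    refine intervalIntegrable_of_tendsto h1 (fun y hy => ?_) h h'
    exact (hc y (hS y (by linarith [hy.1]) (hy.2.trans h2) hy.1.ne')).continuousWithinAt

/-- The boundary terms are the one-sided limits, which may differ from the values of `G` at the
endpoints. -/
lemma integral_mul_cis_of_tendsto {G' : ℝ → ℝ} {a b la lb y : ℝ} (hab : a < b)
    (hd : ∀ x ∈ Ioo a b, HasDerivAt G (G' x) x)
    (hG : IntervalIntegrable G volume a b) (hG' : IntervalIntegrable G' volume a b)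
    (ha : Tendsto G (𝓝[>] a) (𝓝 la)) (hb : Tendsto G (𝓝[<] b) (𝓝 lb)) :
    Complex.I * y * ∫ s in a..b, (G s : ℂ) * cis (y * s) =
      lb * cis (y * b) - la * cis (y * a) - ∫ s in a..b, (G' s : ℂ) * cis (y * s) := by
  have hcis : Continuous fun s => cis (y * s) := by fun_prop
  have hiG : IntervalIntegrable (fun s => (G s : ℂ) * cis (y * s)) volume a b :=
    (intervalIntegrable_ofReal hG).mul_continuousOn hcis.continuousOn
  have hiG' : IntervalIntegrable (fun s => (G' s : ℂ) * cis (y * s)) volume a b :=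
    (intervalIntegrable_ofReal hG').mul_continuousOn hcis.continuousOn
  have hder : ∀ x ∈ Ioo a b, HasDerivAt (fun s => (G s : ℂ) * cis (y * s))
      ((G' x : ℂ) * cis (y * x) + Complex.I * y * ((G x : ℂ) * cis (y * x))) x := fun x hx => by
    have h1 : HasDerivAt (fun s => y * s) y x := by simpa using (hasDerivAt_id x).const_mul y
    convert! (hd x hx).ofReal_comp.mul (hasDerivAt_cis h1) using 1
    ring
  have hlim : ∀ {c l : ℝ} {f : Filter ℝ}, f ≤ 𝓝 c → Tendsto G f (𝓝 l) →
      Tendsto (fun s => (G s : ℂ) * cis (y * s)) f (𝓝 (l * cis (y * c))) := fun hf h =>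
    ((Complex.continuous_ofReal.tendsto _).comp h).mul (hcis.continuousAt.mono_left hf)
  have := intervalIntegral.integral_eq_sub_of_hasDerivAt_of_tendsto hab hder
    (hiG'.add (hiG.const_mul _)) (hlim nhdsWithin_le_nhds ha) (hlim nhdsWithin_le_nhds hb)
  rw [intervalIntegral.integral_add hiG' (hiG.const_mul _),
    intervalIntegral.integral_const_mul] at this
  linear_combination this

/-- Integration by parts against an exponential for a piecewise `C^1` function: the jumps give
a finite exponential sum. -/
lemma exists_jumps_integral_mul_cis {G' : ℝ → ℝ} (hd : ∀ x ∉ S, HasDerivAt G (G' x) x)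
    (hc : ∀ x ∉ S, ContinuousAt G' x) (hl : ∀ x, HasOneSidedLimits G x)
    (hl' : ∀ x, HasOneSidedLimits G' x) {a b : ℝ} (hab : a ≤ b) :
    ∃ c : ℝ →₀ ℂ, (∀ s ∈ c.support, s ∈ Icc a b) ∧ ∀ y : ℝ,
      Complex.I * y * ∫ s in a..b, (G s : ℂ) * cis (y * s) =
        (c.sum fun s z => z * cis (y * s)) - ∫ s in a..b, (G' s : ℂ) * cis (y * s) := by
  classical
  have hiG : ∀ {a b : ℝ}, a ≤ b → IntervalIntegrable G volume a b := fun h =>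
    intervalIntegrable_of_piecewise (fun x hx => (hd x hx).continuousAt) hl h
  have hiG' : ∀ {a b : ℝ}, a ≤ b → IntervalIntegrable G' volume a b := fun h =>
    intervalIntegrable_of_piecewise hc hl' h
  have hcis : ∀ y, Continuous fun s => cis (y * s) := fun y => by fun_prop
  have key : ∀ {a b : ℝ}, a ≤ b → (∀ x ∈ Ioo a b, x ∉ S) →
      ∃ c : ℝ →₀ ℂ, (∀ s ∈ c.support, s ∈ Icc a b) ∧ ∀ y : ℝ,
      Complex.I * y * ∫ s in a..b, (G s : ℂ) * cis (y * s) =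
        (c.sum fun s z => z * cis (y * s)) - ∫ s in a..b, (G' s : ℂ) * cis (y * s) := by
    intro a b hab hS
    rcases hab.eq_or_lt with rfl | hlt
    · exact ⟨0, by simp, by simp⟩
    obtain ⟨la, ha⟩ := (hl a).2
    obtain ⟨lb, hb⟩ := (hl b).1
    -- The atoms left at a common endpoint by two adjacent pieces add up to the jump of `G` there.
    refine ⟨Finsupp.single b (lb : ℂ) + Finsupp.single a (-la : ℂ), fun s hs => ?_, fun y => ?_⟩
    · rcases Finset.mem_union.1 (Finsupp.support_add hs) with h | h
      · rw [Finset.mem_singleton.1 (Finsupp.support_single_subset h)]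
        exact right_mem_Icc.2 hab
      · rw [Finset.mem_singleton.1 (Finsupp.support_single_subset h)]
        exact left_mem_Icc.2 hab
    · rw [integral_mul_cis_of_tendsto hlt (fun x hx => hd x (hS x hx)) (hiG hab) (hiG' hab) ha hb,
        Finsupp.sum_add_index' (by simp) (by intros; ring), Finsupp.sum_single_index (by simp),
        Finsupp.sum_single_index (by simp)]
      ring
  -- Locally each side of a point is free of break points, so the break points need not be put in
  -- order.
  refine interval_induction (P := fun a b =>
      ∃ c : ℝ →₀ ℂ, (∀ s ∈ c.support, s ∈ Icc a b) ∧ ∀ y : ℝ,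
      Complex.I * y * ∫ s in a..b, (G s : ℂ) * cis (y * s) =
        (c.sum fun s z => z * cis (y * s)) - ∫ s in a..b, (G' s : ℂ) * cis (y * s)) ?_ ?_ hab
  · rintro a b c hab hbc ⟨c₁, hs₁, h₁⟩ ⟨c₂, hs₂, h₂⟩
    refine ⟨c₁ + c₂, fun s hs => ?_, fun y => ?_⟩
    · rcases Finset.mem_union.1 (Finsupp.support_add hs) with h | h
      · exact Icc_subset_Icc_right hbc (hs₁ s h)
      · exact Icc_subset_Icc_left hab (hs₂ s h)
    · have hm : ∀ {g : ℝ → ℝ} {a b : ℝ}, IntervalIntegrable g volume a b →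
          IntervalIntegrable (fun s => (g s : ℂ) * cis (y * s)) volume a b := fun h =>
        (intervalIntegrable_ofReal h).mul_continuousOn (hcis y).continuousOn
      rw [← intervalIntegral.integral_add_adjacent_intervals (hm (hiG hab)) (hm (hiG hbc)),
        ← intervalIntegral.integral_add_adjacent_intervals (hm (hiG' hab)) (hm (hiG' hbc)),
        Finsupp.sum_add_index' (by simp) (by intros; ring), mul_add, h₁, h₂]
      ring
  · intro x
    obtain ⟨r, hr, hS⟩ := exists_forall_notMem_finset S x
    refine ⟨r, hr, fun a h1 h2 => key h2 fun y hy => ?_, fun b h1 h2 => key h1 fun y hy => ?_⟩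
    · exact hS y (h1.trans hy.1) (by linarith [hy.2]) hy.2.ne
    · exact hS y (by linarith [hy.1]) (hy.2.trans h2) hy.1.ne'

end Piecewise

/-! ### Fourier decay of the weights. -/

namespace IsWeight

variable {q : ℕ} {θ : ℝ → ℝ}

lemma continuous (h : IsWeight q θ) (hq : 1 ≤ q) : Continuous θ :=
  (h.contDiff 0 (by omega)).continuous

lemma eq_zero_of_notMem (h : IsWeight q θ) {s : ℝ} (hs : s ∉ Icc (-1 : ℝ) 1) : θ s = 0 := by
  rw [← h.support] at hs
  exact image_eq_zero_of_notMem_tsupport hs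

/-- Derivatives of order below `q` are continuous and vanish for `|s| > 1`, hence also at `±1`. This
removes the boundary terms of the first `q` integrations by parts. -/
lemma iteratedDeriv_eq_zero (h : IsWeight q θ) {m : ℕ} (hm : m < q) {s : ℝ} (hs : 1 ≤ |s|) :
    iteratedDeriv m θ s = 0 := by
  have hcl : IsClosed {s | iteratedDeriv m θ s = 0} :=
    isClosed_eq ((h.contDiff m hm).continuous_iteratedDeriv' m) continuous_const
  have hout : ∀ s ∈ {s : ℝ | 1 < |s|}, iteratedDeriv m θ s = 0 := fun s hs => by
    have : EqOn θ (fun _ => 0) {s : ℝ | 1 < |s|} := fun x hx =>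
      h.eq_zero_of_notMem fun hx' => absurd (abs_le.2 hx') (not_le.2 hx)
    have h2 := this.iteratedDeriv_of_isOpen (isOpen_lt continuous_const continuous_abs) m hs
    simpa using h2
  have hmem : s ∈ closure {s : ℝ | 1 < |s|} := by
    rw [Metric.mem_closure_iff]
    intro δ hδ
    have h0 : s ≠ 0 := by rintro rfl; norm_num at hs
    refine ⟨s + SignType.sign s * (δ / 2), ?_, ?_⟩
    · rcases h0.lt_or_gt with h1 | h1
      · rw [abs_of_neg h1] at hs
        simp only [mem_ofPred_eq, sign_neg h1]
        rw [abs_of_neg] <;> norm_num <;> linarith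
      · rw [abs_of_pos h1] at hs
        simp only [mem_ofPred_eq, sign_pos h1]
        rw [abs_of_pos] <;> norm_num <;> linarith
    · rcases h0.lt_or_gt with h1 | h1
      · simp [sign_neg h1, abs_of_pos hδ]; linarith
      · simp [sign_pos h1, abs_of_pos hδ]; linarith
  exact closure_minimal hout hcl hmem

/-- The Fourier transform of a weight of order `q` is `y ^ (-(q + 1))` times that of a finite
measure. -/
theorem exists_fourier (h : IsWeight q θ) (hq : 1 ≤ q) :
    ∃ (c : ℝ →₀ ℂ) (V : ℝ → ℂ), (∀ s ∈ c.support, s ∈ Icc (-1 : ℝ) 1) ∧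
      IntervalIntegrable V volume (-1) 1 ∧ ∀ y : ℝ, y ≠ 0 →
        ∫ s in (-1 : ℝ)..1, (θ s : ℂ) * cis (y * s) = ((y : ℂ) ^ (q + 1))⁻¹ *
          ((c.sum fun s z => z * cis (y * s)) + ∫ s in (-1 : ℝ)..1, V s * cis (y * s)) := by
  obtain ⟨S, hS, hlim⟩ := h.piecewise
  have hopen : IsOpen ((S : Set ℝ)ᶜ) := S.finite_toSet.isClosed.isOpen_compl
  have hder : ∀ m ≤ q, ∀ x ∉ S,
      HasDerivAt (iteratedDeriv m θ) (iteratedDeriv (m + 1) θ x) x := fun m hm x hx => by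
    have h1 := hS.differentiableOn_iteratedDerivWithin (m := m)
      (by exact_mod_cast Nat.lt_succ_of_le hm) hopen.uniqueDiffOn
    have h2 := (h1.congr fun y hy => (iteratedDerivWithin_of_isOpen hopen hy).symm).differentiableAt
      (hopen.mem_nhds hx)
    rw [iteratedDeriv_succ]
    exact h2.hasDerivAt
  have hcont : ∀ x ∉ S, ContinuousAt (iteratedDeriv (q + 1) θ) x := fun x hx => by
    have h1 := hS.continuousOn_iteratedDerivWithin (m := q + 1) le_rfl hopen.uniqueDiffOn
    exact (h1.congr fun y hy => (iteratedDerivWithin_of_isOpen hopen hy).symm).continuousAt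
      (hopen.mem_nhds hx)
  have hl : ∀ x, HasOneSidedLimits (iteratedDeriv q θ) x := fun x => by
    by_cases hx : x ∈ S
    · exact hlim x hx q (Or.inl rfl)
    · exact (hder q le_rfl x hx).continuousAt.hasOneSidedLimits
  have hl' : ∀ x, HasOneSidedLimits (iteratedDeriv (q + 1) θ) x := fun x => by
    by_cases hx : x ∈ S
    · exact hlim x hx (q + 1) (Or.inr rfl)
    · exact (hcont x hx).hasOneSidedLimits
  have h11 : (-1 : ℝ) ≤ 1 := by norm_num
  have hint : ∀ m ≤ q, IntervalIntegrable (iteratedDeriv m θ) volume (-1) 1 := fun m hm => by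
    rcases hm.eq_or_lt with rfl | hm
    · exact intervalIntegrable_of_piecewise (fun x hx => (hder _ le_rfl x hx).continuousAt) hl h11
    · exact ((h.contDiff m hm).continuous_iteratedDeriv' m).intervalIntegrable _ _
  -- At `m = q - 1` the function is continuous everywhere but differentiable only off `S`, so the
  -- fundamental theorem with a countable exceptional set is needed.
  have hstep : ∀ m < q, ∀ y : ℝ,
      Complex.I * y * ∫ s in (-1 : ℝ)..1, ((iteratedDeriv m θ s : ℝ) : ℂ) * cis (y * s) =
        -∫ s in (-1 : ℝ)..1, ((iteratedDeriv (m + 1) θ s : ℝ) : ℂ) * cis (y * s) := fun m hm y => by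
    have hcis : Continuous fun s => cis (y * s) := by fun_prop
    have hi : ∀ m ≤ q, IntervalIntegrable
        (fun s => ((iteratedDeriv m θ s : ℝ) : ℂ) * cis (y * s)) volume (-1) 1 := fun m hm =>
      (intervalIntegrable_ofReal (hint m hm)).mul_continuousOn hcis.continuousOn
    have hco : Continuous fun s => ((iteratedDeriv m θ s : ℝ) : ℂ) * cis (y * s) :=
      (Complex.continuous_ofReal.comp ((h.contDiff m hm).continuous_iteratedDeriv' m)).mul hcis
    have := integral_eq_of_hasDerivAt_off_countable
      (fun s => ((iteratedDeriv m θ s : ℝ) : ℂ) * cis (y * s))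
      (fun s => ((iteratedDeriv (m + 1) θ s : ℝ) : ℂ) * cis (y * s) +
        Complex.I * y * (((iteratedDeriv m θ s : ℝ) : ℂ) * cis (y * s)))
      S.countable_toSet (a := -1) (b := 1) hco.continuousOn (fun x hx => by
        have h1 : HasDerivAt (fun s => y * s) y x := by simpa using (hasDerivAt_id x).const_mul y
        convert! (hder m hm.le x hx.2).ofReal_comp.mul (hasDerivAt_cis h1) using 1
        ring) ((hi (m + 1) hm).add ((hi m hm.le).const_mul _))
    rw [intervalIntegral.integral_add (hi (m + 1) hm) ((hi m hm.le).const_mul _),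
      intervalIntegral.integral_const_mul, h.iteratedDeriv_eq_zero hm (by norm_num),
      h.iteratedDeriv_eq_zero hm (by norm_num)] at this
    simp only [Complex.ofReal_zero, zero_mul, sub_zero] at this
    linear_combination this
  have hpow : ∀ m ≤ q, ∀ y : ℝ,
      (Complex.I * y) ^ m * ∫ s in (-1 : ℝ)..1, (θ s : ℂ) * cis (y * s) =
        (-1) ^ m * ∫ s in (-1 : ℝ)..1, ((iteratedDeriv m θ s : ℝ) : ℂ) * cis (y * s) := fun m => by
    induction m with
    | zero => intro _ y; simp
    | succ m ih =>
      intro hm y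
      have h1 := ih (by omega) y
      have h2 := hstep m (by omega) y
      rw [pow_succ', mul_assoc, h1, pow_succ]
      linear_combination (-1) ^ m * h2
  obtain ⟨c, hc, hcy⟩ := exists_jumps_integral_mul_cis (hder q le_rfl) hcont hl hl' h11
  -- `A` collects the sign from the first `q` integrations by parts and the factor `i^(q+1)` from
  -- all `q + 1`; the last one produces the jumps of the `q`-th derivative and the density `-A
  -- θ^(q+1)`.
  set A : ℂ := (-1) ^ q / Complex.I ^ (q + 1) with hA
  refine ⟨A • c, fun s => -A * ((iteratedDeriv (q + 1) θ s : ℝ) : ℂ), fun s hs =>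
    hc s (Finsupp.support_smul hs),
    (intervalIntegrable_ofReal (intervalIntegrable_of_piecewise hcont hl' h11)).const_mul _, fun y hy => ?_⟩
  have h1 := hpow q le_rfl y
  have h2 := hcy y
  have hI : Complex.I ^ (q + 1) ≠ 0 := pow_ne_zero _ Complex.I_ne_zero
  have hy' : (y : ℂ) ^ (q + 1) ≠ 0 := pow_ne_zero _ (Complex.ofReal_ne_zero.2 hy)
  have h3 : (∫ s in (-1 : ℝ)..1, -A * ((iteratedDeriv (q + 1) θ s : ℝ) : ℂ) * cis (y * s)) =
      -A * ∫ s in (-1 : ℝ)..1, ((iteratedDeriv (q + 1) θ s : ℝ) : ℂ) * cis (y * s) := by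
    rw [← intervalIntegral.integral_const_mul]
    congr 1
    ext s
    ring
  have h4 : ((A • c).sum fun s z => z * cis (y * s)) = A * c.sum fun s z => z * cis (y * s) := by
    rw [Finsupp.sum_smul_index' (by simp), Finsupp.mul_sum]
    simp [mul_assoc]
  rw [h3, h4, eq_inv_mul_iff_mul_eq₀ hy', hA]
  field_simp
  have h5 : (y : ℂ) ^ (q + 1) * Complex.I ^ (q + 1) = (Complex.I * y) * (Complex.I * y) ^ q := by
    rw [← mul_pow, ← pow_succ', mul_comm]
  linear_combination (Complex.I * y) * h1 + (-1) ^ q * h2 +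
    (∫ s in (-1 : ℝ)..1, (θ s : ℂ) * cis (y * s)) * h5

end IsWeight

/-! ### A van der Corput estimate. -/

section VanDerCorput

variable {u u' B B' m Φ : ℝ → ℝ} {M δ lam σ : ℝ}

/-- Since `Φ' = m u`, the integrand is `B / u` times the derivative of `cis (lam * Φ)`, up to `i
lam`. After integrating by parts, the boundary contributes `2 M / δ`, the derivative of `B`
contributes `M (d - c) / δ`, and the variation of `1 / u` contributes `2 M / δ`. That variation is
bounded without any bound on `u'`, because `u` is monotone. -/
lemma norm_integral_cis_le_of_le_abs (hu : ∀ t, HasDerivAt u (u' t) t)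
    (hB : ∀ t, HasDerivAt B (B' t) t) (hΦ : ∀ t, HasDerivAt Φ (m t * u t) t)
    (hu' : Continuous u') (hB' : Continuous B') (hm : Continuous m) (hδ : 0 < δ) (hlam : 0 < lam)
    {c d : ℝ} (hcd : c ≤ d) (hM : ∀ t ∈ Icc c d, |B t| ≤ M) (hM' : ∀ t ∈ Icc c d, |B' t| ≤ M)
    (hσ : |σ| ≤ 1) (hmono : ∀ t ∈ Icc c d, |u' t| ≤ σ * u' t) (hlow : ∀ t ∈ Ioo c d, δ ≤ |u t|) :
    ‖∫ t in c..d, ((B t * m t : ℝ) : ℂ) * cis (lam * Φ t)‖ ≤ M * (4 + (d - c)) / (lam * δ) := by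
  have hM0 : 0 ≤ M := (abs_nonneg _).trans (hM c (left_mem_Icc.2 hcd))
  rcases hcd.eq_or_lt with rfl | hlt
  · simp only [intervalIntegral.integral_same, norm_zero]
    positivity
  have hcu : Continuous u := continuous_iff_continuousAt.2 fun t => (hu t).continuousAt
  have hcB : Continuous B := continuous_iff_continuousAt.2 fun t => (hB t).continuousAt
  have hcΦ : Continuous Φ := continuous_iff_continuousAt.2 fun t => (hΦ t).continuousAt
  have hlow' : ∀ t ∈ Icc c d, δ ≤ |u t| := by
    rw [← closure_Ioo hlt.ne]
    exact closure_minimal hlow (isClosed_le continuous_const hcu.abs)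
  have hu0 : ∀ t ∈ Icc c d, u t ≠ 0 := fun t ht h0 => by
    have := hlow' t ht
    rw [h0, abs_zero] at this
    linarith
  have huIcc : uIcc c d = Icc c d := uIcc_of_le hcd
  set g : ℝ → ℝ := fun t => B' t / u t - B t * u' t / u t ^ 2 with hg
  have hgc : ContinuousOn g (uIcc c d) := by
    rw [huIcc]
    refine ContinuousOn.sub (hB'.continuousOn.div hcu.continuousOn hu0) ?_
    exact (hcB.mul hu').continuousOn.div (hcu.pow 2).continuousOn fun t ht => pow_ne_zero 2 (hu0 t ht)
  have hcisc : Continuous fun t => cis (lam * Φ t) := by fun_prop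
  have hi1 : IntervalIntegrable (fun t => (g t : ℂ) * cis (lam * Φ t)) volume c d :=
    ((Complex.continuous_ofReal.comp_continuousOn hgc).mul hcisc.continuousOn).intervalIntegrable
  have hi2 : IntervalIntegrable (fun t => ((B t * m t : ℝ) : ℂ) * cis (lam * Φ t)) volume c d :=
    ((Complex.continuous_ofReal.comp (hcB.mul hm)).mul hcisc).intervalIntegrable _ _
  have hder : ∀ t ∈ uIcc c d, HasDerivAt (fun t => ((B t / u t : ℝ) : ℂ) * cis (lam * Φ t))
      ((g t : ℂ) * cis (lam * Φ t) +
        Complex.I * lam * (((B t * m t : ℝ) : ℂ) * cis (lam * Φ t))) t := fun t ht => by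
    rw [huIcc] at ht
    convert! ((hB t).div (hu t) (hu0 t ht)).ofReal_comp.mul
      (hasDerivAt_cis ((hΦ t).const_mul lam)) using 1
    have : (u t : ℂ) ≠ 0 := Complex.ofReal_ne_zero.2 (hu0 t ht)
    simp only [hg, Pi.div_apply]
    push_cast
    field_simp
  have hftc := intervalIntegral.integral_eq_sub_of_hasDerivAt hder (hi1.add (hi2.const_mul _))
  rw [intervalIntegral.integral_add hi1 (hi2.const_mul _),
    intervalIntegral.integral_const_mul] at hftc
  have hbdry : ∀ t ∈ Icc c d, ‖((B t / u t : ℝ) : ℂ) * cis (lam * Φ t)‖ ≤ M / δ := fun t ht => by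
    rw [norm_mul, norm_cis, mul_one, Complex.norm_real, Real.norm_eq_abs, abs_div]
    exact div_le_div₀ hM0 (hM t ht) hδ (hlow' t ht)
  -- `|u'| / u ^ 2 ≤ σ * u' / u ^ 2` is an exact derivative, so its integral sees only the
  -- endpoints.
  have hinv : ∀ t ∈ uIcc c d, HasDerivAt (fun t => -(u t)⁻¹) (u' t / u t ^ 2) t := fun t ht => by
    rw [huIcc] at ht
    convert! ((hu t).inv (hu0 t ht)).neg using 1
    ring
  have hui : ContinuousOn (fun t => u' t / u t ^ 2) (uIcc c d) := by
    rw [huIcc]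
    exact hu'.continuousOn.div (hcu.pow 2).continuousOn fun t ht => pow_ne_zero 2 (hu0 t ht)
  have hgi : ‖∫ t in c..d, (g t : ℂ) * cis (lam * Φ t)‖ ≤
      ∫ t in c..d, (M / δ + M * σ * (u' t / u t ^ 2)) := by
    refine intervalIntegral.norm_integral_le_of_norm_le hcd (Eventually.of_forall fun t ht => ?_)
      (intervalIntegrable_const.add (hui.intervalIntegrable.const_mul _))
    have ht' : t ∈ Icc c d := Ioc_subset_Icc_self ht
    rw [norm_mul, norm_cis, mul_one, Complex.norm_real, Real.norm_eq_abs]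
    refine (abs_sub _ _).trans (add_le_add ?_ ?_)
    · rw [abs_div]
      exact div_le_div₀ hM0 (hM' t ht') hδ (hlow' t ht')
    · rw [abs_div, abs_mul, abs_of_nonneg (sq_nonneg (u t)), mul_assoc, ← mul_div_assoc,
        ← mul_div_assoc]
      gcongr
      · exact hM t ht'
      · exact hmono t ht'
  have hval : ∫ t in c..d, (M / δ + M * σ * (u' t / u t ^ 2)) ≤ M / δ * (d - c) + M * (2 / δ) := by
    rw [intervalIntegral.integral_add intervalIntegrable_const
      (hui.intervalIntegrable.const_mul _), intervalIntegral.integral_const,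
      intervalIntegral.integral_const_mul,
      intervalIntegral.integral_eq_sub_of_hasDerivAt hinv hui.intervalIntegrable, smul_eq_mul,
      mul_comm (d - c), mul_assoc M]
    gcongr
    refine (le_abs_self _).trans ?_
    rw [abs_mul]
    have hb : ∀ t ∈ Icc c d, |(u t)⁻¹| ≤ 1 / δ := fun t ht => by
      rw [abs_inv, ← one_div]
      exact one_div_le_one_div_of_le hδ (hlow' t ht)
    have h1 : |-(u d)⁻¹ - -(u c)⁻¹| ≤ 1 / δ + 1 / δ := by
      refine (abs_sub _ _).trans ?_
      rw [abs_neg, abs_neg]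
      exact add_le_add (hb d (right_mem_Icc.2 hcd)) (hb c (left_mem_Icc.2 hcd))
    calc |σ| * |-(u d)⁻¹ - -(u c)⁻¹| ≤ 1 * (1 / δ + 1 / δ) := by gcongr
      _ = 2 / δ := by ring
  have hnorm : ‖Complex.I * lam * ∫ t in c..d, ((B t * m t : ℝ) : ℂ) * cis (lam * Φ t)‖ ≤
      M / δ + M / δ + (M / δ * (d - c) + M * (2 / δ)) := by
    have e : Complex.I * lam * ∫ t in c..d, ((B t * m t : ℝ) : ℂ) * cis (lam * Φ t) =
        ((B d / u d : ℝ) : ℂ) * cis (lam * Φ d) - ((B c / u c : ℝ) : ℂ) * cis (lam * Φ c) -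
          ∫ t in c..d, (g t : ℂ) * cis (lam * Φ t) := by linear_combination hftc
    rw [e]
    refine (norm_sub_le _ _).trans (add_le_add ((norm_sub_le _ _).trans (add_le_add ?_ ?_)) ?_)
    · exact hbdry d (right_mem_Icc.2 hcd)
    · exact hbdry c (left_mem_Icc.2 hcd)
    · exact hgi.trans hval
  rw [norm_mul, norm_mul, Complex.norm_I, one_mul, Complex.norm_real, Real.norm_eq_abs,
    abs_of_pos hlam] at hnorm
  rw [le_div_iff₀ (by positivity)]
  calc _ = δ * (lam * ‖∫ t in c..d, ((B t * m t : ℝ) : ℂ) * cis (lam * Φ t)‖) := by ring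
    _ ≤ δ * (M / δ + M / δ + (M / δ * (d - c) + M * (2 / δ))) := by gcongr
    _ = M * (4 + (d - c)) := by field_simp; ring

/-- A van der Corput estimate: an oscillatory integral is controlled by the diameter of the set
where the derivative of the phase is small. -/
theorem norm_integral_cis_le_of_diam (hu : ∀ t, HasDerivAt u (u' t) t)
    (hB : ∀ t, HasDerivAt B (B' t) t) (hΦ : ∀ t, HasDerivAt Φ (m t * u t) t)
    (hu' : Continuous u') (hB' : Continuous B') (hm : Continuous m) (hδ : 0 < δ) (hlam : 0 < lam)
    {a b M' ℓ : ℝ} (hab : a ≤ b) (hM : ∀ t ∈ Icc a b, |B t| ≤ M)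
    (hM' : ∀ t ∈ Icc a b, |B' t| ≤ M) (hBm : ∀ t ∈ Icc a b, |B t * m t| ≤ M') (hσ : |σ| ≤ 1)
    (hmono : ∀ t ∈ Icc a b, |u' t| ≤ σ * u' t) (hℓ : 0 ≤ ℓ)
    (hdiam : ∀ s ∈ Icc a b, ∀ t ∈ Icc a b, |u s| < δ → |u t| < δ → |s - t| ≤ ℓ) :
    ‖∫ t in a..b, ((B t * m t : ℝ) : ℂ) * cis (lam * Φ t)‖ ≤
      M' * ℓ + 2 * (M * (4 + (b - a)) / (lam * δ)) := by
  have hM0 : 0 ≤ M := (abs_nonneg _).trans (hM a (left_mem_Icc.2 hab))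
  have hM0' : 0 ≤ M' := (abs_nonneg _).trans (hBm a (left_mem_Icc.2 hab))
  have hba : 0 ≤ b - a := sub_nonneg.2 hab
  have hA : ∀ c d, a ≤ c → c ≤ d → d ≤ b → (∀ t ∈ Ioo c d, δ ≤ |u t|) →
      ‖∫ t in c..d, ((B t * m t : ℝ) : ℂ) * cis (lam * Φ t)‖ ≤
        M * (4 + (b - a)) / (lam * δ) := fun c d hac hcd hdb h => by
    have hsub : Icc c d ⊆ Icc a b := Icc_subset_Icc hac hdb
    refine (norm_integral_cis_le_of_le_abs hu hB hΦ hu' hB' hm hδ hlam hcd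
      (fun t ht => hM t (hsub ht)) (fun t ht => hM' t (hsub ht)) hσ
      (fun t ht => hmono t (hsub ht)) h).trans ?_
    gcongr
  -- Off `[inf E, sup E]` one has `δ ≤ |u|`, which leaves two intervals for the previous lemma; the
  -- middle one has length at most `ℓ` and is estimated trivially.
  set E := {t | t ∈ Icc a b ∧ |u t| < δ} with hE
  rcases E.eq_empty_or_nonempty with h0 | hne
  · have := hA a b le_rfl hab le_rfl fun t ht => by
      by_contra h
      exact (h0 ▸ (⟨Ioo_subset_Icc_self ht, not_le.1 h⟩ : t ∈ E) : t ∈ (∅ : Set ℝ))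
    have h2 : 0 ≤ M * (4 + (b - a)) / (lam * δ) := by positivity
    nlinarith [mul_nonneg hM0' hℓ]
  have hbb : BddBelow E := ⟨a, fun t ht => ht.1.1⟩
  have hba' : BddAbove E := ⟨b, fun t ht => ht.1.2⟩
  obtain ⟨x, hx⟩ := hne
  have hap : a ≤ sInf E := le_csInf ⟨x, hx⟩ fun t ht => ht.1.1
  have hpx : sInf E ≤ x := csInf_le hbb hx
  have hxr : x ≤ sSup E := le_csSup hba' hx
  have hrb : sSup E ≤ b := csSup_le ⟨x, hx⟩ fun t ht => ht.1.2
  have hlen : sSup E - sInf E ≤ ℓ := by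
    have h1 : ∀ s ∈ E, sSup E ≤ s + ℓ := fun s hs => csSup_le ⟨x, hx⟩ fun t ht => by
      have := hdiam t ht.1 s hs.1 ht.2 hs.2
      linarith [le_abs_self (t - s)]
    have h2 : sSup E - ℓ ≤ sInf E := le_csInf ⟨x, hx⟩ fun s hs => by linarith [h1 s hs]
    linarith
  have hcu : Continuous u := continuous_iff_continuousAt.2 fun t => (hu t).continuousAt
  have hcB : Continuous B := continuous_iff_continuousAt.2 fun t => (hB t).continuousAt
  have hcΦ : Continuous Φ := continuous_iff_continuousAt.2 fun t => (hΦ t).continuousAt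
  have hi : Continuous fun t => ((B t * m t : ℝ) : ℂ) * cis (lam * Φ t) :=
    (Complex.continuous_ofReal.comp (hcB.mul hm)).mul (by fun_prop)
  rw [← intervalIntegral.integral_add_adjacent_intervals
      (hi.intervalIntegrable a (sInf E)) (hi.intervalIntegrable _ b),
    ← intervalIntegral.integral_add_adjacent_intervals
      (hi.intervalIntegrable (sInf E) (sSup E)) (hi.intervalIntegrable _ b)]
  have e1 := hA a (sInf E) le_rfl hap ((hpx.trans hxr).trans hrb) fun t ht => by
    by_contra h
    exact absurd (csInf_le hbb ⟨⟨ht.1.le, by linarith [ht.2]⟩, not_le.1 h⟩) (not_le.2 ht.2)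
  have e2 := hA (sSup E) b ((hap.trans hpx).trans hxr) hrb le_rfl fun t ht => by
    by_contra h
    exact absurd (le_csSup hba' ⟨⟨by linarith [ht.1], ht.2.le⟩, not_le.1 h⟩) (not_le.2 ht.1)
  have e3 : ‖∫ t in (sInf E)..(sSup E), ((B t * m t : ℝ) : ℂ) * cis (lam * Φ t)‖ ≤ M' * ℓ := by
    refine (intervalIntegral.norm_integral_le_of_norm_le_const (C := M') fun t ht => ?_).trans ?_
    · rw [uIoc_of_le (hpx.trans hxr)] at ht
      rw [norm_mul, norm_cis, mul_one, Complex.norm_real, Real.norm_eq_abs]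
      exact hBm t ⟨hap.trans ht.1.le, ht.2.trans hrb⟩
    · rw [abs_of_nonneg (by linarith)]
      gcongr
  refine (norm_add_le _ _).trans ?_
  have := norm_add_le (∫ t in (sInf E)..(sSup E), ((B t * m t : ℝ) : ℂ) * cis (lam * Φ t))
    (∫ t in (sSup E)..b, ((B t * m t : ℝ) : ℂ) * cis (lam * Φ t))
  linarith

end VanDerCorput

/-! ### Nonstationary phase with parameters. -/

section Nonstationary

variable {E : Type*} [NormedAddCommGroup E] [NormedSpace ℝ E]

/-- The partial derivative with respect to the second, real variable. -/
def sndDeriv (f : E × ℝ → ℝ) (x : E × ℝ) : ℝ := fderiv ℝ f x (0, 1)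

lemma _root_.ContDiff.sndDeriv {f : E × ℝ → ℝ} (hf : ContDiff ℝ ∞ f) :
    ContDiff ℝ ∞ (sndDeriv f) :=
  (hf.fderiv_right (m := ∞) (by simp)).clm_apply contDiff_const

lemma hasDerivAt_sndDeriv {f : E × ℝ → ℝ} (hf : ContDiff ℝ ∞ f) (p : E) (t : ℝ) :
    HasDerivAt (fun s => f (p, s)) (sndDeriv f (p, t)) t := by
  have h1 : HasFDerivAt f (fderiv ℝ f (p, t)) (p, t) :=
    (hf.differentiable (by simp) (p, t)).hasFDerivAt
  have h2 : HasDerivAt (fun s : ℝ => (p, s)) ((0 : E), (1 : ℝ)) t :=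
    (hasDerivAt_const t p).prodMk (hasDerivAt_id t)
  exact h1.comp_hasDerivAt t h2

lemma sndDeriv_periodic {f : E × ℝ → ℝ} {T : ℝ} (hf : ContDiff ℝ ∞ f)
    (hT : ∀ p t, f (p, t + T) = f (p, t)) (p : E) (t : ℝ) :
    sndDeriv f (p, t + T) = sndDeriv f (p, t) := by
  have h1 := (hasDerivAt_sndDeriv hf p (t + T)).comp_add_const t T
  simp only [hT] at h1
  exact h1.unique (hasDerivAt_sndDeriv hf p t)

variable {b R Φ : E × ℝ → ℝ} {T : ℝ} {K : Set E} {Z : E → Set ℝ}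

/-- One integration by parts, with `R` in the role of `1 / ∂Φ` wherever the amplitude is nonzero.
Periodicity cancels the boundary terms. -/
lemma norm_integral_cis_eq_inv_mul (hb : ContDiff ℝ ∞ b) (hR : ContDiff ℝ ∞ R)
    (hΦ : ContDiff ℝ ∞ Φ) (hbT : ∀ p t, b (p, t + T) = b (p, t))
    (hRT : ∀ p t, R (p, t + T) = R (p, t)) (hΦT : ∀ p t, Φ (p, t + T) = Φ (p, t)) {p : E}
    (hinv : ∀ t, b (p, t) ≠ 0 → R (p, t) * sndDeriv Φ (p, t) = 1) {lam : ℝ} (hlam : 0 < lam) :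
    ‖∫ t in (0 : ℝ)..T, (b (p, t) : ℂ) * cis (lam * Φ (p, t))‖ =
      lam⁻¹ * ‖∫ t in (0 : ℝ)..T,
        (sndDeriv (fun x => b x * R x) (p, t) : ℂ) * cis (lam * Φ (p, t))‖ := by
  have hbR : ContDiff ℝ ∞ fun x => b x * R x := hb.mul hR
  have hpt : ContDiff ℝ ∞ fun t : ℝ => (p, t) := contDiff_const.prodMk contDiff_id
  have hcis : Continuous fun t => cis (lam * Φ (p, t)) :=
    continuous_cis.comp (continuous_const.mul (hΦ.continuous.comp hpt.continuous))
  have hi1 : IntervalIntegrable (fun t => (sndDeriv (fun x => b x * R x) (p, t) : ℂ) *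
      cis (lam * Φ (p, t))) volume 0 T :=
    ((Complex.continuous_ofReal.comp (hbR.sndDeriv.continuous.comp hpt.continuous)).mul
      hcis).intervalIntegrable _ _
  have hi2 : IntervalIntegrable (fun t => (b (p, t) : ℂ) * cis (lam * Φ (p, t))) volume 0 T :=
    ((Complex.continuous_ofReal.comp (hb.continuous.comp hpt.continuous)).mul
      hcis).intervalIntegrable _ _
  have hder : ∀ t ∈ uIcc 0 T, HasDerivAt (fun t => ((b (p, t) * R (p, t) : ℝ) : ℂ) *
      cis (lam * Φ (p, t))) ((sndDeriv (fun x => b x * R x) (p, t) : ℂ) * cis (lam * Φ (p, t)) +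
        Complex.I * lam * ((b (p, t) : ℂ) * cis (lam * Φ (p, t)))) t := fun t _ => by
    convert! (hasDerivAt_sndDeriv hbR p t).ofReal_comp.mul
      (hasDerivAt_cis ((hasDerivAt_sndDeriv hΦ p t).const_mul lam)) using 1
    have : b (p, t) = b (p, t) * R (p, t) * sndDeriv Φ (p, t) := by
      by_cases h : b (p, t) = 0
      · simp [h]
      · rw [mul_assoc, hinv t h, mul_one]
    have h2 : (b (p, t) : ℂ) = b (p, t) * R (p, t) * sndDeriv Φ (p, t) := by exact_mod_cast this
    push_cast
    linear_combination Complex.I * lam * cis (lam * Φ (p, t)) * h2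
  have hftc := intervalIntegral.integral_eq_sub_of_hasDerivAt hder (hi1.add (hi2.const_mul _))
  rw [intervalIntegral.integral_add hi1 (hi2.const_mul _),
    intervalIntegral.integral_const_mul] at hftc
  have h0 : ∀ f : E × ℝ → ℝ, (∀ p t, f (p, t + T) = f (p, t)) → f (p, T) = f (p, 0) :=
    fun f hf => by simpa using hf p 0
  rw [h0 b hbT, h0 R hRT, h0 Φ hΦT, sub_self] at hftc
  rw [← norm_neg (∫ t in (0 : ℝ)..T, (sndDeriv (fun x => b x * R x) (p, t) : ℂ) * _),
    ← eq_neg_of_add_eq_zero_right hftc, norm_mul, norm_mul, Complex.norm_I, one_mul,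
    Complex.norm_real, Real.norm_eq_abs, abs_of_pos hlam, inv_mul_cancel_left₀ hlam.ne']

/-- Nonstationary phase: repeated integration by parts over a period. -/
theorem exists_norm_integral_cis_le_inv_pow (hT : 0 ≤ T) (hK : IsCompact K)
    (hZ : ∀ p ∈ K, IsClosed (Z p)) (hR : ContDiff ℝ ∞ R) (hΦ : ContDiff ℝ ∞ Φ)
    (hRT : ∀ p t, R (p, t + T) = R (p, t)) (hΦT : ∀ p t, Φ (p, t + T) = Φ (p, t))
    (hinv : ∀ p ∈ K, ∀ t ∈ Z p, R (p, t) * sndDeriv Φ (p, t) = 1) (N : ℕ)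
    (hb : ContDiff ℝ ∞ b) (hbT : ∀ p t, b (p, t + T) = b (p, t))
    (hbZ : ∀ p ∈ K, ∀ t ∉ Z p, b (p, t) = 0) :
    ∃ C, 0 ≤ C ∧ ∀ p ∈ K, ∀ lam : ℝ, 0 < lam →
      ‖∫ t in (0 : ℝ)..T, (b (p, t) : ℂ) * cis (lam * Φ (p, t))‖ ≤ C * (lam⁻¹) ^ N := by
  induction N generalizing b with
  | zero =>
    obtain ⟨C, hC⟩ := (hK.prod (isCompact_Icc (a := (0 : ℝ)) (b := T))).exists_bound_of_continuousOn
      hb.continuous.continuousOn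
    refine ⟨|C| * T, by positivity, fun p hp lam _ => ?_⟩
    have h1 := intervalIntegral.norm_integral_le_of_norm_le_const (a := 0) (b := T) (C := |C|)
      (f := fun t => (b (p, t) : ℂ) * cis (lam * Φ (p, t))) fun t ht => by
        rw [uIoc_of_le hT] at ht
        rw [norm_mul, norm_cis, mul_one, Complex.norm_real]
        exact (hC (p, t) ⟨hp, Ioc_subset_Icc_self ht⟩).trans (le_abs_self C)
    simpa [abs_of_nonneg hT] using h1
  | succ N ih =>
    have hbR : ContDiff ℝ ∞ fun x => b x * R x := hb.mul hR
    obtain ⟨C, hC0, hC⟩ := ih (b := sndDeriv fun x => b x * R x) hbR.sndDeriv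
      (sndDeriv_periodic hbR fun p t => by rw [hbT, hRT]) fun p hp t ht => by
        -- The complement of `Z p` is open, so the new amplitude vanishes off `Z p` too and the
        -- induction can continue.
        have h1 : (fun s => b (p, s) * R (p, s)) =ᶠ[𝓝 t] fun _ => 0 := by
          filter_upwards [(hZ p hp).isOpen_compl.mem_nhds ht] with s hs
          rw [hbZ p hp s hs, zero_mul]
        exact (hasDerivAt_sndDeriv hbR p t).unique
          ((hasDerivAt_const t (0 : ℝ)).congr_of_eventuallyEq h1)
    refine ⟨C, hC0, fun p hp lam hlam => ?_⟩
    rw [norm_integral_cis_eq_inv_mul hb hR hΦ hbT hRT hΦT (fun t ht => hinv p hp t (by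
      by_contra h; exact ht (hbZ p hp t h))) hlam, pow_succ]
    calc _ ≤ lam⁻¹ * (C * (lam⁻¹) ^ N) := by
          gcongr
          exact hC p hp lam hlam
      _ = _ := by ring

end Nonstationary

/-! ### Frenet formulas, parallel curves and the phase. -/

lemma hasDerivAt_plane_iff {c : ℝ → Plane} {c' : Plane} {t : ℝ} :
    HasDerivAt c c' t ↔
      HasDerivAt (fun s => c s 0) (c' 0) t ∧ HasDerivAt (fun s => c s 1) (c' 1) t := by
  constructor
  · intro h
    exact ⟨(EuclideanSpace.proj (𝕜 := ℝ) (0 : Fin 2)).hasFDerivAt.comp_hasDerivAt t h,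
      (EuclideanSpace.proj (𝕜 := ℝ) (1 : Fin 2)).hasFDerivAt.comp_hasDerivAt t h⟩
  · rintro ⟨h0, h1⟩
    have h : HasDerivAt (fun s (i : Fin 2) => c s i) (fun i => c' i) t :=
      hasDerivAt_pi.2 (by intro i; fin_cases i <;> assumption)
    exact (PiLp.continuousLinearEquiv 2 ℝ (fun _ : Fin 2 => ℝ)).symm.hasFDerivAt.comp_hasDerivAt t h

lemma plane_norm_sq (v : Plane) : ‖v‖ ^ 2 = v 0 ^ 2 + v 1 ^ 2 := by
  simp [EuclideanSpace.norm_sq_eq, Fin.sum_univ_two]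

lemma plane_inner (v w : Plane) : inner ℝ v w = v 0 * w 0 + v 1 * w 1 := by
  simp [PiLp.inner_apply, Fin.sum_univ_two, mul_comm]

lemma plane_ext {v w : Plane} (h0 : v 0 = w 0) (h1 : v 1 = w 1) : v = w := by
  ext i
  fin_cases i <;> assumption

namespace SmoothClosedCurve

variable (γ : SmoothClosedCurve)

/-- The first coordinate of the curve. -/
def cx (t : ℝ) : ℝ := γ.param t 0

/-- The second coordinate of the curve. -/
def cy (t : ℝ) : ℝ := γ.param t 1

/-- The speed of the parametrization. -/
def speed (t : ℝ) : ℝ := ‖deriv γ.param t‖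

/-- The first coordinate of the unit tangent. -/
def tx (t : ℝ) : ℝ := (γ.speed t)⁻¹ * deriv γ.param t 0

/-- The second coordinate of the unit tangent. -/
def ty (t : ℝ) : ℝ := (γ.speed t)⁻¹ * deriv γ.param t 1

/-- The signed curvature at a parameter. -/
def curv (t : ℝ) : ℝ := signedCurvature γ.param t

lemma speed_pos (t : ℝ) : 0 < γ.speed t := norm_pos_iff.2 (γ.regular t)

lemma contDiff_deriv : ContDiff ℝ ∞ (deriv γ.param) :=
  (contDiff_infty_iff_deriv.1 γ.smooth).2

lemma contDiff_deriv_deriv : ContDiff ℝ ∞ (deriv (deriv γ.param)) :=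
  (contDiff_infty_iff_deriv.1 γ.contDiff_deriv).2

lemma contDiff_coord {c : ℝ → Plane} (h : ContDiff ℝ ∞ c) (i : Fin 2) :
    ContDiff ℝ ∞ fun t => c t i :=
  contDiff_euclidean.1 h i

@[fun_prop] lemma contDiff_cx : ContDiff ℝ ∞ γ.cx := contDiff_coord γ.smooth 0

@[fun_prop] lemma contDiff_cy : ContDiff ℝ ∞ γ.cy := contDiff_coord γ.smooth 1

@[fun_prop] lemma contDiff_speed : ContDiff ℝ ∞ γ.speed := γ.contDiff_deriv.norm ℝ γ.regular

@[fun_prop] lemma contDiff_tx : ContDiff ℝ ∞ γ.tx :=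
  (γ.contDiff_speed.inv fun t => (γ.speed_pos t).ne').mul (contDiff_coord γ.contDiff_deriv 0)

@[fun_prop] lemma contDiff_ty : ContDiff ℝ ∞ γ.ty :=
  (γ.contDiff_speed.inv fun t => (γ.speed_pos t).ne').mul (contDiff_coord γ.contDiff_deriv 1)

@[fun_prop] lemma contDiff_curv : ContDiff ℝ ∞ γ.curv := by
  refine ContDiff.div ?_ (γ.contDiff_speed.pow 3) fun t => pow_ne_zero 3 (γ.speed_pos t).ne'
  exact ((contDiff_coord γ.contDiff_deriv 0).mul (contDiff_coord γ.contDiff_deriv_deriv 1)).sub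
    ((contDiff_coord γ.contDiff_deriv 1).mul (contDiff_coord γ.contDiff_deriv_deriv 0))

lemma deriv_zero (t : ℝ) : deriv γ.param t 0 = γ.speed t * γ.tx t :=
  (mul_inv_cancel_left₀ (γ.speed_pos t).ne' _).symm

lemma deriv_one (t : ℝ) : deriv γ.param t 1 = γ.speed t * γ.ty t :=
  (mul_inv_cancel_left₀ (γ.speed_pos t).ne' _).symm

lemma hasDerivAt_param (t : ℝ) : HasDerivAt γ.param (deriv γ.param t) t :=
  (γ.smooth.differentiable (by simp) t).hasDerivAt

lemma hasDerivAt_deriv (t : ℝ) : HasDerivAt (deriv γ.param) (deriv (deriv γ.param) t) t :=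
  (γ.contDiff_deriv.differentiable (by simp) t).hasDerivAt

lemma hasDerivAt_cx (t : ℝ) : HasDerivAt γ.cx (γ.speed t * γ.tx t) t := by
  rw [← deriv_zero]
  exact (hasDerivAt_plane_iff.1 (γ.hasDerivAt_param t)).1

lemma hasDerivAt_cy (t : ℝ) : HasDerivAt γ.cy (γ.speed t * γ.ty t) t := by
  rw [← deriv_one]
  exact (hasDerivAt_plane_iff.1 (γ.hasDerivAt_param t)).2

lemma speed_sq (t : ℝ) : γ.speed t ^ 2 = deriv γ.param t 0 ^ 2 + deriv γ.param t 1 ^ 2 :=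
  plane_norm_sq _

lemma tx_sq_add_ty_sq (t : ℝ) : γ.tx t ^ 2 + γ.ty t ^ 2 = 1 := by
  have h := γ.speed_sq t
  have h0 := (γ.speed_pos t).ne'
  rw [deriv_zero, deriv_one] at h
  have : γ.speed t ^ 2 * (γ.tx t ^ 2 + γ.ty t ^ 2) = γ.speed t ^ 2 * 1 := by linarith
  exact mul_left_cancel₀ (pow_ne_zero 2 h0) this

lemma curv_mul_speed_pow (t : ℝ) : γ.curv t * γ.speed t ^ 3 =
    deriv γ.param t 0 * deriv (deriv γ.param) t 1 -
      deriv γ.param t 1 * deriv (deriv γ.param) t 0 :=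
  div_mul_cancel₀ _ (pow_ne_zero 3 (γ.speed_pos t).ne')

lemma speed_mul_deriv_speed (t : ℝ) : γ.speed t * deriv γ.speed t =
    deriv γ.param t 0 * deriv (deriv γ.param) t 0 +
      deriv γ.param t 1 * deriv (deriv γ.param) t 1 := by
  have h := hasDerivAt_plane_iff.1 (γ.hasDerivAt_deriv t)
  have h1 : HasDerivAt γ.speed (deriv γ.speed t) t :=
    (γ.contDiff_speed.differentiable (by simp) t).hasDerivAt
  have h2 := h1.pow 2
  have h3 := (h.1.pow 2).add (h.2.pow 2)
  have h4 : (γ.speed ^ 2) = (fun s => deriv γ.param s 0) ^ 2 + (fun s => deriv γ.param s 1) ^ 2 :=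
    funext fun s => γ.speed_sq s
  rw [h4] at h2
  have h5 := h2.unique h3
  simp only [Nat.cast_ofNat, Nat.add_one_sub_one, pow_one] at h5
  linarith

/-- The quotient rule for either coordinate of the unit tangent, with the denominator of the speed
cleared in `ha`. -/
lemma hasDerivAt_tangent {t : ℝ} {i : Fin 2} {a : ℝ}
    (ha : a * γ.speed t = γ.speed t * deriv (deriv γ.param) t i -
      deriv γ.speed t * deriv γ.param t i) :
    HasDerivAt (fun s => (γ.speed s)⁻¹ * deriv γ.param s i) ((γ.speed t)⁻¹ * a) t := by
  have h : HasDerivAt (fun s => deriv γ.param s i) (deriv (deriv γ.param) t i) t := by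
    have := hasDerivAt_plane_iff.1 (γ.hasDerivAt_deriv t)
    fin_cases i
    exacts [this.1, this.2]
  have h1 : HasDerivAt γ.speed (deriv γ.speed t) t :=
    (γ.contDiff_speed.differentiable (by simp) t).hasDerivAt
  have h0 := (γ.speed_pos t).ne'
  convert! (h1.inv h0).mul h using 1
  simp only [Pi.inv_apply]
  field_simp
  linear_combination ha

lemma hasDerivAt_tx (t : ℝ) :
    HasDerivAt γ.tx (-(γ.curv t * γ.speed t * γ.ty t)) t := by
  have h0 := (γ.speed_pos t).ne'
  have h := γ.hasDerivAt_tangent (t := t) (i := 0)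
    (a := -(γ.curv t * γ.speed t * deriv γ.param t 1)) (by
      have h1 := γ.curv_mul_speed_pow t
      have h2 := γ.speed_mul_deriv_speed t
      have h3 := γ.speed_sq t
      refine mul_left_cancel₀ h0 ?_
      linear_combination (-deriv γ.param t 1) * h1 + deriv γ.param t 0 * h2 -
        deriv (deriv γ.param) t 0 * h3)
  convert! h using 1
  rw [deriv_one]
  field_simp

lemma hasDerivAt_ty (t : ℝ) :
    HasDerivAt γ.ty (γ.curv t * γ.speed t * γ.tx t) t := by
  have h0 := (γ.speed_pos t).ne'
  have h := γ.hasDerivAt_tangent (t := t) (i := 1)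
    (a := γ.curv t * γ.speed t * deriv γ.param t 0) (by
      have h1 := γ.curv_mul_speed_pow t
      have h2 := γ.speed_mul_deriv_speed t
      have h3 := γ.speed_sq t
      refine mul_left_cancel₀ h0 ?_
      linear_combination deriv γ.param t 0 * h1 + deriv γ.param t 1 * h2 -
        deriv (deriv γ.param) t 1 * h3)
  convert! h using 1
  rw [deriv_zero]
  field_simp

lemma deriv_periodic : Function.Periodic (deriv γ.param) γ.period := fun t => by
  have h := (γ.hasDerivAt_param (t + γ.period)).comp_add_const t γ.period
  have e : (fun x => γ.param (x + γ.period)) = γ.param := funext γ.periodic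
  rw [e] at h
  exact h.unique (γ.hasDerivAt_param t)

lemma deriv_deriv_periodic : Function.Periodic (deriv (deriv γ.param)) γ.period := fun t => by
  have h := (γ.hasDerivAt_deriv (t + γ.period)).comp_add_const t γ.period
  have e : (fun x => deriv γ.param (x + γ.period)) = deriv γ.param := funext γ.deriv_periodic
  rw [e] at h
  exact h.unique (γ.hasDerivAt_deriv t)

lemma cx_periodic : Function.Periodic γ.cx γ.period := fun t => by simp [cx, γ.periodic t]

lemma cy_periodic : Function.Periodic γ.cy γ.period := fun t => by simp [cy, γ.periodic t]

lemma speed_periodic : Function.Periodic γ.speed γ.period := fun t => by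
  simp [speed, γ.deriv_periodic t]

lemma tx_periodic : Function.Periodic γ.tx γ.period := fun t => by
  simp [tx, γ.deriv_periodic t, γ.speed_periodic t]

lemma ty_periodic : Function.Periodic γ.ty γ.period := fun t => by
  simp [ty, γ.deriv_periodic t, γ.speed_periodic t]

lemma curv_periodic : Function.Periodic γ.curv γ.period := fun t => by
  simp [curv, signedCurvature, γ.deriv_periodic t, γ.deriv_deriv_periodic t]

lemma normal_zero (t : ℝ) : γ.normal t 0 = γ.ty t := by simp [normal, ty, speed]

lemma normal_one (t : ℝ) : γ.normal t 1 = -γ.tx t := by simp [normal, tx, speed]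

lemma normal_periodic : Function.Periodic γ.normal γ.period := fun t =>
  plane_ext (by simp [normal_zero, γ.ty_periodic t]) (by simp [normal_one, γ.tx_periodic t])

lemma norm_normal (t : ℝ) : ‖γ.normal t‖ = 1 := by
  have h := plane_norm_sq (γ.normal t)
  rw [normal_zero, normal_one, neg_sq, add_comm, tx_sq_add_ty_sq] at h
  nlinarith [norm_nonneg (γ.normal t)]

lemma inner_normal_deriv (t : ℝ) : inner ℝ (γ.normal t) (deriv γ.param t) = 0 := by
  rw [plane_inner, normal_zero, normal_one, deriv_zero, deriv_one]
  ring

/-- The normal is the tangent rotated by `-π / 2`, so its derivative is a positive multiple of the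
velocity where the curvature is positive. This is why `1 + η κ` appears below. -/
lemma hasDerivAt_normal (t : ℝ) :
    HasDerivAt γ.normal (γ.curv t • deriv γ.param t) t := by
  refine hasDerivAt_plane_iff.2 ⟨?_, ?_⟩
  · simp only [normal_zero, PiLp.smul_apply, deriv_zero, smul_eq_mul]
    convert! γ.hasDerivAt_ty t using 1
    ring
  · simp only [normal_one, PiLp.smul_apply, deriv_one, smul_eq_mul]
    convert! (γ.hasDerivAt_tx t).neg using 1
    ring

lemma levelCurve_zero (η t : ℝ) : γ.levelCurve η t 0 = γ.cx t + η * γ.ty t := by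
  simp [levelCurve, normal_zero, cx]

lemma levelCurve_one (η t : ℝ) : γ.levelCurve η t 1 = γ.cy t - η * γ.tx t := by
  simp [levelCurve, normal_one, cy, sub_eq_add_neg]

lemma deriv_levelCurve (η : ℝ) :
    deriv (γ.levelCurve η) = fun t => (1 + η * γ.curv t) • deriv γ.param t := by
  ext1 t
  refine HasDerivAt.deriv ?_
  convert! (γ.hasDerivAt_param t).add ((γ.hasDerivAt_normal t).const_smul η) using 1
  rw [add_smul, one_smul, smul_smul]

/-- The velocity is scaled by `1 + η κ`, and the extra term of the acceleration is parallel to it.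
So the numerator gains the factor squared and the denominator the factor cubed. -/
lemma signedCurvature_levelCurve {η t : ℝ} (h : 0 < 1 + η * γ.curv t) :
    signedCurvature (γ.levelCurve η) t = γ.curv t / (1 + η * γ.curv t) := by
  have hk : HasDerivAt γ.curv (deriv γ.curv t) t :=
    (γ.contDiff_curv.differentiable (by simp) t).hasDerivAt
  have h2 : deriv (deriv (γ.levelCurve η)) t =
      (1 + η * γ.curv t) • deriv (deriv γ.param) t +
        (η * deriv γ.curv t) • deriv γ.param t := by
    rw [deriv_levelCurve]
    exact (((hk.const_mul η).const_add 1).smul (γ.hasDerivAt_deriv t)).deriv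
  have h3 := γ.curv_mul_speed_pow t
  have h0 := (γ.speed_pos t).ne'
  unfold signedCurvature
  rw [h2, deriv_levelCurve]
  simp only [norm_smul, PiLp.smul_apply, PiLp.add_apply, smul_eq_mul, Real.norm_eq_abs,
    abs_of_pos h]
  change _ / ((1 + η * γ.curv t) * γ.speed t) ^ 3 = _
  rw [div_eq_div_iff (by positivity) h.ne']
  linear_combination (-(1 + η * γ.curv t) ^ 3) * h3

/-- The phase `ω · (γ + η n)`, with `ω = (cos τ, sin τ)`, at `((τ, η), t)`. -/
def phase (x : (ℝ × ℝ) × ℝ) : ℝ :=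
  Real.cos x.1.1 * (γ.cx x.2 + x.1.2 * γ.ty x.2) + Real.sin x.1.1 * (γ.cy x.2 - x.1.2 * γ.tx x.2)

/-- The tangential component of `(cos τ, sin τ)`. -/
def tanComp (τ t : ℝ) : ℝ := Real.cos τ * γ.tx t + Real.sin τ * γ.ty t

/-- The normal component of `(cos τ, sin τ)`. -/
def norComp (τ t : ℝ) : ℝ := Real.cos τ * γ.ty t - Real.sin τ * γ.tx t

lemma contDiff_phase : ContDiff ℝ ∞ γ.phase := by
  unfold phase
  have h1 := γ.contDiff_cx; have h2 := γ.contDiff_cy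
  have h3 := γ.contDiff_tx; have h4 := γ.contDiff_ty
  fun_prop

lemma contDiff_tanComp : ContDiff ℝ ∞ fun x : (ℝ × ℝ) × ℝ => γ.tanComp x.1.1 x.2 := by
  unfold tanComp
  have h3 := γ.contDiff_tx; have h4 := γ.contDiff_ty
  fun_prop

lemma contDiff_norComp : ContDiff ℝ ∞ fun x : (ℝ × ℝ) × ℝ => γ.norComp x.1.1 x.2 := by
  unfold norComp
  have h3 := γ.contDiff_tx; have h4 := γ.contDiff_ty
  fun_prop

lemma phase_periodic (p : ℝ × ℝ) (t : ℝ) : γ.phase (p, t + γ.period) = γ.phase (p, t) := by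
  simp only [phase, γ.cx_periodic t, γ.cy_periodic t, γ.tx_periodic t, γ.ty_periodic t]

lemma norComp_periodic (τ t : ℝ) : γ.norComp τ (t + γ.period) = γ.norComp τ t := by
  simp only [norComp, γ.tx_periodic t, γ.ty_periodic t]

lemma tanComp_sq_add_norComp_sq (τ t : ℝ) : γ.tanComp τ t ^ 2 + γ.norComp τ t ^ 2 = 1 := by
  have h1 := γ.tx_sq_add_ty_sq t
  have h2 := Real.cos_sq_add_sin_sq τ
  unfold tanComp norComp
  linear_combination (Real.cos τ ^ 2 + Real.sin τ ^ 2) * h1 + h2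

lemma abs_norComp_le (τ t : ℝ) : |γ.norComp τ t| ≤ 1 :=
  abs_le_one_iff_mul_self_le_one.2 (by
    nlinarith [γ.tanComp_sq_add_norComp_sq τ t, sq_nonneg (γ.tanComp τ t)])

lemma hasDerivAt_tanComp (τ t : ℝ) :
    HasDerivAt (γ.tanComp τ) (-(γ.curv t * γ.speed t * γ.norComp τ t)) t := by
  convert! ((γ.hasDerivAt_tx t).const_mul (Real.cos τ)).add
    ((γ.hasDerivAt_ty t).const_mul (Real.sin τ)) using 1
  unfold norComp
  ring

/-- Moving along the normal only multiplies the derivative by `1 + η κ`: the stationary points, the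
zeros of `tanComp`, are the same on all parallel curves. This makes the estimates uniform in the
offset. -/
lemma hasDerivAt_phase (p : ℝ × ℝ) (t : ℝ) :
    HasDerivAt (fun s => γ.phase (p, s))
      (γ.speed t * (1 + p.2 * γ.curv t) * γ.tanComp p.1 t) t := by
  convert! (((γ.hasDerivAt_cx t).add ((γ.hasDerivAt_ty t).const_mul p.2)).const_mul
    (Real.cos p.1)).add (((γ.hasDerivAt_cy t).sub ((γ.hasDerivAt_tx t).const_mul p.2)).const_mul
    (Real.sin p.1)) using 1
  unfold tanComp
  ring

end SmoothClosedCurve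

/-! ### Lower bounds for the curvature near flat points. -/

section Graph

/-- The second derivative of `y ↦ s * (ε y) ^ k * H y` on the side `0 < ε y`. -/
lemma hasDerivAt_rpow_mul {H : ℝ → ℝ} {H₁ H₂ k ε y : ℝ} (s : ℝ) (hε : ε ^ 2 = 1) (hy : 0 < ε * y)
    (H' : ℝ → ℝ) (hH : HasDerivAt H H₁ y) (hH' : HasDerivAt H' H₂ y) (h1 : H' y = H₁) :
    HasDerivAt (fun x => s * (ε * x) ^ k * H x)
      (s * ((ε * y) ^ (k - 1) * (k * ε * H y + ε * y * H₁))) y ∧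
    HasDerivAt (fun x => s * ((ε * x) ^ (k - 1) * (k * ε * H x + ε * x * H' x)))
      (s * ((ε * y) ^ (k - 2) * (k * (k - 1) * H y + 2 * k * y * H₁ + y ^ 2 * H₂))) y := by
  have hl : HasDerivAt (fun x => ε * x) ε y := by simpa using (hasDerivAt_id y).const_mul ε
  have e1 : (ε * y) ^ k = (ε * y) ^ (k - 1) * (ε * y) := by
    rw [← Real.rpow_add_one hy.ne']; ring_nf
  have e2 : (ε * y) ^ (k - 1) = (ε * y) ^ (k - 2) * (ε * y) := by
    rw [← Real.rpow_add_one hy.ne']; ring_nf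
  constructor
  · convert! ((hl.rpow_const (p := k) (Or.inl hy.ne')).const_mul s).mul hH using 1
    rw [e1]
    ring
  · convert! ((hl.rpow_const (p := k - 1) (Or.inl hy.ne')).mul
      ((hH.const_mul (k * ε)).add (hl.mul hH'))).const_mul s using 1
    simp only [Pi.mul_apply, Pi.add_apply, h1]
    rw [show k - 1 - 1 = k - 2 by ring, e2]
    linear_combination (-(s * (ε * y) ^ (k - 2) * (k * (k - 1) * H y + 2 * k * y * H₁ +
      y ^ 2 * H₂))) * hε

variable {p p₁ p₂ Q Q₁ Q₂ : ℝ → ℝ} {k r x : ℝ} {H g : ℝ → ℝ}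

/-- If `Q = g ∘ p` near `x`, where `p x = 0` and `|g y| ≤ C |y|`, then `p' x = 0` forces
`Q' x = 0`. -/
lemma deriv_eq_zero_of_abs_le (hp : HasDerivAt p 0 x) (hpx : p x = 0) {b C : ℝ}
    (hQ : HasDerivAt Q b x) (hQx : Q x = 0) (h : ∀ᶠ t in 𝓝 x, |Q t| ≤ C * |p t|) : b = 0 := by
  have h1 : p =o[𝓝 x] fun t => t - x := by
    simpa [hasDerivAt_iff_isLittleO, hpx] using hp
  have h2 : Q =O[𝓝 x] p := IsBigO.of_bound C (by simpa using h)
  have h3 : HasDerivAt Q 0 x := by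
    simpa [hasDerivAt_iff_isLittleO, hQx] using h2.trans_isLittleO h1
  exact hQ.unique h3

/-- Lower bound for the numerator of the curvature of a graph with a flat point of finite order,
in terms of the graph coordinates `p` and `Q` along the curve. -/
theorem exists_le_abs_cross_of_graph (hk : 2 < k) (hr : 0 < r)
    (hH : ContDiffOn ℝ ∞ H (Icc (-r) r)) (hH0 : ∀ y ∈ Icc (-r) r, H y ≠ 0)
    (hg : (∀ y ∈ Icc (-r) r, g y = |y| ^ k * H y) ∨
      ∀ y ∈ Icc (-r) r, g y = Real.sign y * |y| ^ k * H y)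
    (hp : ∀ t, HasDerivAt p (p₁ t) t) (hp₁ : ∀ t, HasDerivAt p₁ (p₂ t) t)
    (hQ : ∀ t, HasDerivAt Q (Q₁ t) t) (hQ₁ : ∀ t, HasDerivAt Q₁ (Q₂ t) t)
    (hcp : Continuous p₁) (hpx : p x = 0)
    (hreg : p₁ x ≠ 0 ∨ Q₁ x ≠ 0) (hgraph : ∀ᶠ t in 𝓝 x, Q t = g (p t)) :
    ∃ c > 0, ∀ᶠ t in 𝓝 x, c * |t - x| ^ (k - 2) ≤ |p₁ t * Q₂ t - Q₁ t * p₂ t| := by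
  have hpc : Continuous p := continuous_iff_continuousAt.2 fun t => (hp t).continuousAt
  have hgabs : ∀ y ∈ Icc (-r) r, |g y| ≤ |y| ^ k * |H y| := fun y hy => by
    rcases hg with h | h
    · rw [h y hy, abs_mul, abs_of_nonneg (by positivity)]
    · rw [h y hy, abs_mul, abs_mul, abs_of_nonneg (show 0 ≤ |y| ^ k by positivity)]
      have : |Real.sign y| ≤ 1 := by
        rcases Real.sign_apply_eq y with h | h | h <;> rw [h] <;> norm_num
      calc |Real.sign y| * |y| ^ k * |H y| ≤ 1 * |y| ^ k * |H y| := by gcongr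
        _ = _ := by rw [one_mul]
  have hIoo : ∀ᶠ t in 𝓝 x, p t ∈ Ioo (-r) r :=
    hpc.continuousAt.eventually (Ioo_mem_nhds (by rw [hpx]; linarith) (by rw [hpx]; exact hr))
  -- Otherwise `|Q| ≤ C |p|`, valid near `x` because `k > 1`, would force `Q₁ x = 0` as well, and
  -- the curve would not be regular at `x`.
  have hp10 : p₁ x ≠ 0 := by
    intro h0
    rcases hreg with h | h
    · exact h h0
    obtain ⟨C, hC⟩ := isCompact_Icc.exists_bound_of_continuousOn hH.continuousOn
    have hQg : ∀ᶠ t in 𝓝 x, |Q t| ≤ C * |p t| := by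
      have hsmall : ∀ᶠ t in 𝓝 x, |p t| < 1 :=
        hpc.abs.continuousAt.eventually (gt_mem_nhds (by simp [hpx]))
      filter_upwards [hgraph, hIoo, hsmall] with t h1 h2 h3
      have h2' := Ioo_subset_Icc_self h2
      rw [h1]
      refine (hgabs _ h2').trans ?_
      rw [mul_comm]
      have h4 : |p t| ^ k ≤ |p t| := by
        conv_rhs => rw [← Real.rpow_one |p t|]
        exact Real.rpow_le_rpow_of_exponent_ge_of_imp (abs_nonneg _) h3.le (by linarith)
          (fun _ h => by linarith)
      exact mul_le_mul (hC _ h2') h4 (by positivity) ((norm_nonneg _).trans (hC _ h2'))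
    have hQx : Q x = 0 := by
      have := hQg.self_of_nhds
      rw [hpx, abs_zero, mul_zero] at this
      exact abs_eq_zero.1 (le_antisymm this (abs_nonneg _))
    exact h (deriv_eq_zero_of_abs_le (h0 ▸ hp x) hpx (hQ x) hQx hQg)
  have hHo := hH.mono Ioo_subset_Icc_self
  have hH1 : ContDiffOn ℝ ∞ (deriv H) (Ioo (-r) r) :=
    ((contDiffOn_infty_iff_deriv_of_isOpen isOpen_Ioo).1 hHo).2
  have hH2 : ContDiffOn ℝ ∞ (deriv (deriv H)) (Ioo (-r) r) :=
    ((contDiffOn_infty_iff_deriv_of_isOpen isOpen_Ioo).1 hH1).2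
  have hderH : ∀ y ∈ Ioo (-r) r, HasDerivAt H (deriv H y) y := fun y hy =>
    ((hHo.differentiableOn (by simp)).differentiableAt (isOpen_Ioo.mem_nhds hy)).hasDerivAt
  have hderH1 : ∀ y ∈ Ioo (-r) r, HasDerivAt (deriv H) (deriv (deriv H) y) y := fun y hy =>
    ((hH1.differentiableOn (by simp)).differentiableAt (isOpen_Ioo.mem_nhds hy)).hasDerivAt
  -- The second derivative of `g` is `±|y| ^ (k - 2) * K y`, and `K 0 = k (k - 1) H 0 ≠ 0`.
  set K : ℝ → ℝ := fun y => k * (k - 1) * H y + 2 * k * y * deriv H y + y ^ 2 * deriv (deriv H) y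
    with hK
  have h0r : (0 : ℝ) ∈ Ioo (-r) r := ⟨by linarith, hr⟩
  have hKc : ContinuousAt K 0 := by
    have e : ∀ {f : ℝ → ℝ}, ContDiffOn ℝ ∞ f (Ioo (-r) r) → ContinuousAt f 0 := fun hf =>
      hf.continuousOn.continuousAt (isOpen_Ioo.mem_nhds h0r)
    have e0 := e hHo
    have e1 := e hH1
    have e2 := e hH2
    fun_prop
  have hK0 : K 0 ≠ 0 := by
    simp only [hK, mul_zero, zero_mul, add_zero, ne_eq, OfNat.ofNat_ne_zero, not_false_eq_true,
      zero_pow]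
    exact mul_ne_zero (mul_ne_zero (by linarith) (by linarith)) (hH0 0 (Ioo_subset_Icc_self h0r))
  have hKev : ∀ᶠ t in 𝓝 x, |K 0| / 2 < |K (p t)| := by
    have h1 : ContinuousAt (fun t => |K (p t)|) x := by
      have h2 : ContinuousAt K (p x) := by rwa [hpx]
      exact (h2.comp (f := p) hpc.continuousAt).abs
    refine h1.eventually (lt_mem_nhds ?_)
    change |K 0| / 2 < |K (p x)|
    rw [hpx]
    linarith [abs_pos.2 hK0]
  have hp1ev : ∀ᶠ t in 𝓝 x, |p₁ x| / 2 < |p₁ t| :=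
    hcp.abs.continuousAt.eventually (lt_mem_nhds (by linarith [abs_pos.2 hp10]))
  have hpev : ∀ᶠ t in 𝓝 x, |p₁ x| / 2 * |t - x| ≤ |p t| := by
    have h1 : (fun t => p t - (t - x) * p₁ x) =o[𝓝 x] fun t => t - x := by
      simpa [hasDerivAt_iff_isLittleO, hpx] using hp x
    filter_upwards [h1.def (c := |p₁ x| / 2) (by linarith [abs_pos.2 hp10])] with t ht
    rw [Real.norm_eq_abs, Real.norm_eq_abs, abs_sub_comm] at ht
    have h2 := abs_sub_abs_le_abs_sub ((t - x) * p₁ x) (p t)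
    rw [abs_mul] at h2
    linarith
  -- The product of the lower bounds for `|p₁| ^ 3`, `|p| ^ (k - 2)` and `|K ∘ p|`.
  set c := (|p₁ x| / 2) ^ 3 * ((|p₁ x| / 2) ^ (k - 2) * (|K 0| / 2)) with hc
  have hp1pos := abs_pos.2 hp10
  have hKpos := abs_pos.2 hK0
  refine ⟨c, by positivity, ?_⟩
  filter_upwards [hKev, hp1ev, hpev, hIoo.eventually_nhds, hgraph.eventually_nhds] with
    t h1 h2 h3 h4 h5
  rcases eq_or_ne t x with rfl | htx
  · rw [sub_self, abs_zero, Real.zero_rpow (by linarith), mul_zero]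
    exact abs_nonneg _
  have hpt : p t ≠ 0 := by
    intro h
    rw [h, abs_zero] at h3
    have := abs_pos.2 (sub_ne_zero.2 htx)
    nlinarith
  -- `ε` is the sign of `p t`. On that side `|y| = ε y` is smooth and both forms of `g` become `s *
  -- (ε y) ^ k * H y`.
  obtain ⟨ε, hε, hεp⟩ : ∃ ε : ℝ, ε ^ 2 = 1 ∧ 0 < ε * p t := by
    rcases hpt.lt_or_gt with h | h
    · exact ⟨-1, by norm_num, by linarith⟩
    · exact ⟨1, by norm_num, by linarith⟩
  have habs : ∀ y : ℝ, 0 < ε * y → |y| = ε * y := fun y hy => by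
    rw [← abs_of_pos hy, abs_mul]
    have : |ε| = 1 := by rw [← abs_one]; exact (sq_eq_sq_iff_abs_eq_abs _ _).1 (by rw [hε]; norm_num)
    rw [this, one_mul]
  have hsign : ∀ y : ℝ, 0 < ε * y → Real.sign y = ε := fun y hy => by
    rcases mul_self_eq_one_iff.1 ((sq ε).symm.trans hε) with rfl | rfl
    · exact Real.sign_of_pos (by linarith)
    · exact Real.sign_of_neg (by linarith)
  obtain ⟨s, hs, hgs⟩ : ∃ s : ℝ, |s| = 1 ∧
      ∀ y ∈ Ioo (-r) r, 0 < ε * y → g y = s * (ε * y) ^ k * H y := by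
    rcases hg with h | h
    · exact ⟨1, abs_one, fun y hy hy' => by
        rw [h y (Ioo_subset_Icc_self hy), habs y hy', one_mul]⟩
    · refine ⟨ε, ?_, fun y hy hy' => by
        rw [h y (Ioo_subset_Icc_self hy), habs y hy', hsign y hy']⟩
      rw [← abs_one]
      exact (sq_eq_sq_iff_abs_eq_abs _ _).1 (by rw [hε]; norm_num)
  have hside : ∀ᶠ τ in 𝓝 t, 0 < ε * p τ :=
    (hpc.const_mul ε).continuousAt.eventually (lt_mem_nhds hεp)
  set G1 : ℝ → ℝ := fun y => s * ((ε * y) ^ (k - 1) * (k * ε * H y + ε * y * deriv H y)) with hG1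
  have hfirst : ∀ᶠ τ in 𝓝 t, Q₁ τ = G1 (p τ) * p₁ τ := by
    filter_upwards [h4.eventually_nhds, h5.eventually_nhds, hside.eventually_nhds] with τ k4 k5 k6
    have hpτ := k4.self_of_nhds
    have hd := (hasDerivAt_rpow_mul (k := k) s hε k6.self_of_nhds (deriv H) (hderH _ hpτ)
      (hderH1 _ hpτ) rfl).1
    have hd2 := hd.comp τ (hp τ)
    refine (hQ τ).unique (hd2.congr_of_eventuallyEq ?_)
    filter_upwards [k4, k5, k6] with τ' l4 l5 l6
    rw [l5, hgs _ l4 l6]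
    rfl
  have hpt' := h4.self_of_nhds
  have hsecond : Q₂ t = s * ((ε * p t) ^ (k - 2) * K (p t)) * p₁ t * p₁ t + G1 (p t) * p₂ t := by
    have hd := (hasDerivAt_rpow_mul (k := k) s hε hεp (deriv H) (hderH _ hpt')
      (hderH1 _ hpt') rfl).2
    have hd2 := (hd.comp t (hp t)).mul (hp₁ t)
    exact (hQ₁ t).unique (hd2.congr_of_eventuallyEq hfirst)
  -- For `Q = g ∘ p` the terms with `g'` and `p₂` cancel, leaving `g''(p) p₁ ^ 3`.
  have hcross : p₁ t * Q₂ t - Q₁ t * p₂ t = s * p₁ t ^ 3 * ((ε * p t) ^ (k - 2) * K (p t)) := by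
    rw [hsecond, hfirst.self_of_nhds]
    ring
  rw [hcross, abs_mul, abs_mul, abs_mul, hs, one_mul, abs_pow,
    abs_of_pos (Real.rpow_pos_of_pos hεp _), ← habs _ hεp, hc, mul_assoc]
  have hk2 : 0 ≤ k - 2 := by linarith
  calc (|p₁ x| / 2) ^ 3 * ((|p₁ x| / 2) ^ (k - 2) * (|K 0| / 2) * |t - x| ^ (k - 2))
      = (|p₁ x| / 2) ^ 3 * ((|p₁ x| / 2 * |t - x|) ^ (k - 2) * (|K 0| / 2)) := by
        rw [Real.mul_rpow (by positivity) (abs_nonneg _)]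
        ring
    _ ≤ |p₁ t| ^ 3 * (|p t| ^ (k - 2) * |K (p t)|) := by gcongr

end Graph

namespace SmoothClosedCurve

variable {γ : SmoothClosedCurve} {κ : ℝ}

/-- In the orthonormal frame the coordinates of the curve satisfy `Q = g ∘ p`. The numerator of the
curvature changes only by the determinant `±1` of the frame, and the speed is locally bounded. -/
lemma exists_le_abs_curv_of_flat {x k : ℝ} (hk : 2 < k)
    (h : CurvatureVanishesToOrder γ.carrier (γ.param x) k) :
    ∃ c > 0, ∀ᶠ t in 𝓝 x, c * |t - x| ^ (k - 2) ≤ |γ.curv t| := by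
  obtain ⟨e, r, H, g, hr, hH, hH0, hg, hgraph⟩ := h
  have hd : ∀ (i : Fin 2) {c : ℝ → Plane} {c' : Plane} {t : ℝ}, HasDerivAt c c' t →
      HasDerivAt (fun t => inner ℝ (e i) (c t)) (inner ℝ (e i) c') t := fun i c c' t hc => by
    simpa using (hasDerivAt_const t (e i)).inner ℝ hc
  have h00 : inner ℝ (e 0) (e 0) = 1 := by simp [e.orthonormal.1]
  have h11 : inner ℝ (e 1) (e 1) = 1 := by simp [e.orthonormal.1]
  have h01 : inner ℝ (e 0) (e 1) = 0 := e.orthonormal.2 (by simp)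
  have h10 : inner ℝ (e 1) (e 0) = 0 := e.orthonormal.2 (by simp)
  have hgr : ∀ᶠ t in 𝓝 x, inner ℝ (e 1) (γ.param t - γ.param x) =
      g (inner ℝ (e 0) (γ.param t - γ.param x)) := by
    filter_upwards [γ.smooth.continuous.continuousAt.eventually hgraph] with t ht
    obtain ⟨y, hy, hty⟩ := ht.1 (mem_range_self t)
    rw [hty, add_assoc, add_sub_cancel_left, inner_add_right, inner_add_right, inner_smul_right,
      inner_smul_right, inner_smul_right, inner_smul_right, h00, h11, h01, h10]
    simp
  set D := e 0 0 * e 1 1 - e 0 1 * e 1 0 with hD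
  rw [plane_inner] at h00 h11 h01
  have hD2 : D ^ 2 = 1 := by
    rw [hD]
    linear_combination (e 1 0 ^ 2 + e 1 1 ^ 2) * h00 + h11 -
      (e 0 0 * e 1 0 + e 0 1 * e 1 1) * h01
  have hDabs : |D| = 1 := by
    rw [← abs_one]; exact (sq_eq_sq_iff_abs_eq_abs _ _).1 (by rw [hD2]; norm_num)
  obtain ⟨c, hc, hev⟩ := exists_le_abs_cross_of_graph (x := x)
    (p := fun t => inner ℝ (e 0) (γ.param t - γ.param x))
    (p₁ := fun t => inner ℝ (e 0) (deriv γ.param t))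
    (p₂ := fun t => inner ℝ (e 0) (deriv (deriv γ.param) t))
    (Q := fun t => inner ℝ (e 1) (γ.param t - γ.param x))
    (Q₁ := fun t => inner ℝ (e 1) (deriv γ.param t))
    (Q₂ := fun t => inner ℝ (e 1) (deriv (deriv γ.param) t)) hk hr hH hH0 hg
    (fun t => hd 0 ((γ.hasDerivAt_param t).sub_const _)) (fun t => hd 0 (γ.hasDerivAt_deriv t))
    (fun t => hd 1 ((γ.hasDerivAt_param t).sub_const _)) (fun t => hd 1 (γ.hasDerivAt_deriv t))
    (continuous_const.inner γ.contDiff_deriv.continuous) (by simp) (by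
      by_contra! hcon
      obtain ⟨h0, h1⟩ := hcon
      rw [plane_inner] at h0 h1
      have hD0 : D ≠ 0 := by rintro h; rw [h] at hD2; norm_num at hD2
      refine γ.regular x (plane_ext (mul_left_cancel₀ hD0 ?_) (mul_left_cancel₀ hD0 ?_))
      · simp only [PiLp.zero_apply, mul_zero, hD]
        linear_combination e 1 1 * h0 - e 0 1 * h1
      · simp only [PiLp.zero_apply, mul_zero, hD]
        linear_combination e 0 0 * h1 - e 1 0 * h0) hgr
  have hsp : ∀ᶠ t in 𝓝 x, γ.speed t < γ.speed x + 1 :=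
    γ.contDiff_speed.continuous.continuousAt.eventually (gt_mem_nhds (by linarith))
  have hpos : 0 < γ.speed x + 1 := by linarith [γ.speed_pos x]
  refine ⟨c / (γ.speed x + 1) ^ 3, by positivity, ?_⟩
  filter_upwards [hev, hsp] with t h1 h2
  have hcr : inner ℝ (e 0) (deriv γ.param t) * inner ℝ (e 1) (deriv (deriv γ.param) t) -
      inner ℝ (e 1) (deriv γ.param t) * inner ℝ (e 0) (deriv (deriv γ.param) t) =
      D * (γ.curv t * γ.speed t ^ 3) := by
    rw [curv_mul_speed_pow]
    simp only [plane_inner, hD]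
    ring
  simp only [hcr, abs_mul, hDabs, one_mul, abs_of_pos (pow_pos (γ.speed_pos t) 3)] at h1
  rw [div_mul_eq_mul_div, div_le_iff₀ (by positivity)]
  refine h1.trans ?_
  have := γ.speed_pos t
  gcongr

/-- For `|t - x| ≤ 1` a larger exponent gives a weaker bound, so every `k ≤ κ`, and also the points
of nonzero curvature, fit the single exponent `κ - 2`. -/
theorem exists_le_abs_curv (hκ : 2 < κ) (hflat : γ.HasFlatPointsOfOrder κ) (x : ℝ) :
    ∃ c > 0, ∀ᶠ t in 𝓝 x, c * |t - x| ^ (κ - 2) ≤ |γ.curv t| := by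
  have hone : ∀ᶠ t in 𝓝 x, |t - x| ≤ 1 := by
    filter_upwards [Metric.closedBall_mem_nhds x one_pos] with t ht
    rwa [Metric.mem_closedBall, Real.dist_eq] at ht
  by_cases hx : γ.curv x = 0
  · obtain ⟨k, hk, hkκ, h⟩ := hflat.2 (γ.param x) ⟨x, hx, rfl⟩
    obtain ⟨c, hc, hev⟩ := exists_le_abs_curv_of_flat hk h
    refine ⟨c, hc, ?_⟩
    filter_upwards [hev, hone] with t h1 h2
    refine le_trans ?_ h1
    refine mul_le_mul_of_nonneg_left ?_ hc.le
    exact Real.rpow_le_rpow_of_exponent_ge_of_imp (abs_nonneg _) h2 (by linarith)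
      (fun _ h => by linarith)
  · have hpos := abs_pos.2 hx
    refine ⟨|γ.curv x| / 2, by linarith, ?_⟩
    filter_upwards [hone, γ.contDiff_curv.continuous.abs.continuousAt.eventually
      (lt_mem_nhds (show |γ.curv x| / 2 < |γ.curv x| by linarith))] with t h1 h2
    have h3 : |t - x| ^ (κ - 2) ≤ 1 := Real.rpow_le_one (abs_nonneg _) h1 (by linarith)
    nlinarith

end SmoothClosedCurve

/-! ### Smooth cutoffs. -/

/-- A smooth function that coincides with the inverse away from a neighbourhood of zero. -/
lemma exists_contDiff_inv {c : ℝ} (hc : 0 < c) :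
    ∃ ρ : ℝ → ℝ, ContDiff ℝ ∞ ρ ∧ ∀ x, c ≤ |x| → ρ x * x = 1 := by
  refine ⟨fun x => Real.smoothTransition (2 * (x / c) ^ 2 - 1) / x, ?_, fun x hx => ?_⟩
  · refine contDiff_iff_contDiffAt.2 fun x => ?_
    rcases eq_or_ne x 0 with rfl | hx
    · have h : (fun x => Real.smoothTransition (2 * (x / c) ^ 2 - 1) / x) =ᶠ[𝓝 0] fun _ => 0 := by
        have h1 : ContinuousAt (fun x => 2 * (x / c) ^ 2 - 1) 0 := by fun_prop
        have h2 : 2 * ((0 : ℝ) / c) ^ 2 - 1 < 0 := by norm_num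
        filter_upwards [h1.eventually (gt_mem_nhds h2)] with y hy
        rw [Real.smoothTransition.zero_of_nonpos hy.le, zero_div]
      exact contDiffAt_const.congr_of_eventuallyEq h
    · refine ContDiffAt.div ?_ contDiffAt_id hx
      exact (Real.smoothTransition.contDiff.comp (by fun_prop)).contDiffAt
  · have hx0 : x ≠ 0 := by
      rintro rfl
      simp at hx
      linarith
    have h1 : 1 ≤ (x / c) ^ 2 := by
      rw [← sq_abs, abs_div, abs_of_pos hc]
      exact one_le_pow₀ ((one_le_div hc).2 hx)
    simp only []
    rw [Real.smoothTransition.one_of_one_le (by linarith), one_div, inv_mul_cancel₀ hx0]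

/-- A smooth cutoff away from zero. -/
lemma exists_cutoff : ∃ φ : ℝ → ℝ, ContDiff ℝ ∞ φ ∧ (∀ x, |x| ≤ 1 / 2 → φ x = 0) ∧
    ∀ x, 3 / 4 ≤ |x| → φ x = 1 := by
  refine ⟨fun x => Real.smoothTransition (16 / 5 * (x ^ 2 - 1 / 4)),
    Real.smoothTransition.contDiff.comp (by fun_prop), fun x hx => ?_, fun x hx => ?_⟩
  · refine Real.smoothTransition.zero_of_nonpos ?_
    rw [← sq_abs]
    nlinarith [abs_nonneg x]
  · refine Real.smoothTransition.one_of_one_le ?_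
    rw [← sq_abs]
    nlinarith

/-! ### One-sided pieces of the curve and the turning of the tangent. -/

namespace SmoothClosedCurve

/-- An interval of parameters on which the curvature does not change sign, the tangent turns only
a little, and the angle between two tangents is bounded below. -/
structure IsGoodPiece (γ : SmoothClosedCurve) (κ a b : ℝ) : Prop where
  cross : ∃ c > 0, ∀ s ∈ Icc a b, ∀ t ∈ Icc a b,
    c * |s - t| ^ (κ - 1) ≤ |γ.tx s * γ.ty t - γ.ty s * γ.tx t|
  sign : ∃ σ : ℝ, |σ| ≤ 1 ∧ ∀ t ∈ Icc a b, |γ.curv t| ≤ σ * γ.curv t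
  osc : ∀ s ∈ Icc a b, ∀ t ∈ Icc a b, |γ.tx s - γ.tx t| ≤ 1 / 8 ∧ |γ.ty s - γ.ty t| ≤ 1 / 8

variable {γ : SmoothClosedCurve} {κ : ℝ}

/-- The curvature can vanish only at `x`, which is not interior to the interval, so the intermediate
value theorem excludes a change of sign. -/
lemma exists_sign_of_le_abs_curv {a b x c : ℝ} (hx : x ≤ a ∨ b ≤ x) (hc : 0 < c)
    (hcurv : ∀ t ∈ Icc a b, c * |t - x| ^ (κ - 2) ≤ |γ.curv t|) :
    ∃ σ : ℝ, |σ| ≤ 1 ∧ ∀ t ∈ Icc a b, |γ.curv t| ≤ σ * γ.curv t := by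
  by_cases hpos : ∀ t ∈ Icc a b, 0 ≤ γ.curv t
  · exact ⟨1, by simp, fun t ht => by rw [one_mul, abs_of_nonneg (hpos t ht)]⟩
  by_cases hneg : ∀ t ∈ Icc a b, γ.curv t ≤ 0
  · exact ⟨-1, by simp, fun t ht => by rw [neg_one_mul, abs_of_nonpos (hneg t ht)]⟩
  exfalso
  push Not at hpos hneg
  obtain ⟨s, hs, hs0⟩ := hpos
  obtain ⟨t, ht, ht0⟩ := hneg
  obtain ⟨z, hz, hz0⟩ := intermediate_value_uIcc (f := γ.curv) (a := s) (b := t)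
    γ.contDiff_curv.continuous.continuousOn
    (show (0 : ℝ) ∈ uIcc (γ.curv s) (γ.curv t) from by
      rw [uIcc_of_le (by linarith)]; exact ⟨hs0.le, ht0.le⟩)
  have hzI : z ∈ Icc a b := uIcc_subset_Icc hs ht hz
  have hzs : z ≠ s := by rintro rfl; linarith
  have hzt : z ≠ t := by rintro rfl; linarith
  have hzx : z ≠ x := by
    rintro rfl
    rcases le_total s t with h | h
    · rw [uIcc_of_le h] at hz
      have h1 := lt_of_le_of_ne hz.1 hzs.symm
      have h2 := lt_of_le_of_ne hz.2 hzt
      rcases hx with hx | hx <;> linarith [hs.1, ht.2]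
    · rw [uIcc_of_ge h] at hz
      have h1 := lt_of_le_of_ne hz.1 hzt.symm
      have h2 := lt_of_le_of_ne hz.2 hzs
      rcases hx with hx | hx <;> linarith [ht.1, hs.2]
  have h1 := hcurv z hzI
  rw [hz0, abs_zero] at h1
  have h2 : 0 < c * |z - x| ^ (κ - 2) :=
    mul_pos hc (Real.rpow_pos_of_pos (abs_pos.2 (sub_ne_zero.2 hzx)) _)
  linarith

lemma exists_le_speed (γ : SmoothClosedCurve) : ∃ v > 0, ∀ t, v ≤ γ.speed t := by
  have hc : IsCompact (range γ.speed) := γ.speed_periodic.compact_of_continuous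
    γ.period_pos.ne' γ.contDiff_speed.continuous
  obtain ⟨_, ⟨t₀, rfl⟩, h⟩ := hc.exists_isLeast (range_nonempty _)
  exact ⟨γ.speed t₀, γ.speed_pos _, fun t => h (mem_range_self t)⟩

/-- The cross product is the sine of the turning angle. Its derivative is curvature times speed
times the cosine, and the cosine stays at least `1 / 2` on the piece. Integrating the lower bound
`|t - x| ^ (κ - 2)` raises the exponent to `κ - 1`. -/
lemma exists_cross_lower_bound (hκ : 2 < κ) {a b x c σ : ℝ} (hx : x ≤ a ∨ b ≤ x) (hc : 0 < c)
    (hcurv : ∀ t ∈ Icc a b, c * |t - x| ^ (κ - 2) ≤ |γ.curv t|)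
    (hσ : |σ| ≤ 1) (hsign : ∀ t ∈ Icc a b, |γ.curv t| ≤ σ * γ.curv t)
    (hosc : ∀ s ∈ Icc a b, ∀ t ∈ Icc a b,
      |γ.tx s - γ.tx t| ≤ 1 / 8 ∧ |γ.ty s - γ.ty t| ≤ 1 / 8) :
    ∃ c > 0, ∀ s ∈ Icc a b, ∀ t ∈ Icc a b,
      c * |s - t| ^ (κ - 1) ≤ |γ.tx s * γ.ty t - γ.ty s * γ.tx t| := by
  obtain ⟨v, hv, hspeed⟩ := γ.exists_le_speed
  have hκ1 : 0 < κ - 1 := by linarith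
  have hκ2 : 0 ≤ κ - 2 := by linarith
  set C := c * v / 2 / (κ - 1) with hC
  have hCmul : C * (κ - 1) = c * v / 2 := div_mul_cancel₀ _ hκ1.ne'
  have hdot : ∀ s ∈ Icc a b, ∀ t ∈ Icc a b,
      1 / 2 ≤ γ.tx s * γ.tx t + γ.ty s * γ.ty t := fun s hs t ht => by
    have h1 := γ.tx_sq_add_ty_sq s
    have h2 := γ.tx_sq_add_ty_sq t
    obtain ⟨h3, h4⟩ := hosc s hs t ht
    have h5 := sq_le_sq' (abs_le.1 h3).1 (abs_le.1 h3).2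
    have h6 := sq_le_sq' (abs_le.1 h4).1 (abs_le.1 h4).2
    nlinarith
  have hrate : ∀ s ∈ Icc a b, ∀ t ∈ Icc a b, ∀ w : ℝ, 0 ≤ w → w ≤ |t - x| →
      C * ((κ - 1) * w ^ (κ - 2)) ≤
        σ * (γ.curv t * γ.speed t * (γ.tx s * γ.tx t + γ.ty s * γ.ty t)) :=
    fun s hs t ht w hw hwt => by
      have h1 := hdot s hs t ht
      have h2 := hspeed t
      have h3 := (hcurv t ht).trans (hsign t ht)
      have h4 : c * w ^ (κ - 2) ≤ c * |t - x| ^ (κ - 2) := by gcongr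
      have h5 : 0 ≤ c * w ^ (κ - 2) := by positivity
      calc C * ((κ - 1) * w ^ (κ - 2)) = (c * w ^ (κ - 2)) * (v * (1 / 2)) := by
            rw [← mul_assoc, hCmul]; ring
        _ ≤ (σ * γ.curv t) * (γ.speed t * (γ.tx s * γ.tx t + γ.ty s * γ.ty t)) := by
            exact mul_le_mul (h4.trans h3)
              (mul_le_mul h2 h1 (by norm_num) (hv.le.trans h2)) (by positivity)
              (h5.trans (h4.trans h3))
        _ = _ := by ring
  have hCpos : 0 < C := by positivity
  have hpow : ∀ y : ℝ, HasDerivAt (fun z : ℝ => z ^ (κ - 1)) ((κ - 1) * y ^ (κ - 2)) y := fun y => by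
    have := Real.hasDerivAt_rpow_const (x := y) (p := κ - 1) (Or.inr (by linarith))
    rwa [show κ - 1 - 1 = κ - 2 by ring] at this
  have hmain : ∀ s ∈ Icc a b, ∀ t ∈ Icc a b, s ≤ t →
      C * (t - s) ^ (κ - 1) ≤ σ * (γ.tx s * γ.ty t - γ.ty s * γ.tx t) := fun s hs t ht hst => by
    have hsub : Icc s t ⊆ Icc a b := Icc_subset_Icc hs.1 ht.2
    -- Fix the endpoint nearer to `x` and move the other away from it: the distance moved is then at
    -- most the distance to `x`, as `hrate` requires.
    rcases hx with hx | hx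
    · have hd : ∀ y, HasDerivAt
          (fun y => σ * (γ.tx s * γ.ty y - γ.ty s * γ.tx y) - C * (y - s) ^ (κ - 1))
          (σ * (γ.curv y * γ.speed y * (γ.tx s * γ.tx y + γ.ty s * γ.ty y)) -
            C * ((κ - 1) * (y - s) ^ (κ - 2))) y := fun y => by
        convert! ((((γ.hasDerivAt_ty y).const_mul (γ.tx s)).sub
          ((γ.hasDerivAt_tx y).const_mul (γ.ty s))).const_mul σ).sub
          (((hpow (y - s)).comp_sub_const y s).const_mul C) using 1
        ring
      have hmono : MonotoneOn
          (fun y => σ * (γ.tx s * γ.ty y - γ.ty s * γ.tx y) - C * (y - s) ^ (κ - 1)) (Icc s t) := by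
        refine monotoneOn_of_deriv_nonneg (convex_Icc _ _)
          (fun y _ => (hd y).continuousAt.continuousWithinAt)
          (fun y _ => (hd y).differentiableAt.differentiableWithinAt) fun y hy => ?_
        rw [interior_Icc] at hy
        rw [(hd y).deriv]
        have hy' := hsub (Ioo_subset_Icc_self hy)
        refine sub_nonneg.2 (hrate s hs y hy' _ (by linarith [hy.1]) ?_)
        rw [abs_of_nonneg (by linarith [hy'.1])]
        linarith [hs.1]
      have h := hmono (left_mem_Icc.2 hst) (right_mem_Icc.2 hst) hst
      simp only [sub_self, Real.zero_rpow hκ1.ne', mul_zero] at h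
      rw [mul_comm (γ.tx s) (γ.ty s), sub_self, mul_zero] at h
      linarith
    · have hd : ∀ y, HasDerivAt
          (fun y => σ * (γ.tx y * γ.ty t - γ.ty y * γ.tx t) - C * (t - y) ^ (κ - 1))
          (C * ((κ - 1) * (t - y) ^ (κ - 2)) -
            σ * (γ.curv y * γ.speed y * (γ.tx t * γ.tx y + γ.ty t * γ.ty y))) y := fun y => by
        convert! ((((γ.hasDerivAt_tx y).mul_const (γ.ty t)).sub
          ((γ.hasDerivAt_ty y).mul_const (γ.tx t))).const_mul σ).sub
          (((hpow (t - y)).comp_const_sub t y).const_mul C) using 1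
        ring
      have hmono : AntitoneOn
          (fun y => σ * (γ.tx y * γ.ty t - γ.ty y * γ.tx t) - C * (t - y) ^ (κ - 1)) (Icc s t) := by
        refine antitoneOn_of_deriv_nonpos (convex_Icc _ _)
          (fun y _ => (hd y).continuousAt.continuousWithinAt)
          (fun y _ => (hd y).differentiableAt.differentiableWithinAt) fun y hy => ?_
        rw [interior_Icc] at hy
        rw [(hd y).deriv]
        have hy' := hsub (Ioo_subset_Icc_self hy)
        refine sub_nonpos.2 (hrate t ht y hy' _ (by linarith [hy.2]) ?_)
        rw [abs_of_nonpos (by linarith [hy'.2])]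
        linarith [ht.2]
      have h := hmono (left_mem_Icc.2 hst) (right_mem_Icc.2 hst) hst
      simp only [sub_self, Real.zero_rpow hκ1.ne', mul_zero] at h
      rw [mul_comm (γ.tx t) (γ.ty t), sub_self, mul_zero] at h
      linarith
  have hle : ∀ y, σ * y ≤ |y| := fun y => by
    refine (le_abs_self _).trans ?_
    rw [abs_mul]
    exact mul_le_of_le_one_left (abs_nonneg _) hσ
  refine ⟨C, hCpos, fun s hs t ht => ?_⟩
  rcases le_total s t with h | h
  · rw [abs_sub_comm s t, abs_of_nonneg (sub_nonneg.2 h)]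
    exact (hmain s hs t ht h).trans (hle _)
  · rw [abs_of_nonneg (sub_nonneg.2 h)]
    refine (hmain t ht s hs h).trans ((hle _).trans (le_of_eq ?_))
    rw [← abs_neg]
    congr 1
    ring

/-- The two sides of `x` are separate pieces, since the curvature changes sign at an inflection
point. The bound `1 / 16` around `x` gives `1 / 8` between any two points. -/
lemma exists_isGoodPiece (hκ : 2 < κ) (hflat : γ.HasFlatPointsOfOrder κ) (x : ℝ) :
    ∃ r > 0, (∀ a, x - r < a → a ≤ x → γ.IsGoodPiece κ a x) ∧
      ∀ b, x ≤ b → b < x + r → γ.IsGoodPiece κ x b := by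
  obtain ⟨c, hc, hcurv⟩ := exists_le_abs_curv hκ hflat x
  have hosc : ∀ f : ℝ → ℝ, Continuous f → ∀ᶠ t in 𝓝 x, |f t - f x| ≤ 1 / 16 := fun f hf => by
    filter_upwards [hf.continuousAt.eventually (Metric.closedBall_mem_nhds (f x)
      (show (0 : ℝ) < 1 / 16 by norm_num))] with t ht
    rwa [Real.dist_eq] at ht
  obtain ⟨r, hr, hball⟩ := Metric.eventually_nhds_iff.1 (hcurv.and
    ((hosc _ γ.contDiff_tx.continuous).and (hosc _ γ.contDiff_ty.continuous)))
  have key : ∀ a b, x - r < a → b < x + r → (x ≤ a ∨ b ≤ x) → γ.IsGoodPiece κ a b :=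
    fun a b ha hb hx => by
      have hin : ∀ t ∈ Icc a b, dist t x < r := fun t ht => by
        rw [Real.dist_eq, abs_lt]
        constructor <;> linarith [ht.1, ht.2]
      have h1 : ∀ t ∈ Icc a b, c * |t - x| ^ (κ - 2) ≤ |γ.curv t| := fun t ht =>
        (hball (hin t ht)).1
      have h2 : ∀ s ∈ Icc a b, ∀ t ∈ Icc a b,
          |γ.tx s - γ.tx t| ≤ 1 / 8 ∧ |γ.ty s - γ.ty t| ≤ 1 / 8 := fun s hs t ht => by
        obtain ⟨-, h3, h4⟩ := hball (hin s hs)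
        obtain ⟨-, h5, h6⟩ := hball (hin t ht)
        rw [abs_le] at *
        rw [abs_le]
        refine ⟨⟨?_, ?_⟩, ?_, ?_⟩ <;> linarith [h3.1, h3.2, h4.1, h4.2, h5.1, h5.2, h6.1, h6.2]
      obtain ⟨σ, hσ, hsign⟩ := exists_sign_of_le_abs_curv hx hc h1
      exact ⟨exists_cross_lower_bound hκ hx hc h1 hσ hsign h2, ⟨σ, hσ, hsign⟩, h2⟩
  exact ⟨r, hr, fun a h1 _ => key a x h1 (by linarith) (Or.inr le_rfl),
    fun b _ h2 => key x b (by linarith) h2 (Or.inl le_rfl)⟩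

end SmoothClosedCurve

/-! ### Oscillatory integrals along the curve, uniform in direction and offset. -/

namespace SmoothClosedCurve

variable {γ : SmoothClosedCurve} {κ : ℝ}

/-- The compact set of directions and signed distances. -/
def paramBox (η : ℝ) : Set (ℝ × ℝ) := Icc (-Real.pi) Real.pi ×ˢ Icc (-η) η

lemma isCompact_paramBox (η : ℝ) : IsCompact (paramBox η) := isCompact_Icc.prod isCompact_Icc

lemma half_le_one_add_mul_curv {η : ℝ} (hη : ∀ t, η * |γ.curv t| ≤ 1 / 2) {p : ℝ × ℝ}
    (hp : p ∈ paramBox η) (t : ℝ) : 1 / 2 ≤ 1 + p.2 * γ.curv t := by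
  have h1 : |p.2 * γ.curv t| ≤ 1 / 2 := by
    rw [abs_mul]
    refine le_trans ?_ (hη t)
    gcongr
    exact abs_le.2 hp.2
  linarith [(abs_le.1 h1).1]

lemma cross_eq_tanComp (τ s t : ℝ) : γ.tx s * γ.ty t - γ.ty s * γ.tx t =
    γ.tanComp τ s * γ.norComp τ t - γ.norComp τ s * γ.tanComp τ t := by
  have h := Real.cos_sq_add_sin_sq τ
  unfold tanComp norComp
  linear_combination (-(γ.tx s * γ.ty t - γ.ty s * γ.tx t)) * h

/-- Two unit tangents almost orthogonal to the same direction are almost parallel: their cross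
product is at most `2 δ`. The turning bound then keeps the parameters close. -/
lemma abs_sub_le_of_abs_tanComp_lt {c δ s t τ : ℝ} (hκ : 1 < κ) (hc : 0 < c)
    (hcross : c * |s - t| ^ (κ - 1) ≤ |γ.tx s * γ.ty t - γ.ty s * γ.tx t|)
    (hs : |γ.tanComp τ s| < δ) (ht : |γ.tanComp τ t| < δ) :
    |s - t| ≤ (2 / c * δ) ^ (κ - 1)⁻¹ := by
  have h1 : |γ.tx s * γ.ty t - γ.ty s * γ.tx t| ≤ 2 * δ := by
    rw [γ.cross_eq_tanComp τ]
    refine (abs_sub _ _).trans ?_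
    rw [abs_mul, abs_mul]
    have h2 := γ.abs_norComp_le τ s
    have h3 := γ.abs_norComp_le τ t
    nlinarith [abs_nonneg (γ.norComp τ s), abs_nonneg (γ.norComp τ t),
      abs_nonneg (γ.tanComp τ s), abs_nonneg (γ.tanComp τ t)]
  have h2 : |s - t| ^ (κ - 1) ≤ 2 / c * δ := by
    rw [div_mul_eq_mul_div, le_div_iff₀ hc]
    linarith
  have hκ1 : 0 < κ - 1 := by linarith
  calc |s - t| = (|s - t| ^ (κ - 1)) ^ (κ - 1)⁻¹ := by
        rw [← Real.rpow_mul (abs_nonneg _), mul_inv_cancel₀ hκ1.ne', Real.rpow_one]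
    _ ≤ _ := by gcongr

/-- Monotonicity of `tanComp`. The curvature has constant sign on the piece; `norComp` exceeds `1 /
2` in absolute value at one point and varies by at most `1 / 4`, so it has constant sign too. -/
lemma IsGoodPiece.exists_sign_deriv_tanComp {a b : ℝ} (h : γ.IsGoodPiece κ a b) {τ s : ℝ}
    (hs : s ∈ Icc a b) (hw : 1 / 2 < |γ.norComp τ s|) :
    ∃ σ : ℝ, |σ| ≤ 1 ∧ ∀ t ∈ Icc a b, |-(γ.curv t * γ.speed t * γ.norComp τ t)| ≤
      σ * -(γ.curv t * γ.speed t * γ.norComp τ t) := by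
  obtain ⟨σ, hσ, hsign⟩ := h.sign
  have hclose : ∀ t ∈ Icc a b, |γ.norComp τ s - γ.norComp τ t| ≤ 1 / 4 := fun t ht => by
    obtain ⟨h1, h2⟩ := h.osc s hs t ht
    have e : γ.norComp τ s - γ.norComp τ t =
        Real.cos τ * (γ.ty s - γ.ty t) - Real.sin τ * (γ.tx s - γ.tx t) := by
      unfold norComp; ring
    rw [e]
    refine (abs_sub _ _).trans ?_
    rw [abs_mul, abs_mul]
    nlinarith [Real.abs_cos_le_one τ, Real.abs_sin_le_one τ, abs_nonneg (γ.ty s - γ.ty t),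
      abs_nonneg (γ.tx s - γ.tx t)]
  obtain ⟨μ, hμ, hnor⟩ : ∃ μ : ℝ, |μ| ≤ 1 ∧ ∀ t ∈ Icc a b,
      |γ.norComp τ t| = μ * γ.norComp τ t := by
    rcases le_total 0 (γ.norComp τ s) with h0 | h0
    · rw [abs_of_nonneg h0] at hw
      refine ⟨1, by simp, fun t ht => ?_⟩
      rw [one_mul, abs_of_nonneg]
      linarith [(abs_le.1 (hclose t ht)).2]
    · rw [abs_of_nonpos h0] at hw
      refine ⟨-1, by simp, fun t ht => ?_⟩
      rw [neg_one_mul, abs_of_nonpos]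
      linarith [(abs_le.1 (hclose t ht)).1]
  refine ⟨-(σ * μ), ?_, fun t ht => ?_⟩
  · rw [abs_neg, abs_mul]
    exact mul_le_one₀ hσ (abs_nonneg _) hμ
  · rw [abs_neg, abs_mul, abs_mul, abs_of_pos (γ.speed_pos t), hnor t ht]
    have h1 : 0 ≤ μ * γ.norComp τ t := by rw [← hnor t ht]; exact abs_nonneg _
    calc |γ.curv t| * γ.speed t * (μ * γ.norComp τ t)
        ≤ σ * γ.curv t * γ.speed t * (μ * γ.norComp τ t) := by
          have := γ.speed_pos t
          have := hsign t ht
          gcongr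
      _ = _ := by ring

/-- The amplitude of the van der Corput argument. -/
lemma exists_amplitude {A ψ : ℝ → ℝ} (hA : ContDiff ℝ ∞ A) (hψ : ContDiff ℝ ∞ ψ) {η : ℝ}
    (hη : ∀ t, η * |γ.curv t| ≤ 1 / 2) :
    ∃ B : (ℝ × ℝ) × ℝ → ℝ, ContDiff ℝ ∞ B ∧ ∀ p ∈ paramBox η, ∀ t,
      B (p, t) * (γ.speed t * (1 + p.2 * γ.curv t)) = A t * ψ (γ.norComp p.1 t) := by
  -- `1 + η κ` may vanish for offsets outside the box, so its inverse is replaced by a function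
  -- smooth everywhere that agrees with it on the box.
  obtain ⟨ρ, hρ, hρ1⟩ := exists_contDiff_inv (c := 1 / 2) (by norm_num)
  have h1 := γ.contDiff_norComp
  have h2 := γ.contDiff_speed
  have h3 := γ.contDiff_curv
  have h4 : ContDiff ℝ ∞ fun t => (γ.speed t)⁻¹ := h2.inv fun t => (γ.speed_pos t).ne'
  refine ⟨fun x => A x.2 * ψ (γ.norComp x.1.1 x.2) *
    ((γ.speed x.2)⁻¹ * ρ (1 + x.1.2 * γ.curv x.2)), ?_, fun p hp t => ?_⟩
  · refine ((hA.comp contDiff_snd).mul (hψ.comp h1)).mul ((h4.comp contDiff_snd).mul (hρ.comp ?_))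
    fun_prop
  · have h5 := half_le_one_add_mul_curv hη hp t
    have h6 := hρ1 _ (h5.trans (le_abs_self _))
    have h7 := (γ.speed_pos t).ne'
    simp only []
    calc _ = A t * ψ (γ.norComp p.1 t) * (ρ (1 + p.2 * γ.curv t) * (1 + p.2 * γ.curv t)) *
          ((γ.speed t)⁻¹ * γ.speed t) := by ring
      _ = _ := by rw [h6, inv_mul_cancel₀ h7, mul_one, mul_one]

lemma contDiff_prod_left {f : (ℝ × ℝ) × ℝ → ℝ} (hf : ContDiff ℝ ∞ f) (p : ℝ × ℝ) :
    ContDiff ℝ ∞ fun t => f (p, t) :=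
  hf.comp (contDiff_const.prodMk contDiff_id)

/-- Van der Corput with `u = tanComp`. The set where `|u| < δ` has diameter of order `δ ^ (1 / (κ -
1))`, and the rest contributes order `1 / (lam * δ)`. -/
lemma IsGoodPiece.exists_norm_integral_le {a b : ℝ} (h : γ.IsGoodPiece κ a b) (hab : a ≤ b)
    (hκ : 2 < κ) {A ψ : ℝ → ℝ} (hA : ContDiff ℝ ∞ A) (hψ : ContDiff ℝ ∞ ψ)
    (hψ0 : ∀ x, |x| ≤ 1 / 2 → ψ x = 0) {η : ℝ} (hη : ∀ t, η * |γ.curv t| ≤ 1 / 2) :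
    ∃ C, 0 ≤ C ∧ ∀ p ∈ paramBox η, ∀ lam : ℝ, 0 < lam →
      ‖∫ t in a..b, ((A t * ψ (γ.norComp p.1 t) : ℝ) : ℂ) * cis (lam * γ.phase (p, t))‖ ≤
        C * lam ^ (-κ⁻¹) := by
  obtain ⟨c, hc, hcross⟩ := h.cross
  obtain ⟨B, hB, hBm⟩ := exists_amplitude hA hψ hη
  have hcomp := (isCompact_paramBox η).prod (isCompact_Icc (a := a) (b := b))
  obtain ⟨M₁, hM₁⟩ := hcomp.exists_bound_of_continuousOn hB.continuous.continuousOn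
  obtain ⟨M₂, hM₂⟩ := hcomp.exists_bound_of_continuousOn hB.sndDeriv.continuous.continuousOn
  have hAψ : ContDiff ℝ ∞ fun x : (ℝ × ℝ) × ℝ => A x.2 * ψ (γ.norComp x.1.1 x.2) :=
    (hA.comp contDiff_snd).mul (hψ.comp γ.contDiff_norComp)
  obtain ⟨M₃, hM₃⟩ := hcomp.exists_bound_of_continuousOn hAψ.continuous.continuousOn
  set M := max (max M₁ M₂) 0
  have hba : 0 ≤ b - a := sub_nonneg.2 hab
  have hM0 : 0 ≤ M := le_max_right _ _
  refine ⟨max M₃ 0 * (2 / c) ^ (κ - 1)⁻¹ + 2 * (M * (4 + (b - a))), by positivity,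
    fun p hp lam hlam => ?_⟩
  -- If `norComp` never exceeds `1 / 2` in absolute value on the piece, the amplitude vanishes
  -- identically.
  by_cases hw : ∃ s ∈ Icc a b, 1 / 2 < |γ.norComp p.1 s|
  swap
  · push Not at hw
    rw [intervalIntegral.integral_congr (g := fun _ => (0 : ℂ)) fun t ht => by
      rw [uIcc_of_le hab] at ht
      simp [hψ0 _ (hw t ht)]]
    simp only [intervalIntegral.integral_zero, norm_zero]
    positivity
  obtain ⟨s₀, hs₀, hw⟩ := hw
  obtain ⟨σ, hσ, hmono⟩ := h.exists_sign_deriv_tanComp hs₀ hw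
  have hκ1 : 0 < κ - 1 := by linarith
  -- This choice balances the two contributions: both become `lam ^ (-1/κ)`.
  set δ := lam ^ (κ⁻¹ - 1) with hδ
  have hδpos : 0 < δ := Real.rpow_pos_of_pos hlam _
  have hbound := norm_integral_cis_le_of_diam (u := γ.tanComp p.1)
    (u' := fun t => -(γ.curv t * γ.speed t * γ.norComp p.1 t)) (B := fun t => B (p, t))
    (B' := fun t => sndDeriv B (p, t)) (m := fun t => γ.speed t * (1 + p.2 * γ.curv t))
    (Φ := fun t => γ.phase (p, t)) (M := M) (δ := δ) (lam := lam) (σ := σ) (M' := max M₃ 0)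
    (ℓ := (2 / c * δ) ^ (κ - 1)⁻¹) (γ.hasDerivAt_tanComp p.1) (hasDerivAt_sndDeriv hB p)
    (γ.hasDerivAt_phase p)
    (((γ.contDiff_curv.continuous.mul γ.contDiff_speed.continuous).mul
      (contDiff_prod_left γ.contDiff_norComp p).continuous).neg)
    (contDiff_prod_left hB.sndDeriv p).continuous
    (γ.contDiff_speed.continuous.mul
      (continuous_const.add (continuous_const.mul γ.contDiff_curv.continuous)))
    hδpos hlam hab
    (fun t ht => (hM₁ (p, t) ⟨hp, ht⟩).trans ((le_max_left _ _).trans (le_max_left _ _)))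
    (fun t ht => (hM₂ (p, t) ⟨hp, ht⟩).trans ((le_max_right _ _).trans (le_max_left _ _)))
    (fun t ht => by
      rw [hBm p hp]
      exact (hM₃ (p, t) ⟨hp, ht⟩).trans (le_max_left _ _))
    hσ hmono (by positivity)
    (fun s hs t ht h1 h2 =>
      abs_sub_le_of_abs_tanComp_lt (by linarith) hc (hcross s hs t ht) h1 h2)
  simp only [hBm p hp] at hbound
  refine hbound.trans (le_of_eq ?_)
  have e1 : (2 / c * δ) ^ (κ - 1)⁻¹ = (2 / c) ^ (κ - 1)⁻¹ * lam ^ (-κ⁻¹) := by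
    rw [Real.mul_rpow (by positivity) hδpos.le, hδ, ← Real.rpow_mul hlam.le]
    congr 2
    have : κ ≠ 0 := by linarith
    field_simp
    ring
  have e2 : lam * δ = (lam ^ (-κ⁻¹))⁻¹ := by
    rw [hδ, Real.rpow_neg hlam.le, inv_inv, mul_comm, ← Real.rpow_add_one hlam.ne']
    ring_nf
  rw [e1, e2, div_inv_eq_mul]
  ring

/-- The stationary part: decay of order `1 / κ`. -/
theorem exists_norm_integral_near_le (hκ : 2 < κ) (hflat : γ.HasFlatPointsOfOrder κ)
    {A ψ : ℝ → ℝ} (hA : ContDiff ℝ ∞ A) (hψ : ContDiff ℝ ∞ ψ)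
    (hψ0 : ∀ x, |x| ≤ 1 / 2 → ψ x = 0) {η : ℝ} (hη : ∀ t, η * |γ.curv t| ≤ 1 / 2)
    {a b : ℝ} (hab : a ≤ b) :
    ∃ C, 0 ≤ C ∧ ∀ p ∈ paramBox η, ∀ lam : ℝ, 0 < lam →
      ‖∫ t in a..b, ((A t * ψ (γ.norComp p.1 t) : ℝ) : ℂ) * cis (lam * γ.phase (p, t))‖ ≤
        C * lam ^ (-κ⁻¹) := by
  refine interval_induction (P := fun a b => ∃ C, 0 ≤ C ∧ ∀ p ∈ paramBox η, ∀ lam : ℝ, 0 < lam →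
      ‖∫ t in a..b, ((A t * ψ (γ.norComp p.1 t) : ℝ) : ℂ) * cis (lam * γ.phase (p, t))‖ ≤
        C * lam ^ (-κ⁻¹)) ?_ (fun x => ?_) hab
  · rintro a b c - - ⟨C₁, h₁, H₁⟩ ⟨C₂, h₂, H₂⟩
    refine ⟨C₁ + C₂, add_nonneg h₁ h₂, fun p hp lam hlam => ?_⟩
    have hi : Continuous fun t => ((A t * ψ (γ.norComp p.1 t) : ℝ) : ℂ) *
        cis (lam * γ.phase (p, t)) :=
      (Complex.continuous_ofReal.comp (hA.continuous.mul (hψ.continuous.comp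
        (contDiff_prod_left γ.contDiff_norComp p).continuous))).mul
        (continuous_cis.comp (continuous_const.mul
          (contDiff_prod_left γ.contDiff_phase p).continuous))
    rw [← intervalIntegral.integral_add_adjacent_intervals (hi.intervalIntegrable a b)
      (hi.intervalIntegrable b c), add_mul]
    exact (norm_add_le _ _).trans (add_le_add (H₁ p hp lam hlam) (H₂ p hp lam hlam))
  · obtain ⟨r, hr, hl, hrt⟩ := exists_isGoodPiece hκ hflat x
    exact ⟨r, hr, fun a h1 h2 => (hl a h1 h2).exists_norm_integral_le h2 hκ hA hψ hψ0 hη,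
      fun b h1 h2 => (hrt b h1 h2).exists_norm_integral_le h1 hκ hA hψ hψ0 hη⟩

/-- The nonstationary part: rapid decay. -/
theorem exists_norm_integral_far_le {A χ : ℝ → ℝ} (hA : ContDiff ℝ ∞ A)
    (hAT : Function.Periodic A γ.period) (hχ : ContDiff ℝ ∞ χ)
    (hχ0 : ∀ x, 3 / 4 ≤ |x| → χ x = 0) {η : ℝ} (hη : ∀ t, η * |γ.curv t| ≤ 1 / 2) (N : ℕ) :
    ∃ C, 0 ≤ C ∧ ∀ p ∈ paramBox η, ∀ lam : ℝ, 0 < lam →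
      ‖∫ t in (0 : ℝ)..γ.period, ((A t * χ (γ.norComp p.1 t) : ℝ) : ℂ) *
        cis (lam * γ.phase (p, t))‖ ≤ C * (lam⁻¹) ^ N := by
  obtain ⟨v, hv, hspeed⟩ := γ.exists_le_speed
  -- On `Z p` the phase derivative is at least `v * (1 / 2) * (1 / 2)`: speed, Jacobian factor and
  -- tangential component.
  obtain ⟨ρ, hρ, hρ1⟩ := exists_contDiff_inv (c := v / 4) (by positivity)
  have hΦ := γ.contDiff_phase
  refine exists_norm_integral_cis_le_inv_pow (T := γ.period) (K := paramBox η)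
    (b := fun x : (ℝ × ℝ) × ℝ => A x.2 * χ (γ.norComp x.1.1 x.2))
    (R := fun x => ρ (sndDeriv γ.phase x)) (Φ := γ.phase)
    (Z := fun p => {t | 1 / 2 ≤ |γ.tanComp p.1 t|}) γ.period_pos.le (isCompact_paramBox η)
    (fun p _ => isClosed_le continuous_const
      (contDiff_prod_left γ.contDiff_tanComp p).continuous.abs)
    (hρ.comp hΦ.sndDeriv) hΦ (fun p t => by rw [sndDeriv_periodic hΦ γ.phase_periodic])
    γ.phase_periodic (fun p hp t ht => ?_) N
    ((hA.comp contDiff_snd).mul (hχ.comp γ.contDiff_norComp))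
    (fun p t => by simp only [hAT t, norComp_periodic]) (fun p _ t ht => ?_)
  · refine hρ1 _ ?_
    rw [(hasDerivAt_sndDeriv hΦ p t).unique (γ.hasDerivAt_phase p t), abs_mul, abs_mul,
      abs_of_pos (γ.speed_pos t)]
    have h1 := half_le_one_add_mul_curv hη hp t
    rw [abs_of_pos (by linarith)]
    have h2 : 1 / 2 ≤ |γ.tanComp p.1 t| := ht
    calc v / 4 = v * (1 / 2) * (1 / 2) := by ring
      _ ≤ _ := by
        have := hspeed t
        have h3 := γ.speed_pos t
        gcongr
  · have h1 : |γ.tanComp p.1 t| < 1 / 2 := not_le.1 ht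
    have h2 := γ.tanComp_sq_add_norComp_sq p.1 t
    rw [← sq_abs, ← sq_abs (γ.norComp p.1 t)] at h2
    -- `|tanComp| < 1 / 2` forces `|norComp| > √3 / 2 > 3 / 4`, where `χ` vanishes.
    have h3 : 3 / 4 ≤ |γ.norComp p.1 t| := by
      by_contra! h
      nlinarith [abs_nonneg (γ.tanComp p.1 t), abs_nonneg (γ.norComp p.1 t)]
    simp [hχ0 _ h3]

end SmoothClosedCurve

/-! ### Decay of the Fourier transform of the thickened curve. -/

section Swap

variable {V : ℝ → ℂ} {b : ℝ → ℝ} {Φ : ℝ → ℝ → ℝ} {T : ℝ}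

lemma integral_mul_integral_cis_swap (hV : IntervalIntegrable V volume (-1) 1)
    (hb : Continuous b) (hΦ : Continuous fun x : ℝ × ℝ => Φ x.1 x.2) :
    ∫ t in (0 : ℝ)..T, (b t : ℂ) * ∫ s in (-1 : ℝ)..1, V s * cis (Φ s t) =
      ∫ s in (-1 : ℝ)..1, V s * ∫ t in (0 : ℝ)..T, (b t : ℂ) * cis (Φ s t) := by
  have hbi : IntegrableOn (fun t => (b t : ℂ)) (uIoc 0 T) :=
    ((Complex.continuous_ofReal.comp hb).intervalIntegrable 0 T).def'
  have hint : IntegrableOn (Function.uncurry fun t s => (b t : ℂ) * V s * cis (Φ s t))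
      (uIoc 0 T ×ˢ uIoc (-1) 1) := by
    rw [IntegrableOn, Measure.volume_eq_prod, ← Measure.prod_restrict]
    refine (hbi.mul_prod hV.def').mul_bdd (c := 1)
      (g := fun z : ℝ × ℝ => cis (Φ z.2 z.1)) ?_ (Eventually.of_forall fun z => by simp)
    exact (continuous_cis.comp (hΦ.comp continuous_swap)).aestronglyMeasurable
  have h := intervalIntegral_intervalIntegral_swap hint
  simp_rw [← intervalIntegral.integral_const_mul]
  calc _ = ∫ t in (0 : ℝ)..T, ∫ s in (-1 : ℝ)..1, (b t : ℂ) * V s * cis (Φ s t) := by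
        simp_rw [mul_assoc]
    _ = _ := h
    _ = _ := by
        congr 1; ext s; congr 1; ext t; ring

lemma norm_integral_mul_integral_cis_le (hV : IntervalIntegrable V volume (-1) 1)
    (hb : Continuous b) (hΦ : Continuous fun x : ℝ × ℝ => Φ x.1 x.2) {D : ℝ}
    (hD : ∀ s ∈ Icc (-1 : ℝ) 1, ‖∫ t in (0 : ℝ)..T, (b t : ℂ) * cis (Φ s t)‖ ≤ D) :
    ‖∫ t in (0 : ℝ)..T, (b t : ℂ) * ∫ s in (-1 : ℝ)..1, V s * cis (Φ s t)‖ ≤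
      (∫ s in (-1 : ℝ)..1, ‖V s‖) * D := by
  rw [integral_mul_integral_cis_swap hV hb hΦ, ← intervalIntegral.integral_mul_const]
  refine intervalIntegral.norm_integral_le_of_norm_le (by norm_num)
    (Eventually.of_forall fun s hs => ?_) (hV.norm.mul_const D)
  rw [norm_mul]
  gcongr
  exact hD s (Ioc_subset_Icc_self hs)

end Swap

namespace SmoothClosedCurve

variable {γ : SmoothClosedCurve} {κ : ℝ}

lemma phase_add (τ η t : ℝ) : γ.phase ((τ, η), t) = γ.phase ((τ, 0), t) + η * γ.norComp τ t := by
  simp only [phase, norComp]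
  ring

/-- The Fourier transform of `A dσ ⊗ θ_ε`, in polar coordinates of the dual variable. -/
def curveFourier (γ : SmoothClosedCurve) (A θ : ℝ → ℝ) (ε τ lam : ℝ) : ℂ :=
  ∫ t in (0 : ℝ)..γ.period, (A t : ℂ) * ∫ s in (-1 : ℝ)..1,
    (θ s : ℂ) * cis (lam * γ.phase ((τ, ε * s), t))

lemma continuous_phase_uncurry (lam ε τ : ℝ) :
    Continuous fun x : ℝ × ℝ => lam * γ.phase ((τ, ε * x.1), x.2) :=
  continuous_const.mul (γ.contDiff_phase.continuous.comp (by fun_prop))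

lemma mem_paramBox {η ε τ s : ℝ} (hτ : τ ∈ Icc (-Real.pi) Real.pi) (hε : 0 ≤ ε) (hεη : ε ≤ η)
    (hs : s ∈ Icc (-1 : ℝ) 1) : (τ, ε * s) ∈ paramBox η := by
  refine ⟨hτ, abs_le.1 ?_⟩
  change |ε * s| ≤ η
  rw [abs_mul, abs_of_nonneg hε]
  calc ε * |s| ≤ ε * 1 := by gcongr; exact abs_le.2 hs
    _ ≤ η := by linarith

/-- The phase is affine in the offset with slope `norComp`, so the integral over `s` is a Fourier
transform of `θ` at `ε * lam * norComp`. Replacing it by `exists_fourier` and exchanging integrals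
leaves, for each `s ∈ [-1, 1]`, a stationary integral at offset `ε * s`, to be averaged against a
finite measure. -/
lemma exists_norm_curveFourier_near_le (hκ : 2 < κ) (hflat : γ.HasFlatPointsOfOrder κ)
    {A φ : ℝ → ℝ} (hA : ContDiff ℝ ∞ A) (hφ : ContDiff ℝ ∞ φ) (hφ0 : ∀ x, |x| ≤ 1 / 2 → φ x = 0)
    {q : ℕ} {θ : ℝ → ℝ} (hq : 1 ≤ q) (hθ : IsWeight q θ)
    {η : ℝ} (hη : ∀ t, η * |γ.curv t| ≤ 1 / 2) :
    ∃ C, 0 ≤ C ∧ ∀ τ ∈ Icc (-Real.pi) Real.pi, ∀ ε, 0 < ε → ε ≤ η → ∀ lam : ℝ, 0 < lam →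
      ‖∫ t in (0 : ℝ)..γ.period, ((A t * φ (γ.norComp τ t) : ℝ) : ℂ) * ∫ s in (-1 : ℝ)..1,
        (θ s : ℂ) * cis (lam * γ.phase ((τ, ε * s), t))‖ ≤
        C * (((ε * lam) ^ (q + 1))⁻¹ * lam ^ (-κ⁻¹)) := by
  obtain ⟨c, V, hc, hV, hfour⟩ := hθ.exists_fourier hq
  obtain ⟨ρ, hρ, hρ1⟩ := exists_contDiff_inv (c := 1 / 2) (by norm_num)
  -- The factor `norComp ^ (-(q + 1))` is absorbed in the cutoff; it is harmless because `φ`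
  -- vanishes for `|x| ≤ 1 / 2`.
  set ψ : ℝ → ℝ := fun x => φ x * ρ x ^ (q + 1) with hψdef
  have hψ : ContDiff ℝ ∞ ψ := hφ.mul (hρ.pow _)
  have hψ0 : ∀ x, |x| ≤ 1 / 2 → ψ x = 0 := fun x hx => by simp [hψdef, hφ0 x hx]
  obtain ⟨C, hC, hbound⟩ := exists_norm_integral_near_le hκ hflat hA hψ hψ0 hη γ.period_pos.le
  refine ⟨((∑ s ∈ c.support, ‖c s‖) + ∫ s in (-1 : ℝ)..1, ‖V s‖) * C, ?_, ?_⟩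
  · have : 0 ≤ ∫ s in (-1 : ℝ)..1, ‖V s‖ :=
      intervalIntegral.integral_nonneg (by norm_num) fun s _ => norm_nonneg _
    have := Finset.sum_nonneg fun s (_ : s ∈ c.support) => norm_nonneg (c s)
    positivity
  intro τ hτ ε hε hεη lam hlam
  set P : ℝ → ℝ → ℝ := fun s t => lam * γ.phase ((τ, ε * s), t) with hP
  set b : ℝ → ℝ := fun t => A t * ψ (γ.norComp τ t) with hb
  have hnc : Continuous (γ.norComp τ) :=
    (contDiff_prod_left γ.contDiff_norComp (τ, 0)).continuous
  have hbc : Continuous b := hA.continuous.mul (hψ.continuous.comp hnc)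
  have hPc : Continuous fun x : ℝ × ℝ => P x.1 x.2 := continuous_phase_uncurry lam ε τ
  have hPs : ∀ s, Continuous (P s) := fun s =>
    hPc.comp (Continuous.prodMk continuous_const continuous_id)
  have hPt : ∀ t, Continuous fun s => P s t := fun t =>
    hPc.comp (Continuous.prodMk continuous_id continuous_const)
  have hPadd : ∀ s t, P s t = P 0 t + (ε * lam * γ.norComp τ t) * s := fun s t => by
    simp only [hP]
    rw [phase_add, phase_add τ (ε * 0)]
    ring
  have hpoint : ∀ t, ((A t * φ (γ.norComp τ t) : ℝ) : ℂ) *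
      ∫ s in (-1 : ℝ)..1, (θ s : ℂ) * cis (P s t) =
      (((ε * lam) ^ (q + 1) : ℝ) : ℂ)⁻¹ * ((∑ s ∈ c.support, c s * ((b t : ℂ) * cis (P s t))) +
        (b t : ℂ) * ∫ s in (-1 : ℝ)..1, V s * cis (P s t)) := fun t => by
    by_cases hw : |γ.norComp τ t| ≤ 1 / 2
    · simp [hφ0 _ hw, hb, hψ0 _ hw]
    have hinv := hρ1 _ (not_le.1 hw).le
    set w := γ.norComp τ t
    have hw0 : w ≠ 0 := by
      intro h
      rw [h, mul_zero] at hinv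
      exact zero_ne_one hinv
    set y := ε * lam * w with hy
    have hy0 : y ≠ 0 := by positivity
    have hsplit : ∀ W : ℝ → ℂ, ∫ s in (-1 : ℝ)..1, W s * cis (P s t) =
        cis (P 0 t) * ∫ s in (-1 : ℝ)..1, W s * cis (y * s) := fun W => by
      rw [← intervalIntegral.integral_const_mul]
      congr 1
      ext s
      rw [hPadd s t, cis_add]
      ring
    have hsum : ∑ s ∈ c.support, c s * ((b t : ℂ) * cis (P s t)) =
        (b t : ℂ) * cis (P 0 t) * c.sum fun s z => z * cis (y * s) := by
      rw [Finsupp.sum, Finset.mul_sum]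
      refine Finset.sum_congr rfl fun s _ => ?_
      rw [hPadd s t, cis_add]
      ring
    rw [hsplit, hsplit V, hsum, hfour y hy0]
    have hρw : ((ρ w : ℝ) : ℂ) * (w : ℂ) = 1 := by exact_mod_cast hinv
    have hyinv : ((y : ℂ) ^ (q + 1))⁻¹ =
        (((ε * lam) ^ (q + 1) : ℝ) : ℂ)⁻¹ * (ρ w : ℂ) ^ (q + 1) := by
      rw [eq_inv_of_mul_eq_one_left hρw, hy]
      push_cast
      rw [mul_pow, mul_inv, inv_pow]
    rw [hyinv]
    simp only [hb, hψdef]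
    push_cast
    ring
  have hIbound : ∀ s ∈ Icc (-1 : ℝ) 1,
      ‖∫ t in (0 : ℝ)..γ.period, (b t : ℂ) * cis (P s t)‖ ≤ C * lam ^ (-κ⁻¹) := fun s hs =>
    hbound (τ, ε * s) (mem_paramBox hτ hε.le hεη hs) lam hlam
  have hi1 : ∀ s, IntervalIntegrable (fun t => (b t : ℂ) * cis (P s t)) volume 0 γ.period :=
    fun s => ((Complex.continuous_ofReal.comp hbc).mul
      (continuous_cis.comp (hPs s))).intervalIntegrable _ _
  have hcont : Continuous fun t => ∫ s in (-1 : ℝ)..1, V s * cis (P s t) := by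
    refine intervalIntegral.continuous_of_dominated_interval (bound := fun s => ‖V s‖)
      (fun t => hV.def'.aestronglyMeasurable.mul
        (continuous_cis.comp (hPt t)).aestronglyMeasurable)
      (fun t => Eventually.of_forall fun s _ => by simp) hV.norm
      (Eventually.of_forall fun s _ => continuous_const.mul (continuous_cis.comp (hPs s)))
  have hi2 : IntervalIntegrable (fun t => (b t : ℂ) * ∫ s in (-1 : ℝ)..1, V s * cis (P s t))
      volume 0 γ.period :=
    ((Complex.continuous_ofReal.comp hbc).mul hcont).intervalIntegrable _ _
  have hisum : IntervalIntegrable (fun t => ∑ s ∈ c.support, c s * ((b t : ℂ) * cis (P s t)))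
      volume 0 γ.period := by
    refine Continuous.intervalIntegrable ?_ _ _
    exact continuous_finsetSum _ fun s _ => continuous_const.mul
      ((Complex.continuous_ofReal.comp hbc).mul (continuous_cis.comp (hPs s)))
  change ‖∫ t in (0 : ℝ)..γ.period, ((A t * φ (γ.norComp τ t) : ℝ) : ℂ) *
    ∫ s in (-1 : ℝ)..1, (θ s : ℂ) * cis (P s t)‖ ≤ _
  simp_rw [hpoint]
  rw [intervalIntegral.integral_const_mul, intervalIntegral.integral_add hisum hi2,
    intervalIntegral.integral_finsetSum fun s _ => (hi1 s).const_mul _, norm_mul, norm_inv,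
    Complex.norm_real, Real.norm_eq_abs, abs_of_pos (by positivity)]
  simp_rw [intervalIntegral.integral_const_mul]
  have h1 : ‖∑ s ∈ c.support, c s * ∫ t in (0 : ℝ)..γ.period, (b t : ℂ) * cis (P s t)‖ ≤
      (∑ s ∈ c.support, ‖c s‖) * (C * lam ^ (-κ⁻¹)) := by
    rw [Finset.sum_mul]
    refine norm_sum_le_of_le _ fun s hs => ?_
    rw [norm_mul]
    gcongr
    exact hIbound s (hc s hs)
  have h2 := norm_integral_mul_integral_cis_le hV hbc hPc hIbound
  calc _ ≤ ((ε * lam) ^ (q + 1))⁻¹ * ((∑ s ∈ c.support, ‖c s‖) * (C * lam ^ (-κ⁻¹)) +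
        (∫ s in (-1 : ℝ)..1, ‖V s‖) * (C * lam ^ (-κ⁻¹))) := by
        gcongr
        exact (norm_add_le _ _).trans (add_le_add h1 h2)
    _ = _ := by ring

theorem exists_norm_curveFourier_le (hκ : 2 < κ) (hflat : γ.HasFlatPointsOfOrder κ)
    {A : ℝ → ℝ} (hA : ContDiff ℝ ∞ A) (hAT : Function.Periodic A γ.period)
    {q : ℕ} {θ : ℝ → ℝ} (hq : 1 ≤ q) (hθ : IsWeight q θ)
    {η : ℝ} (hη : ∀ t, η * |γ.curv t| ≤ 1 / 2) :
    ∃ C, 0 ≤ C ∧ ∀ τ ∈ Icc (-Real.pi) Real.pi, ∀ ε, 0 < ε → ε ≤ η → ∀ lam : ℝ, 1 ≤ lam →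
      ‖γ.curveFourier A θ ε τ lam‖ ≤ C * (((ε * lam) ^ (q + 1))⁻¹ * lam ^ (-κ⁻¹)) := by
  obtain ⟨φ, hφ, hφ0, hφ1⟩ := exists_cutoff
  obtain ⟨C₁, hC₁, hnear⟩ := exists_norm_curveFourier_near_le hκ hflat hA hφ hφ0 hq hθ hη
  -- The order `q + 2` suffices: `q + 1` powers of `lam⁻¹` are compared with `(ε * lam) ^ (-(q +
  -- 1))` through `ε ≤ η`, and the last is below `lam ^ (-1/κ)`.
  obtain ⟨C₂, hC₂, hfar⟩ := exists_norm_integral_far_le (χ := fun x => 1 - φ x) hA hAT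
    (contDiff_const.sub hφ) (fun x hx => by simp [hφ1 x hx]) hη (q + 2)
  have hθc : Continuous fun s => (θ s : ℂ) := Complex.continuous_ofReal.comp (hθ.continuous hq)
  have hθi : IntervalIntegrable (fun s => (θ s : ℂ)) volume (-1) 1 := hθc.intervalIntegrable _ _
  set Θ := ∫ s in (-1 : ℝ)..1, ‖(θ s : ℂ)‖ with hΘ
  have hΘ0 : 0 ≤ Θ := intervalIntegral.integral_nonneg (by norm_num) fun s _ => norm_nonneg _
  refine ⟨C₁ + Θ * C₂ * |η| ^ (q + 1), by positivity, fun τ hτ ε hε hεη lam hlam => ?_⟩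
  have hlam0 : 0 < lam := by linarith
  have hnc : Continuous (γ.norComp τ) :=
    (contDiff_prod_left γ.contDiff_norComp (τ, 0)).continuous
  have hPc : Continuous fun x : ℝ × ℝ => lam * γ.phase ((τ, ε * x.1), x.2) :=
    continuous_phase_uncurry lam ε τ
  set F : ℝ → ℂ := fun t => ∫ s in (-1 : ℝ)..1,
    (θ s : ℂ) * cis (lam * γ.phase ((τ, ε * s), t)) with hF
  have hFc : Continuous F := by
    refine intervalIntegral.continuous_parametric_intervalIntegral_of_continuous' ?_ _ _
    exact (hθc.comp continuous_snd).mul (continuous_cis.comp (hPc.comp continuous_swap))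
  have hb1 : Continuous fun t => A t * φ (γ.norComp τ t) :=
    hA.continuous.mul (hφ.continuous.comp hnc)
  have hb2 : Continuous fun t => A t * (1 - φ (γ.norComp τ t)) :=
    hA.continuous.mul (continuous_const.sub (hφ.continuous.comp hnc))
  have hsplit : γ.curveFourier A θ ε τ lam =
      (∫ t in (0 : ℝ)..γ.period, ((A t * φ (γ.norComp τ t) : ℝ) : ℂ) * F t) +
        ∫ t in (0 : ℝ)..γ.period, ((A t * (1 - φ (γ.norComp τ t)) : ℝ) : ℂ) * F t := by
    have hi : ∀ {b : ℝ → ℝ}, Continuous b →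
        IntervalIntegrable (fun t => (b t : ℂ) * F t) volume 0 γ.period := fun hb =>
      ((Complex.continuous_ofReal.comp hb).mul hFc).intervalIntegrable _ _
    rw [← intervalIntegral.integral_add (hi hb1) (hi hb2)]
    refine intervalIntegral.integral_congr fun t _ => ?_
    simp only [hF]
    push_cast
    ring
  have h1 := hnear τ hτ ε hε hεη lam hlam0
  have h2 := norm_integral_mul_integral_cis_le (T := γ.period) hθi hb2 hPc fun s hs =>
    hfar (τ, ε * s) (mem_paramBox hτ hε.le hεη hs) lam hlam0
  have h3 : (lam⁻¹) ^ (q + 2) ≤ |η| ^ (q + 1) * (((ε * lam) ^ (q + 1))⁻¹ * lam ^ (-κ⁻¹)) := by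
    have e1 : lam⁻¹ ≤ lam ^ (-κ⁻¹) := by
      rw [← Real.rpow_neg_one]
      refine Real.rpow_le_rpow_of_exponent_le hlam ?_
      have : κ⁻¹ ≤ 1 := inv_le_one_of_one_le₀ (by linarith)
      linarith
    have e2 : (lam⁻¹) ^ (q + 1) ≤ |η| ^ (q + 1) * ((ε * lam) ^ (q + 1))⁻¹ := by
      have e3 : ε ^ (q + 1) ≤ |η| ^ (q + 1) := by
        gcongr
        exact hεη.trans (le_abs_self η)
      calc (lam⁻¹) ^ (q + 1) = ε ^ (q + 1) * ((ε * lam) ^ (q + 1))⁻¹ := by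
            rw [mul_pow, inv_pow]; field_simp
        _ ≤ _ := by gcongr
    calc (lam⁻¹) ^ (q + 2) = (lam⁻¹) ^ (q + 1) * lam⁻¹ := pow_succ _ _
      _ ≤ |η| ^ (q + 1) * ((ε * lam) ^ (q + 1))⁻¹ * lam ^ (-κ⁻¹) := by gcongr
      _ = _ := by ring
  rw [hsplit]
  refine (norm_add_le _ _).trans ?_
  calc _ ≤ C₁ * (((ε * lam) ^ (q + 1))⁻¹ * lam ^ (-κ⁻¹)) + Θ * (C₂ * (lam⁻¹) ^ (q + 2)) :=
        add_le_add h1 h2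
    _ ≤ C₁ * (((ε * lam) ^ (q + 1))⁻¹ * lam ^ (-κ⁻¹)) +
        Θ * (C₂ * (|η| ^ (q + 1) * (((ε * lam) ^ (q + 1))⁻¹ * lam ^ (-κ⁻¹)))) := by gcongr
    _ = _ := by ring

end SmoothClosedCurve

/-! ### The tubular neighbourhood. -/

namespace SmoothClosedCurve

variable (γ : SmoothClosedCurve)

lemma exists_add_zsmul_of_param_eq {s t : ℝ} (h : γ.param s = γ.param t) :
    ∃ m : ℤ, s = t + m • γ.period := by
  obtain ⟨a, ha, -⟩ := existsUnique_add_zsmul_mem_Ico γ.period_pos s 0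
  obtain ⟨b, hb, -⟩ := existsUnique_add_zsmul_mem_Ico γ.period_pos t 0
  rw [zero_add] at ha hb
  have e := γ.simple ha hb (by rw [γ.periodic.zsmul a s, γ.periodic.zsmul b t, h])
  refine ⟨b - a, ?_⟩
  rw [sub_smul]
  linarith

lemma param_eq_of_abs_lt {s t : ℝ} (h : γ.param s = γ.param t) (hst : |s - t| < γ.period) :
    s = t := by
  obtain ⟨m, hm⟩ := γ.exists_add_zsmul_of_param_eq h
  have hp := γ.period_pos
  rw [hm, add_sub_cancel_left, zsmul_eq_mul, abs_mul, abs_of_pos hp] at hst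
  have h1 : |(m : ℝ)| < 1 := by
    by_contra! hcon
    nlinarith
  have h2 : m = 0 := by
    have : |m| < 1 := by exact_mod_cast h1
    exact Int.abs_lt_one_iff.1 this
  rw [hm, h2, zero_smul, add_zero]

lemma exists_norm_deriv_deriv_le : ∃ M > 0, ∀ t, ‖deriv (deriv γ.param) t‖ ≤ M := by
  have hc : IsCompact (range (deriv (deriv γ.param))) := γ.deriv_deriv_periodic.compact_of_continuous
    γ.period_pos.ne' γ.contDiff_deriv_deriv.continuous
  obtain ⟨M, hM⟩ := hc.isBounded.exists_norm_le
  refine ⟨|M| + 1, by positivity, fun t => (hM _ (mem_range_self t)).trans ?_⟩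
  linarith [le_abs_self M]

lemma exists_abs_curv_le : ∃ K, 0 ≤ K ∧ ∀ t, |γ.curv t| ≤ K := by
  have hc : IsCompact (range γ.curv) := γ.curv_periodic.compact_of_continuous
    γ.period_pos.ne' γ.contDiff_curv.continuous
  obtain ⟨M, hM⟩ := hc.isBounded.exists_norm_le
  exact ⟨|M|, abs_nonneg M, fun t => (hM _ (mem_range_self t)).trans (le_abs_self M)⟩

lemma norm_param_sub_sub_le {M : ℝ} (hM : ∀ t, ‖deriv (deriv γ.param) t‖ ≤ M) (s t : ℝ) :
    ‖γ.param s - γ.param t - (s - t) • deriv γ.param t‖ ≤ M * |s - t| ^ 2 := by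
  have hM0 : 0 ≤ M := (norm_nonneg _).trans (hM 0)
  have h1 : ∀ y, ‖deriv γ.param y - deriv γ.param t‖ ≤ M * |y - t| := fun y =>
    convex_univ.norm_image_sub_le_of_norm_hasDerivWithin_le
      (fun z _ => (γ.hasDerivAt_deriv z).hasDerivWithinAt) (fun z _ => hM z)
      (mem_univ t) (mem_univ y)
  have h2 := (convex_uIcc t s).norm_image_sub_le_of_norm_hasDerivWithin_le
    (f := fun y => γ.param y - y • deriv γ.param t) (C := M * |s - t|)
    (fun y _ => ((γ.hasDerivAt_param y).sub
      ((hasDerivAt_id y).smul_const (deriv γ.param t))).hasDerivWithinAt)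
    (fun y hy => by
      rw [one_smul]
      refine (h1 y).trans ?_
      gcongr ?_ * ?_
      exact abs_sub_left_of_mem_uIcc hy) left_mem_uIcc right_mem_uIcc
  rw [Real.norm_eq_abs, mul_assoc, ← sq] at h2
  refine le_trans (le_of_eq ?_) h2
  congr 1
  rw [sub_smul]
  abel

/-- The normal component of a chord is bounded by the square of its length. -/
theorem exists_abs_inner_normal_le : ∃ C > 0, ∀ s t,
    |inner ℝ (γ.normal t) (γ.param s - γ.param t)| ≤ C * ‖γ.param s - γ.param t‖ ^ 2 := by
  obtain ⟨M, hM0, hM⟩ := γ.exists_norm_deriv_deriv_le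
  obtain ⟨v, hv, hspeed⟩ := γ.exists_le_speed
  have hp := γ.period_pos
  -- For `|s - t| ≤ r` the Taylor remainder `M |s - t| ^ 2` is at most half of `v |s - t|`, so chord
  -- and parameter distance are comparable.
  set r := v / (2 * M) with hr
  have hr0 : 0 < r := by positivity
  -- Pairs at parameter distance between `r` and half a period: on this compact set injectivity
  -- bounds the chord below.
  set Kc : Set (ℝ × ℝ) := (Icc 0 γ.period ×ˢ Icc (-(2 * γ.period)) (2 * γ.period)) ∩
    {x | r ≤ |x.2 - x.1| ∧ |x.2 - x.1| ≤ γ.period / 2} with hKc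
  have hcont : Continuous fun x : ℝ × ℝ => ‖γ.param x.2 - γ.param x.1‖ := by
    have := γ.smooth.continuous
    fun_prop
  have hcomp : IsCompact Kc := by
    have hc : Continuous fun x : ℝ × ℝ => |x.2 - x.1| := by fun_prop
    exact (isCompact_Icc.prod isCompact_Icc).inter_right
      ((isClosed_le continuous_const hc).inter (isClosed_le hc continuous_const))
  obtain ⟨m, hm, hmle⟩ : ∃ m > 0, ∀ x ∈ Kc, m ≤ ‖γ.param x.2 - γ.param x.1‖ := by
    rcases Kc.eq_empty_or_nonempty with h | h
    · exact ⟨1, one_pos, fun x hx => by rw [h] at hx; exact hx.elim⟩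
    · obtain ⟨x, hx, hmin⟩ := hcomp.exists_isMinOn h hcont.continuousOn
      refine ⟨_, norm_pos_iff.2 fun h0 => ?_, fun y hy => hmin hy⟩
      have := γ.param_eq_of_abs_lt (sub_eq_zero.1 h0) (by linarith [hx.2.2])
      have h1 := hx.2.1
      rw [this, sub_self, abs_zero] at h1
      linarith
  have hnear : ∀ s t, |s - t| ≤ r → |inner ℝ (γ.normal t) (γ.param s - γ.param t)| ≤
      4 * M / v ^ 2 * ‖γ.param s - γ.param t‖ ^ 2 := fun s t hst => by
    have h1 := γ.norm_param_sub_sub_le hM s t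
    have h2 : |inner ℝ (γ.normal t) (γ.param s - γ.param t)| ≤ M * |s - t| ^ 2 := by
      have e : inner ℝ (γ.normal t) (γ.param s - γ.param t) =
          inner ℝ (γ.normal t) (γ.param s - γ.param t - (s - t) • deriv γ.param t) := by
        rw [inner_sub_right _ _ ((s - t) • _), inner_smul_right, inner_normal_deriv, mul_zero,
          sub_zero]
      rw [e]
      refine (abs_real_inner_le_norm _ _).trans ?_
      rwa [norm_normal, one_mul]
    have h3 : v / 2 * |s - t| ≤ ‖γ.param s - γ.param t‖ := by
      have h4 : ‖(s - t) • deriv γ.param t‖ ≤ ‖γ.param s - γ.param t‖ +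
          ‖γ.param s - γ.param t - (s - t) • deriv γ.param t‖ := by
        simpa using norm_sub_le (γ.param s - γ.param t)
          (γ.param s - γ.param t - (s - t) • deriv γ.param t)
      rw [norm_smul, Real.norm_eq_abs] at h4
      have h5 : |s - t| * v ≤ |s - t| * ‖deriv γ.param t‖ := by
        gcongr
        exact hspeed t
      have h6 : M * |s - t| ^ 2 ≤ v / 2 * |s - t| := by
        rw [sq, ← mul_assoc]
        gcongr
        calc M * |s - t| ≤ M * r := by gcongr
          _ = v / 2 := by rw [hr]; field_simp
      linarith
    calc _ ≤ M * |s - t| ^ 2 := h2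
      _ = 4 * M / v ^ 2 * (v / 2 * |s - t|) ^ 2 := by field_simp; ring
      _ ≤ _ := by gcongr
  have hmid : ∀ s t, t ∈ Icc 0 γ.period → |s - t| ≤ γ.period / 2 →
      |inner ℝ (γ.normal t) (γ.param s - γ.param t)| ≤
        (4 * M / v ^ 2 + 1 / m) * ‖γ.param s - γ.param t‖ ^ 2 := fun s t ht hst => by
    rcases le_total |s - t| r with h | h
    · refine (hnear s t h).trans ?_
      gcongr
      linarith [show 0 < 1 / m by positivity]
    · have hs := abs_le.1 hst
      have h1 := hmle (t, s) ⟨⟨ht, by constructor <;> linarith [ht.1, ht.2]⟩, h, hst⟩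
      simp only at h1
      calc _ ≤ ‖γ.param s - γ.param t‖ := by
            refine (abs_real_inner_le_norm _ _).trans ?_
            rw [norm_normal, one_mul]
        _ ≤ 1 / m * ‖γ.param s - γ.param t‖ ^ 2 := by
            rw [one_div, inv_mul_eq_div, le_div_iff₀ hm, sq]
            gcongr
        _ ≤ _ := by
            gcongr
            linarith [show 0 < 4 * M / v ^ 2 by positivity]
  refine ⟨4 * M / v ^ 2 + 1 / m, by positivity, fun s t => ?_⟩
  -- Shift `t` into one period and `s` to within half a period of it.
  obtain ⟨a, ha, -⟩ := existsUnique_add_zsmul_mem_Ico hp t 0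
  set t' := t + a • γ.period with ht'
  obtain ⟨b, hb, -⟩ := existsUnique_add_zsmul_mem_Ico hp s (t' - γ.period / 2)
  have h := hmid (s + b • γ.period) t' ⟨ha.1, by linarith [ha.2]⟩ (by
    rw [abs_le]
    constructor <;> linarith [hb.1, hb.2])
  rwa [ht', γ.normal_periodic.zsmul a t, γ.periodic.zsmul a t, γ.periodic.zsmul b s] at h

/-- The reach bound: tubes of width at most `ε₀` are embedded. -/
structure IsReach (ε₀ : ℝ) : Prop where
  pos : 0 < ε₀
  curv_le : ∀ t, ε₀ * |γ.curv t| ≤ 1 / 2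
  inner_le : ∀ s t, 4 * ε₀ * |inner ℝ (γ.normal t) (γ.param s - γ.param t)| ≤
    ‖γ.param s - γ.param t‖ ^ 2

lemma exists_isReach : ∃ ε₀, γ.IsReach ε₀ := by
  obtain ⟨C, hC, h⟩ := γ.exists_abs_inner_normal_le
  obtain ⟨K, hK, hcurv⟩ := γ.exists_abs_curv_le
  have hpos : 0 < min (1 / (4 * C)) (1 / (2 * (K + 1))) := by positivity
  refine ⟨min (1 / (4 * C)) (1 / (2 * (K + 1))), hpos, fun t => ?_, fun s t => ?_⟩
  · calc _ ≤ 1 / (2 * (K + 1)) * (K + 1) := by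
          gcongr
          · exact min_le_right _ _
          · linarith [hcurv t]
      _ = 1 / 2 := by field_simp
  · calc _ ≤ 4 * (1 / (4 * C)) * (C * ‖γ.param s - γ.param t‖ ^ 2) := by
          gcongr
          · exact min_le_left _ _
          · exact h s t
      _ = _ := by field_simp

variable {γ} {ε₀ : ℝ}

lemma isCompact_carrier : IsCompact γ.carrier :=
  γ.periodic.compact_of_continuous γ.period_pos.ne' γ.smooth.continuous

lemma dist_levelCurve_self {η t : ℝ} : dist (γ.levelCurve η t) (γ.param t) = |η| := by
  rw [dist_eq_norm, levelCurve, add_sub_cancel_left, norm_smul, norm_normal, mul_one,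
    Real.norm_eq_abs]

/-- At a nearest point the derivative of the squared distance vanishes, so `x - γ(t)` is normal to
the curve. -/
lemma exists_levelCurve_eq (x : Plane) :
    ∃ t ∈ Ico 0 γ.period, ∃ η, |η| = Metric.infDist x γ.carrier ∧ x = γ.levelCurve η t := by
  obtain ⟨_, ⟨s, rfl⟩, hs⟩ := γ.isCompact_carrier.exists_infDist_eq_dist (range_nonempty _) x
  obtain ⟨a, ha, -⟩ := existsUnique_add_zsmul_mem_Ico γ.period_pos s 0
  rw [zero_add] at ha
  set t := s + a • γ.period with ht
  have hts : γ.param t = γ.param s := γ.periodic.zsmul a s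
  rw [← hts] at hs
  have hmin : IsLocalMin (fun y => ‖x - γ.param y‖ ^ 2) t := by
    refine Eventually.of_forall fun y => ?_
    simp only
    rw [← dist_eq_norm, ← dist_eq_norm, ← hs]
    have := Metric.infDist_le_dist_of_mem (x := x) (mem_range_self (f := γ.param) y)
    have h0 := Metric.infDist_nonneg (x := x) (s := γ.carrier)
    exact pow_le_pow_left₀ h0 this 2
  have hder : HasDerivAt (fun y => ‖x - γ.param y‖ ^ 2)
      (2 * inner ℝ (x - γ.param t) (-deriv γ.param t)) t :=
    ((γ.hasDerivAt_param t).const_sub x).norm_sq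
  have h0 := hmin.hasDerivAt_eq_zero hder
  rw [inner_neg_right, plane_inner, deriv_zero, deriv_one] at h0
  have hv := (γ.speed_pos t).ne'
  have h1 : (x - γ.param t) 0 * γ.tx t + (x - γ.param t) 1 * γ.ty t = 0 := by
    refine mul_left_cancel₀ hv ?_
    rw [mul_zero]
    linarith
  have h2 := γ.tx_sq_add_ty_sq t
  have hx : x = γ.levelCurve (inner ℝ (γ.normal t) (x - γ.param t)) t := by
    rw [levelCurve, ← sub_eq_iff_eq_add']
    refine plane_ext ?_ ?_
    · rw [PiLp.smul_apply, plane_inner, normal_zero, normal_one, smul_eq_mul]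
      linear_combination γ.tx t * h1 - (x - γ.param t) 0 * h2
    · rw [PiLp.smul_apply, plane_inner, normal_zero, normal_one, smul_eq_mul]
      linear_combination γ.ty t * h1 - (x - γ.param t) 1 * h2
  refine ⟨t, ha, _, ?_, hx⟩
  rw [hs]
  conv_rhs => rw [hx]
  rw [dist_levelCurve_self]

namespace IsReach

lemma one_add_pos (hr : γ.IsReach ε₀) {η : ℝ} (hη : |η| ≤ ε₀) (t : ℝ) :
    1 / 2 ≤ 1 + η * γ.curv t := by
  have h1 : |η * γ.curv t| ≤ 1 / 2 := by
    rw [abs_mul]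
    exact (mul_le_mul_of_nonneg_right hη (abs_nonneg _)).trans (hr.curv_le t)
  linarith [(abs_le.1 h1).1]

/-- Expanding the square gives `η ^ 2 - 2 η ⟨n, c⟩ + ‖c‖ ^ 2` for the chord `c`, and `inner_le`
bounds the cross term by half of `‖c‖ ^ 2`. Everything about nearest points follows from this. -/
lemma sq_add_le_dist_sq (hr : γ.IsReach ε₀) {η : ℝ} (hη : |η| ≤ ε₀) (s t : ℝ) :
    η ^ 2 + ‖γ.param s - γ.param t‖ ^ 2 / 2 ≤ dist (γ.levelCurve η t) (γ.param s) ^ 2 := by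
  have e : γ.levelCurve η t - γ.param s = η • γ.normal t - (γ.param s - γ.param t) := by
    rw [levelCurve]; abel
  rw [dist_eq_norm, e, norm_sub_sq_real (η • γ.normal t), norm_smul, norm_normal, mul_one, Real.norm_eq_abs, sq_abs,
    real_inner_smul_left]
  have h1 := hr.inner_le s t
  have h2 : η * inner ℝ (γ.normal t) (γ.param s - γ.param t) ≤
      ε₀ * |inner ℝ (γ.normal t) (γ.param s - γ.param t)| := by
    refine (le_abs_self _).trans ?_
    rw [abs_mul]
    gcongr
  linarith


lemma abs_le_dist (hr : γ.IsReach ε₀) {η : ℝ} (hη : |η| ≤ ε₀) (s t : ℝ) :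
    |η| ≤ dist (γ.levelCurve η t) (γ.param s) := by
  have h := hr.sq_add_le_dist_sq hη s t
  refine abs_le_of_sq_le_sq ?_ dist_nonneg
  nlinarith [sq_nonneg ‖γ.param s - γ.param t‖]

lemma infDist_levelCurve (hr : γ.IsReach ε₀) {η : ℝ} (hη : |η| ≤ ε₀) (t : ℝ) :
    Metric.infDist (γ.levelCurve η t) γ.carrier = |η| := by
  refine le_antisymm ?_ ?_
  · rw [← dist_levelCurve_self (t := t)]
    exact Metric.infDist_le_dist_of_mem (mem_range_self t)
  · refine (Metric.le_infDist (range_nonempty _)).2 ?_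
    rintro _ ⟨s, rfl⟩
    exact hr.abs_le_dist hη s t

lemma param_eq_of_dist_eq (hr : γ.IsReach ε₀) {η s t : ℝ} (hη : |η| ≤ ε₀)
    (h : dist (γ.levelCurve η t) (γ.param s) = Metric.infDist (γ.levelCurve η t) γ.carrier) :
    γ.param s = γ.param t := by
  have h1 := hr.sq_add_le_dist_sq hη s t
  rw [h, hr.infDist_levelCurve hη, sq_abs] at h1
  have h2 : ‖γ.param s - γ.param t‖ ^ 2 = 0 := le_antisymm (by linarith) (sq_nonneg _)
  exact sub_eq_zero.1 (norm_eq_zero.1 (pow_eq_zero_iff two_ne_zero |>.1 h2))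

lemma existsUnique_nearest (hr : γ.IsReach ε₀) {x : Plane} (hx : x ∈ γ.tube ε₀) :
    ∃! y, y ∈ γ.carrier ∧ dist x y = Metric.infDist x γ.carrier := by
  obtain ⟨t, -, η, hη, rfl⟩ := γ.exists_levelCurve_eq x
  have hη' : |η| ≤ ε₀ := hη ▸ hx
  refine ⟨γ.param t, ⟨mem_range_self t, by rw [← hη, dist_levelCurve_self]⟩, ?_⟩
  rintro _ ⟨⟨s, rfl⟩, hs⟩
  exact hr.param_eq_of_dist_eq hη' hs

/-- The chosen parameter is determined only up to a multiple of the period, which no periodic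
quantity can see. -/
lemma exists_footParam (hr : γ.IsReach ε₀) {η : ℝ} (hη : |η| ≤ ε₀) (t : ℝ) :
    ∃ m : ℤ, γ.footParam (γ.levelCurve η t) = t + m • γ.period := by
  refine γ.exists_add_zsmul_of_param_eq (hr.param_eq_of_dist_eq hη ?_)
  exact Classical.epsilon_spec (p := fun s => dist (γ.levelCurve η t) (γ.param s) =
    Metric.infDist (γ.levelCurve η t) γ.carrier)
    ⟨t, by rw [hr.infDist_levelCurve hη, dist_levelCurve_self]⟩

lemma proj_levelCurve (hr : γ.IsReach ε₀) {η : ℝ} (hη : |η| ≤ ε₀) (t : ℝ) :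
    γ.proj (γ.levelCurve η t) = γ.param t := by
  obtain ⟨m, hm⟩ := hr.exists_footParam hη t
  rw [proj, hm, γ.periodic.zsmul m t]

lemma signedDist_levelCurve (hr : γ.IsReach ε₀) {η : ℝ} (hη : |η| ≤ ε₀) (t : ℝ) :
    γ.signedDist (γ.levelCurve η t) = η := by
  obtain ⟨m, hm⟩ := hr.exists_footParam hη t
  rw [signedDist, hr.proj_levelCurve hη, hm, γ.normal_periodic.zsmul m t, levelCurve,
    add_sub_cancel_left, real_inner_smul_right, real_inner_self_eq_norm_sq, norm_normal]
  ring

/-- `1 - η κ / (1 + η κ)`: the Jacobian is the inverse of the stretching factor of the parallel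
curve. -/
lemma jacobian_levelCurve (hr : γ.IsReach ε₀) {η : ℝ} (hη : |η| ≤ ε₀) (t : ℝ) :
    γ.jacobian (γ.levelCurve η t) = (1 + η * γ.curv t)⁻¹ := by
  obtain ⟨m, hm⟩ := hr.exists_footParam hη t
  have h := hr.one_add_pos hη
  rw [jacobian, hr.signedDist_levelCurve hη, hm, signedCurvature_levelCurve _ (by linarith [h (t + m • γ.period)]),
    γ.curv_periodic.zsmul m t]
  have h1 : 1 + η * γ.curv t ≠ 0 := by linarith [h t]
  field_simp
  ring

lemma integrand_levelCurve (hr : γ.IsReach ε₀) {η : ℝ} (hη : |η| ≤ ε₀) (t : ℝ)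
    (f : Plane → ℝ) (θ : ℝ → ℝ) (ε : ℝ) :
    γ.integrand f θ ε (γ.levelCurve η t) =
      f (γ.param t) * (ε⁻¹ * θ (ε⁻¹ * η)) * (1 + η * γ.curv t)⁻¹ := by
  rw [integrand, hr.proj_levelCurve hη, hr.signedDist_levelCurve hη, hr.jacobian_levelCurve hη]

lemma levelCurve_mem_tube_iff (hr : γ.IsReach ε₀) {η : ℝ} (hη : |η| ≤ ε₀) (t ε : ℝ) :
    γ.levelCurve η t ∈ γ.tube ε ↔ |η| ≤ ε := by
  change Metric.infDist _ _ ≤ ε ↔ _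
  rw [hr.infDist_levelCurve hη]

lemma levelCurve_injective (hr : γ.IsReach ε₀) {η ζ s t : ℝ} (hη : |η| ≤ ε₀) (hζ : |ζ| ≤ ε₀)
    (ht : t ∈ Ico 0 γ.period) (hs : s ∈ Ico 0 γ.period)
    (h : γ.levelCurve η t = γ.levelCurve ζ s) : t = s ∧ η = ζ := by
  refine ⟨γ.simple ht hs ?_, ?_⟩
  · rw [← hr.proj_levelCurve hη t, ← hr.proj_levelCurve hζ s, h]
  · rw [← hr.signedDist_levelCurve hη t, ← hr.signedDist_levelCurve hζ s, h]

end IsReach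

end SmoothClosedCurve

/-! ### The tube function and the change of variables. -/

namespace SmoothClosedCurve

variable (γ : SmoothClosedCurve)

/-- The integrand of the implicit boundary integral, extended by zero outside the tube. -/
def tubeFun (f : Plane → ℝ) (θ : ℝ → ℝ) (ε : ℝ) : Plane → ℝ :=
  (γ.tube ε).indicator (γ.integrand f θ ε)

/-- The map `(t, η) ↦ γ(t) + η n(t)` in coordinates. -/
def tubeMap (p : ℝ × ℝ) : ℝ × ℝ :=
  (γ.cx p.1 + p.2 * γ.ty p.1, γ.cy p.1 - p.2 * γ.tx p.1)

lemma vec_tubeMap (p : ℝ × ℝ) :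
    !₂[(γ.tubeMap p).1, (γ.tubeMap p).2] = γ.levelCurve p.2 p.1 := by
  refine plane_ext ?_ ?_
  · simp [tubeMap, γ.levelCurve_zero]
  · simp [tubeMap, γ.levelCurve_one]

lemma continuous_tubeMap : Continuous γ.tubeMap := by
  have := γ.contDiff_cx.continuous
  have := γ.contDiff_cy.continuous
  have := γ.contDiff_tx.continuous
  have := γ.contDiff_ty.continuous
  unfold tubeMap
  fun_prop

lemma continuous_levelCurve_uncurry : Continuous fun p : ℝ × ℝ => γ.levelCurve p.2 p.1 := by
  have h : (fun p : ℝ × ℝ => γ.levelCurve p.2 p.1) =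
      fun p => !₂[(γ.tubeMap p).1, (γ.tubeMap p).2] := funext fun p => (γ.vec_tubeMap p).symm
  rw [h]
  have := γ.continuous_tubeMap
  refine (PiLp.continuous_toLp 2 _).comp (continuous_pi fun i => ?_)
  fin_cases i
  · exact this.fst
  · exact this.snd

/-- The derivative of `tubeMap`. -/
def fderivTubeMap (p : ℝ × ℝ) : ℝ × ℝ →L[ℝ] ℝ × ℝ :=
  (Matrix.toLin (.finTwoProd ℝ) (.finTwoProd ℝ)
    !![γ.speed p.1 * γ.tx p.1 * (1 + p.2 * γ.curv p.1), γ.ty p.1;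
      γ.speed p.1 * γ.ty p.1 * (1 + p.2 * γ.curv p.1), -γ.tx p.1]).toContinuousLinearMap

lemma det_fderivTubeMap (p : ℝ × ℝ) :
    (γ.fderivTubeMap p).det = -(γ.speed p.1 * (1 + p.2 * γ.curv p.1)) := by
  unfold fderivTubeMap
  simp only [LinearMap.det_toContinuousLinearMap, LinearMap.det_toLin, Matrix.det_fin_two_of]
  linear_combination (-(γ.speed p.1 * (1 + p.2 * γ.curv p.1))) * γ.tx_sq_add_ty_sq p.1

lemma hasFDerivAt_tubeMap (p : ℝ × ℝ) : HasFDerivAt γ.tubeMap (γ.fderivTubeMap p) p := by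
  unfold fderivTubeMap
  rw [Matrix.toLin_finTwoProd_toContinuousLinearMap]
  have hx := (γ.hasDerivAt_cx p.1).comp_hasFDerivAt p (hasFDerivAt_fst (𝕜 := ℝ) (p := p))
  have hy := (γ.hasDerivAt_cy p.1).comp_hasFDerivAt p (hasFDerivAt_fst (𝕜 := ℝ) (p := p))
  have htx := (γ.hasDerivAt_tx p.1).comp_hasFDerivAt p (hasFDerivAt_fst (𝕜 := ℝ) (p := p))
  have hty := (γ.hasDerivAt_ty p.1).comp_hasFDerivAt p (hasFDerivAt_fst (𝕜 := ℝ) (p := p))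
  have hs := hasFDerivAt_snd (𝕜 := ℝ) (p := p)
  refine ((hx.add (hs.mul hty)).prodMk (hy.sub (hs.mul htx))).congr_fderiv ?_
  ext <;> simp <;> ring

lemma isClosed_tube (ε : ℝ) : IsClosed (γ.tube ε) :=
  isClosed_le (Metric.continuous_infDist_pt _) continuous_const

namespace IsReach

variable {γ} {ε₀ : ℝ} {f : Plane → ℝ} {θ : ℝ → ℝ} {ε : ℝ} {q : ℕ}

lemma tube_eq_image (hr : γ.IsReach ε₀) (hε : ε ≤ ε₀) :
    γ.tube ε = (fun p : ℝ × ℝ => γ.levelCurve p.2 p.1) '' (Ico 0 γ.period ×ˢ Icc (-ε) ε) := by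
  ext x
  constructor
  · intro hx
    obtain ⟨t, ht, η, hη, rfl⟩ := γ.exists_levelCurve_eq x
    have hη' : |η| ≤ ε := hη.trans_le hx
    exact ⟨(t, η), ⟨ht, abs_le.1 hη'⟩, rfl⟩
  · rintro ⟨⟨t, η⟩, ⟨-, hη⟩, rfl⟩
    have hη' : |η| ≤ ε := abs_le.2 hη
    exact (hr.levelCurve_mem_tube_iff (hη'.trans hε) t ε).2 hη'

lemma isCompact_tube (hr : γ.IsReach ε₀) (hε : ε ≤ ε₀) : IsCompact (γ.tube ε) := by
  have hK : IsCompact ((fun p : ℝ × ℝ => γ.levelCurve p.2 p.1) ''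
      (Icc 0 γ.period ×ˢ Icc (-ε) ε)) :=
    (isCompact_Icc.prod isCompact_Icc).image γ.continuous_levelCurve_uncurry
  refine hK.of_isClosed_subset (γ.isClosed_tube ε) ?_
  rw [hr.tube_eq_image hε]
  exact image_mono (prod_mono Ico_subset_Icc_self Subset.rfl)

/-- The projection is defined by choice, so continuity is obtained upstairs: in the coordinates `(t,
η)` the integrand is explicit, and preimages of closed sets are, within the tube, continuous images
of compact sets. -/
lemma continuousOn_integrand (hr : γ.IsReach ε₀) (hε : ε ≤ ε₀)
    (hf : Continuous fun t => f (γ.param t)) (hθ : Continuous θ) :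
    ContinuousOn (γ.integrand f θ ε) (γ.tube ε) := by
  set Q : Set (ℝ × ℝ) := Icc 0 γ.period ×ˢ Icc (-ε) ε with hQ
  set φ : ℝ × ℝ → ℝ := fun p =>
    f (γ.param p.1) * (ε⁻¹ * θ (ε⁻¹ * p.2)) * (1 + p.2 * γ.curv p.1)⁻¹ with hφ
  have hQε : ∀ p ∈ Q, |p.2| ≤ ε := fun p hp => abs_le.2 hp.2
  have hc : ContinuousOn φ Q := by
    have := γ.contDiff_curv.continuous
    have hf' : Continuous fun p : ℝ × ℝ => f (γ.param p.1) := hf.comp continuous_fst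
    refine ContinuousOn.mul (hf'.mul (by fun_prop)).continuousOn (ContinuousOn.inv₀ (by fun_prop) fun p hp => ?_)
    have := hr.one_add_pos ((hQε p hp).trans hε) p.1
    linarith
  have hQc : IsCompact Q := isCompact_Icc.prod isCompact_Icc
  refine continuousOn_iff_isClosed.2 fun C hC => ?_
  have h1 : IsCompact (Q ∩ φ ⁻¹' C) :=
    hQc.of_isClosed_subset (hc.preimage_isClosed_of_isClosed hQc.isClosed hC) inter_subset_left
  refine ⟨(fun p : ℝ × ℝ => γ.levelCurve p.2 p.1) '' (Q ∩ φ ⁻¹' C),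
    (h1.image γ.continuous_levelCurve_uncurry).isClosed, ?_⟩
  ext x
  constructor
  · rintro ⟨hxC, hx⟩
    refine ⟨?_, hx⟩
    rw [hr.tube_eq_image hε] at hx
    obtain ⟨⟨t, η⟩, hp, rfl⟩ := hx
    refine ⟨(t, η), ⟨⟨Ico_subset_Icc_self hp.1, hp.2⟩, ?_⟩, rfl⟩
    rwa [mem_preimage, hr.integrand_levelCurve ((abs_le.2 hp.2).trans hε)] at hxC
  · rintro ⟨⟨⟨t, η⟩, ⟨hp, hpC⟩, rfl⟩, hx⟩
    refine ⟨?_, hx⟩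
    rwa [mem_preimage, hr.integrand_levelCurve ((hQε _ hp).trans hε)]

/-- On the frontier the distance is exactly `ε`, where `θ` vanishes, so the extension by zero is
continuous. -/
lemma continuous_tubeFun (hr : γ.IsReach ε₀) (hε0 : 0 < ε) (hε : ε ≤ ε₀)
    (hf : Continuous fun t => f (γ.param t)) (hq : 1 ≤ q) (hθ : IsWeight q θ) :
    Continuous (γ.tubeFun f θ ε) := by
  refine continuous_indicator (fun x hx => ?_) ?_
  · have hx' : Metric.infDist x γ.carrier = ε :=
      frontier_le_subset_eq (Metric.continuous_infDist_pt _) continuous_const hx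
    obtain ⟨t, ht, η, hη, rfl⟩ := γ.exists_levelCurve_eq x
    rw [hx'] at hη
    rw [hr.integrand_levelCurve (hη.trans_le hε)]
    have h0 : θ (ε⁻¹ * η) = 0 := by
      have := hθ.iteratedDeriv_eq_zero (m := 0) (s := ε⁻¹ * η) (by omega) (by
        rw [abs_mul, hη, abs_of_pos (inv_pos.2 hε0), inv_mul_cancel₀ hε0.ne'])
      simpa using this
    rw [h0]
    simp
  · rw [(γ.isClosed_tube ε).closure_eq]
    exact hr.continuousOn_integrand hε hf (hθ.continuous hq)

lemma tubeFun_levelCurve (hr : γ.IsReach ε₀) (hε : ε ≤ ε₀) {η : ℝ} (hη : |η| ≤ ε) (t : ℝ) :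
    γ.tubeFun f θ ε (γ.levelCurve η t) =
      f (γ.param t) * (ε⁻¹ * θ (ε⁻¹ * η)) * (1 + η * γ.curv t)⁻¹ := by
  rw [tubeFun, indicator_of_mem ((hr.levelCurve_mem_tube_iff (hη.trans hε) t ε).2 hη),
    hr.integrand_levelCurve (hη.trans hε)]

/-- Change of variables `(t, η)`, then `η = ε * s`. The factor `1 + η κ` of the determinant cancels
the Jacobian in the integrand, leaving a product measure. -/
lemma integral_tubeFun_mul (hr : γ.IsReach ε₀) (hε0 : 0 < ε) (hε : ε ≤ ε₀)
    (hf : Continuous fun t => f (γ.param t)) (hθ : Continuous θ)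
    {g : ℝ × ℝ → ℂ} (hg : Continuous g) :
    ∫ p : ℝ × ℝ, g p * (γ.tubeFun f θ ε !₂[p.1, p.2] : ℂ) =
      ∫ t in (0 : ℝ)..γ.period, ((f (γ.param t) * γ.speed t : ℝ) : ℂ) *
        ∫ s in (-1 : ℝ)..1, (θ s : ℂ) * g (γ.tubeMap (t, ε * s)) := by
  -- The half-open period makes the coordinates injective.
  set S : Set (ℝ × ℝ) := Ico 0 γ.period ×ˢ Icc (-ε) ε with hS
  have hSm : MeasurableSet S := measurableSet_Ico.prod measurableSet_Icc
  have hSε : ∀ p ∈ S, |p.2| ≤ ε := fun p hp => abs_le.2 hp.2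
  have hinj : InjOn γ.tubeMap S := by
    intro p hp p' hp' h
    have h' : γ.levelCurve p.2 p.1 = γ.levelCurve p'.2 p'.1 := by
      rw [← γ.vec_tubeMap, ← γ.vec_tubeMap, h]
    obtain ⟨h1, h2⟩ := hr.levelCurve_injective ((hSε p hp).trans hε) ((hSε p' hp').trans hε)
      hp.1 hp'.1 h'
    exact Prod.ext (by simpa using h1) (by simpa using h2)
  have hzero : ∀ p ∉ γ.tubeMap '' S, g p * (γ.tubeFun f θ ε !₂[p.1, p.2] : ℂ) = 0 := by
    intro p hp
    rw [tubeFun, indicator_of_notMem, Complex.ofReal_zero, mul_zero]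
    intro hx
    rw [hr.tube_eq_image hε] at hx
    obtain ⟨p', hp', h⟩ := hx
    refine hp ⟨p', hp', ?_⟩
    have h' : !₂[(γ.tubeMap p').1, (γ.tubeMap p').2] = !₂[p.1, p.2] := by
      rw [γ.vec_tubeMap]; exact h
    have e0 := congrArg (fun v : Plane => v 0) h'
    have e1 := congrArg (fun v : Plane => v 1) h'
    exact Prod.ext (by simpa using e0) (by simpa using e1)
  rw [← setIntegral_eq_integral_of_forall_compl_eq_zero hzero,
    integral_image_eq_integral_abs_det_fderiv_smul volume hSm
      (fun p _ => (γ.hasFDerivAt_tubeMap p).hasFDerivWithinAt) hinj]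
  have hcong : ∀ p ∈ S, |(γ.fderivTubeMap p).det| • (g (γ.tubeMap p) *
      (γ.tubeFun f θ ε !₂[(γ.tubeMap p).1, (γ.tubeMap p).2] : ℂ)) =
      ((f (γ.param p.1) * γ.speed p.1 : ℝ) : ℂ) *
        ((ε⁻¹ : ℝ) * ((θ (ε⁻¹ * p.2) : ℂ) * g (γ.tubeMap p))) := by
    intro p hp
    have h1 := hr.one_add_pos ((hSε p hp).trans hε) p.1
    have h2 : (0 : ℝ) < 1 + p.2 * γ.curv p.1 := by linarith
    have h3 : ((1 + p.2 * γ.curv p.1 : ℝ) : ℂ) ≠ 0 := by exact_mod_cast h2.ne'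
    rw [γ.vec_tubeMap, hr.tubeFun_levelCurve hε (hSε p hp), γ.det_fderivTubeMap, abs_neg,
      abs_of_pos (mul_pos (γ.speed_pos _) h2), Complex.real_smul]
    push_cast at h3 ⊢
    field_simp
  rw [setIntegral_congr_fun hSm hcong, hS, Measure.volume_eq_prod, setIntegral_prod]
  · rw [integral_Ico_eq_integral_Ioc, ← intervalIntegral.integral_of_le γ.period_pos.le]
    refine intervalIntegral.integral_congr fun t _ => ?_
    simp only
    rw [integral_const_mul, integral_Icc_eq_integral_Ioc,
      ← intervalIntegral.integral_of_le (by linarith), intervalIntegral.integral_const_mul]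
    congr 1
    have := intervalIntegral.integral_comp_mul_left (a := -1) (b := 1)
      (fun s => (θ (ε⁻¹ * s) : ℂ) * g (γ.tubeMap (t, s))) hε0.ne'
    rw [Complex.real_smul, mul_neg, mul_one] at this
    rw [← this]
    refine intervalIntegral.integral_congr fun s _ => ?_
    simp only [inv_mul_cancel_left₀ hε0.ne']
  · have := γ.continuous_tubeMap
    have := γ.contDiff_speed.continuous
    rw [← Measure.volume_eq_prod]
    refine IntegrableOn.mono_set (ContinuousOn.integrableOn_compact
      (isCompact_Icc.prod isCompact_Icc) (Continuous.continuousOn ?_))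
      (prod_mono Ico_subset_Icc_self Subset.rfl)
    have hf' : Continuous fun p : ℝ × ℝ => f (γ.param p.1) := hf.comp continuous_fst
    have hA : Continuous fun p : ℝ × ℝ => f (γ.param p.1) * γ.speed p.1 := hf'.mul (by fun_prop)
    exact (Complex.continuous_ofReal.comp hA).mul (by fun_prop)

end IsReach

end SmoothClosedCurve

/-! ### Poisson summation on the scaled lattice and the error bound. -/

lemma latticeChar_eq_cis (k : Fin 2 → ℤ) (x : Fin 2 → ℝ) :
    latticeChar k x = cis (-(2 * Real.pi) * (k 0 * x 0 + k 1 * x 1)) := by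
  unfold latticeChar cis
  congr 1
  rw [Fin.sum_univ_two]
  push_cast
  ring

namespace SmoothClosedCurve.IsReach

variable {γ : SmoothClosedCurve} {ε₀ : ℝ} {f : Plane → ℝ} {θ : ℝ → ℝ} {ε h : ℝ} {q : ℕ}

lemma integral_latticeChar_mul_tubeFun (hr : γ.IsReach ε₀) (hε0 : 0 < ε) (hε : ε ≤ ε₀)
    (hf : Continuous fun t => f (γ.param t)) (hθ : Continuous θ) (hh : 0 < h) (k : Fin 2 → ℤ) :
    ∫ x : Fin 2 → ℝ, latticeChar k x * (γ.tubeFun f θ ε !₂[h * x 0, h * x 1] : ℂ) =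
      ((h ^ 2)⁻¹ : ℝ) * ∫ t in (0 : ℝ)..γ.period, ((f (γ.param t) * γ.speed t : ℝ) : ℂ) *
        ∫ s in (-1 : ℝ)..1, (θ s : ℂ) * cis (-(2 * Real.pi / h) *
          (k 0 * (γ.tubeMap (t, ε * s)).1 + k 1 * (γ.tubeMap (t, ε * s)).2)) := by
  set g : ℝ × ℝ → ℂ := fun p => cis (-(2 * Real.pi / h) * (k 0 * p.1 + k 1 * p.2)) with hg
  have hgc : Continuous g := continuous_cis.comp (by fun_prop)
  rw [← hr.integral_tubeFun_mul hε0 hε hf hθ hgc]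
  have h1 := (volume_preserving_finTwoArrow ℝ).integral_comp'
    (fun p : ℝ × ℝ => g (h • p) * (γ.tubeFun f θ ε !₂[(h • p).1, (h • p).2] : ℂ))
  have h2 := Measure.integral_comp_smul (volume : Measure (ℝ × ℝ))
    (fun p : ℝ × ℝ => g p * (γ.tubeFun f θ ε !₂[p.1, p.2] : ℂ)) h
  have hfr : Module.finrank ℝ (ℝ × ℝ) = 2 := by simp
  rw [hfr, abs_of_pos (by positivity), Complex.real_smul] at h2
  rw [← h2, ← h1]
  congr 1
  ext x
  simp only [MeasurableEquiv.finTwoArrow_apply, Prod.smul_mk, smul_eq_mul, hg,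
    latticeChar_eq_cis]
  congr 2
  field_simp

/-- At frequency zero the integral across the tube is that of `θ`, which is one; hence there is no
error beyond the nonzero frequencies. -/
lemma integral_latticeChar_zero_mul_tubeFun (hr : γ.IsReach ε₀) (hε0 : 0 < ε) (hε : ε ≤ ε₀)
    (hf : Continuous fun t => f (γ.param t)) (hq : 1 ≤ q) (hθ : IsWeight q θ) (hh : 0 < h) :
    ∫ x : Fin 2 → ℝ, latticeChar 0 x * (γ.tubeFun f θ ε !₂[h * x 0, h * x 1] : ℂ) =
      (((h ^ 2)⁻¹ * γ.boundaryIntegral f : ℝ) : ℂ) := by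
  rw [hr.integral_latticeChar_mul_tubeFun hε0 hε hf (hθ.continuous hq) hh]
  have h1 : ∫ s in (-1 : ℝ)..1, (θ s : ℂ) = 1 := by
    rw [intervalIntegral.integral_ofReal, hθ.integral, Complex.ofReal_one]
  simp only [Pi.zero_apply, Int.cast_zero, zero_mul, add_zero, mul_zero]
  have h2 : cis 0 = 1 := by simp [cis]
  simp only [h2, mul_one, h1]
  rw [intervalIntegral.integral_ofReal, ← Complex.ofReal_mul]
  rfl

/-- `τ` and `lam` are polar coordinates of `-2πk / h`, read as a complex number. The lower bound for
`lam` uses the sup norm of `k` and `1 ≤ 2π`. -/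
lemma exists_integral_latticeChar_eq (hr : γ.IsReach ε₀) (hε0 : 0 < ε) (hε : ε ≤ ε₀)
    (hf : Continuous fun t => f (γ.param t)) (hθ : Continuous θ) (hh : 0 < h) (k : Fin 2 → ℤ) :
    ∃ τ ∈ Icc (-Real.pi) Real.pi, ∃ lam, ‖k‖ / h ≤ lam ∧
      ∫ x : Fin 2 → ℝ, latticeChar k x * (γ.tubeFun f θ ε !₂[h * x 0, h * x 1] : ℂ) =
        ((h ^ 2)⁻¹ : ℝ) * γ.curveFourier (fun t => f (γ.param t) * γ.speed t) θ ε τ lam := by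
  set z : ℂ := ⟨-(2 * Real.pi / h) * k 0, -(2 * Real.pi / h) * k 1⟩ with hz
  refine ⟨Complex.arg z, ⟨(Complex.neg_pi_lt_arg z).le, Complex.arg_le_pi z⟩, ‖z‖, ?_, ?_⟩
  · have hpi : 1 ≤ 2 * Real.pi := by linarith [Real.pi_gt_three]
    have key : ∀ m : ℤ, |(m : ℝ)| / h ≤ |-(2 * Real.pi / h) * m| := fun m => by
      rw [abs_mul, abs_neg, abs_of_pos (show 0 < 2 * Real.pi / h by positivity),
        div_mul_eq_mul_div]
      gcongr
      exact le_mul_of_one_le_left (abs_nonneg _) hpi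
    rw [div_le_iff₀ hh]
    refine (pi_norm_le_iff_of_nonneg (by positivity)).2 fun i => ?_
    rw [← div_le_iff₀ hh, Int.norm_eq_abs]
    refine (key (k i)).trans ?_
    fin_cases i
    · exact Complex.abs_re_le_norm z
    · exact Complex.abs_im_le_norm z
  · rw [hr.integral_latticeChar_mul_tubeFun hε0 hε hf hθ hh, curveFourier]
    have hc : ‖z‖ * Real.cos z.arg = -(2 * Real.pi / h) * k 0 := Complex.norm_mul_cos_arg z
    have hs : ‖z‖ * Real.sin z.arg = -(2 * Real.pi / h) * k 1 := Complex.norm_mul_sin_arg z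
    congr 1
    refine intervalIntegral.integral_congr fun t _ => ?_
    congr 1
    refine intervalIntegral.integral_congr fun s _ => ?_
    congr 2
    simp only [phase, tubeMap]
    linear_combination (-(γ.cx t + ε * s * γ.ty t)) * hc - (γ.cy t - ε * s * γ.tx t) * hs

lemma exists_norm_integral_latticeChar_le {κ : ℝ} (hr : γ.IsReach ε₀) (hκ : 2 < κ)
    (hflat : γ.HasFlatPointsOfOrder κ) (hf : ContDiff ℝ ∞ fun t => f (γ.param t))
    (hq : 1 ≤ q) (hθ : IsWeight q θ) :
    ∃ C, 0 ≤ C ∧ ∀ ε, 0 < ε → ε ≤ ε₀ → ∀ h, 0 < h → h ≤ 1 → ∀ k : Fin 2 → ℤ, k ≠ 0 →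
      ‖∫ x : Fin 2 → ℝ, latticeChar k x * (γ.tubeFun f θ ε !₂[h * x 0, h * x 1] : ℂ)‖ ≤
        (h ^ 2)⁻¹ * (C * (ε ^ (q + 1))⁻¹ * h ^ ((q : ℝ) + 1 + κ⁻¹)) *
          ‖k‖ ^ (-((q : ℝ) + 1 + κ⁻¹)) := by
  have hA : ContDiff ℝ ∞ fun t => f (γ.param t) * γ.speed t := hf.mul γ.contDiff_speed
  have hAT : Function.Periodic (fun t => f (γ.param t) * γ.speed t) γ.period := fun t => by
    simp only [γ.periodic t, γ.speed_periodic t]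
  obtain ⟨C, hC, hbound⟩ := γ.exists_norm_curveFourier_le hκ hflat hA hAT hq hθ hr.curv_le
  refine ⟨C, hC, fun ε hε0 hε h hh hh1 k hk => ?_⟩
  obtain ⟨τ, hτ, lam, hlam, heq⟩ := hr.exists_integral_latticeChar_eq hε0 hε hf.continuous
    (hθ.continuous hq) hh k
  have hk1 : 1 ≤ ‖k‖ := by
    obtain ⟨i, hi⟩ := Function.ne_iff.1 hk
    refine le_trans ?_ (norm_le_pi_norm k i)
    rw [Int.norm_eq_abs]
    exact_mod_cast Int.one_le_abs hi
  have hkh : 1 ≤ ‖k‖ / h := (one_le_div hh).2 (hh1.trans hk1)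
  have hlam1 := hkh.trans hlam
  have hkh0 : 0 < ‖k‖ / h := by linarith
  have hlam0 : 0 < lam := by linarith
  have hκ0 : 0 < κ := by linarith
  rw [heq, norm_mul, Complex.norm_real, Real.norm_of_nonneg (by positivity), mul_assoc]
  refine mul_le_mul_of_nonneg_left ((hbound τ hτ ε hε0 hε lam hlam1).trans ?_) (by positivity)
  have h1 : ((ε * lam) ^ (q + 1))⁻¹ * lam ^ (-κ⁻¹) =
      (ε ^ (q + 1))⁻¹ * lam ^ (-((q : ℝ) + 1 + κ⁻¹)) := by
    rw [neg_add, Real.rpow_add hlam0, mul_pow, mul_inv, Real.rpow_neg hlam0.le ((q : ℝ) + 1),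
      mul_assoc]
    congr 3
    exact_mod_cast (Real.rpow_natCast lam (q + 1)).symm
  have h2 : lam ^ (-((q : ℝ) + 1 + κ⁻¹)) ≤ (‖k‖ / h) ^ (-((q : ℝ) + 1 + κ⁻¹)) :=
    Real.rpow_le_rpow_of_nonpos hkh0 hlam (by
      have : 0 < κ⁻¹ := by positivity
      have : (0 : ℝ) ≤ q := by positivity
      linarith)
  rw [Real.div_rpow (norm_nonneg _) hh.le, Real.rpow_neg hh.le, div_inv_eq_mul] at h2
  rw [h1, mul_assoc C, mul_assoc C, mul_assoc (ε ^ (q + 1))⁻¹]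
  gcongr
  rwa [mul_comm]

theorem exists_abs_boundaryIntegral_sub_quadrature_le {κ : ℝ} (hr : γ.IsReach ε₀) (hκ : 2 < κ)
    (hflat : γ.HasFlatPointsOfOrder κ) (hf : ContDiff ℝ ∞ fun t => f (γ.param t))
    (hq : 1 ≤ q) (hθ : IsWeight q θ) :
    ∃ C, 0 ≤ C ∧ ∀ ε, 0 < ε → ε ≤ ε₀ → ∀ h, 0 < h → h ≤ 1 →
      |γ.boundaryIntegral f - γ.quadrature f θ ε h| ≤
        C * (ε ^ (q + 1))⁻¹ * h ^ ((q : ℝ) + 1 + κ⁻¹) := by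
  obtain ⟨C, hC, hbound⟩ := hr.exists_norm_integral_latticeChar_le hκ hflat hf hq hθ
  have hκ0 : 0 < κ⁻¹ := inv_pos.2 (by linarith)
  have hq1 : (1 : ℝ) ≤ q := by exact_mod_cast hq
  -- In two dimensions an exponent above `2` is needed; `q ≥ 1` and `1 / κ > 0` give it.
  have hsum : Summable fun k : Fin 2 → ℤ => ‖k‖ ^ (-((q : ℝ) + 1 + κ⁻¹)) :=
    EisensteinSeries.summable_one_div_norm_rpow (by linarith)
  have hpos : ∀ k : Fin 2 → ℤ, 0 ≤ ‖k‖ ^ (-((q : ℝ) + 1 + κ⁻¹)) := fun k => by positivity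
  refine ⟨C * ∑' k : Fin 2 → ℤ, ‖k‖ ^ (-((q : ℝ) + 1 + κ⁻¹)),
    mul_nonneg hC (tsum_nonneg hpos), fun ε hε0 hε h hh hh1 => ?_⟩
  set F : (Fin 2 → ℝ) → ℂ := fun x => (γ.tubeFun f θ ε !₂[h * x 0, h * x 1] : ℂ) with hF
  set B := (h ^ 2)⁻¹ * (C * (ε ^ (q + 1))⁻¹ * h ^ ((q : ℝ) + 1 + κ⁻¹)) with hB
  have hcont := hr.continuous_tubeFun hε0 hε hf.continuous hq hθ
  have hlin : Continuous fun x : Fin 2 → ℝ => (!₂[h * x 0, h * x 1] : Plane) := by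
    refine (PiLp.continuous_toLp 2 _).comp (continuous_pi fun i => ?_)
    fin_cases i
    · exact continuous_const.mul (continuous_apply 0)
    · exact continuous_const.mul (continuous_apply 1)
  have hFc : Continuous F := Complex.continuous_ofReal.comp (hcont.comp hlin)
  have hFs : HasCompactSupport F := by
    have hK : IsCompact ((fun y : Plane => fun i => h⁻¹ * y i) '' γ.tube ε) :=
      (hr.isCompact_tube hε).image (by fun_prop)
    refine HasCompactSupport.intro hK fun x hx => ?_
    rw [hF]
    simp only [Complex.ofReal_eq_zero]
    refine indicator_of_notMem (fun hxt => hx ⟨_, hxt, ?_⟩) _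
    ext i
    fin_cases i <;> simp [inv_mul_cancel_left₀ hh.ne']
  have hsB : Summable fun k : Fin 2 → ℤ => B * ‖k‖ ^ (-((q : ℝ) + 1 + κ⁻¹)) := hsum.mul_left B
  have hs : Summable fun k : Fin 2 → ℤ => ∫ x, latticeChar k x * F x := by
    refine hsB.of_norm_bounded_eventually ?_
    refine (Set.finite_singleton (0 : Fin 2 → ℤ)).subset fun k hk => ?_
    by_contra hk0
    exact hk (hbound ε hε0 hε h hh hh1 k hk0)
  have hP := hasSum_integral_latticeChar hFc hFs hs
  have hQ : ((h ^ 2 : ℝ) : ℂ) * ∑' n : Fin 2 → ℤ, F (fun i => (n i : ℝ)) =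
      (γ.quadrature f θ ε h : ℂ) := by
    rw [quadrature, Complex.ofReal_mul, Complex.ofReal_tsum]
    congr 1
    exact (finTwoArrowEquiv ℤ).tsum_eq
      (fun n : ℤ × ℤ => (γ.tubeFun f θ ε !₂[h * (n.1 : ℝ), h * (n.2 : ℝ)] : ℂ))
  have h0 := hr.integral_latticeChar_zero_mul_tubeFun hε0 hε hf.continuous hq hθ hh
  -- Removing the term `k = 0` from the Poisson sum leaves the error up to sign and the factor `h ^
  -- 2`.
  have hrest := hP.sub (hasSum_ite_eq (0 : Fin 2 → ℤ) (∫ x, latticeChar 0 x * F x))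
  have hle : ‖∑' n : Fin 2 → ℤ, F (fun i => (n i : ℝ)) - ∫ x, latticeChar 0 x * F x‖ ≤
      B * ∑' k : Fin 2 → ℤ, ‖k‖ ^ (-((q : ℝ) + 1 + κ⁻¹)) := by
    rw [← tsum_mul_left, ← hrest.tsum_eq]
    refine tsum_of_norm_bounded hsB.hasSum fun k => ?_
    by_cases hk : k = 0
    · subst hk
      simp only [if_true, sub_self, norm_zero]
      have := hpos 0
      positivity
    · simp only [if_neg hk, sub_zero]
      exact hbound ε hε0 hε h hh hh1 k hk
  have hh2 : (0 : ℝ) < h ^ 2 := by positivity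
  have heq : ((γ.boundaryIntegral f - γ.quadrature f θ ε h : ℝ) : ℂ) =
      -(((h ^ 2 : ℝ) : ℂ) *
        (∑' n : Fin 2 → ℤ, F (fun i => (n i : ℝ)) - ∫ x, latticeChar 0 x * F x)) := by
    have hh3 : ((h : ℝ) : ℂ) ≠ 0 := by exact_mod_cast hh.ne'
    rw [mul_sub, hQ, hF, h0]
    push_cast
    field_simp
    ring
  rw [← Real.norm_eq_abs, ← Complex.norm_real, heq, norm_neg, norm_mul, Complex.norm_real,
    Real.norm_of_nonneg hh2.le]
  refine (mul_le_mul_of_nonneg_left hle hh2.le).trans (le_of_eq ?_)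
  rw [hB]
  field_simp

end SmoothClosedCurve.IsReach

end IBIM

end

theorem mainTheorem7 (γ : IBIM.SmoothClosedCurve) (κ : ℝ) (hκ : 2 < κ)
    (hflat : γ.HasFlatPointsOfOrder κ) :
    ∃ ε₀ : ℝ, 0 < ε₀ ∧
      (∀ x ∈ γ.tube ε₀, ∃! y, y ∈ γ.carrier ∧ dist x y = Metric.infDist x γ.carrier) ∧
      ∀ (q : ℕ) (θ : ℝ → ℝ) (f : IBIM.Plane → ℝ) (α : ℝ) (ε : ℝ → ℝ),
        1 ≤ q → IBIM.IsWeight q θ → ContDiff ℝ ∞ (fun t => f (γ.param t)) →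
        0 ≤ α → α ≤ 1 →
        (∀ᶠ h in 𝓝[>] (0 : ℝ), 0 < ε h ∧ ε h ≤ ε₀) →
        ε =Θ[𝓝[>] (0 : ℝ)] (fun h => h ^ α) →
        (fun h => γ.boundaryIntegral f - γ.quadrature f θ (ε h) h)
          =O[𝓝[>] (0 : ℝ)] (fun h => h ^ (1 / κ + ((q : ℝ) + 1) * (1 - α))) := by
  obtain ⟨ε₀, hr⟩ := γ.exists_isReach
  refine ⟨ε₀, hr.pos, fun x hx => hr.existsUnique_nearest hx, ?_⟩
  intro q θ f α ε hq hθ hf _ _ hε hΘ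
  obtain ⟨C, hC, hbound⟩ :=
    hr.exists_abs_boundaryIntegral_sub_quadrature_le hκ hflat hf hq hθ
  -- The half `h ^ α = O(ε)` of the hypothesis turns `ε⁻¹` into `c * h ^ (-α)`.
  obtain ⟨c, hc, hlow⟩ := hΘ.2.exists_pos
  rw [isBigOWith_iff] at hlow
  refine IsBigO.of_bound (C * c ^ (q + 1)) ?_
  filter_upwards [hε, hlow, Ioo_mem_nhdsGT (zero_lt_one (α := ℝ))] with h hεh hlo hh
  obtain ⟨hh0, hh1⟩ := hh
  rw [Real.norm_of_nonneg (Real.rpow_nonneg hh0.le _), Real.norm_of_nonneg hεh.1.le] at hlo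
  rw [Real.norm_eq_abs, Real.norm_of_nonneg (Real.rpow_nonneg hh0.le _)]
  refine (hbound (ε h) hεh.1 hεh.2 h hh0 hh1.le).trans ?_
  have hα : 0 < h ^ α := Real.rpow_pos_of_pos hh0 _
  have h1 : (ε h ^ (q + 1))⁻¹ ≤ c ^ (q + 1) * h ^ (-(α * ((q : ℝ) + 1))) := by
    have h2 : (ε h)⁻¹ ≤ c * (h ^ α)⁻¹ := by
      rw [← div_eq_mul_inv, inv_le_iff_one_le_mul₀ hεh.1, div_mul_eq_mul_div, one_le_div hα]
      exact hlo
    rw [Real.rpow_neg hh0.le, Real.rpow_mul hh0.le, ← inv_pow, ← Nat.cast_succ,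
      Real.rpow_natCast, ← inv_pow, ← mul_pow]
    exact pow_le_pow_left₀ (inv_nonneg.2 hεh.1.le) h2 _
  calc C * (ε h ^ (q + 1))⁻¹ * h ^ ((q : ℝ) + 1 + κ⁻¹)
      ≤ C * (c ^ (q + 1) * h ^ (-(α * ((q : ℝ) + 1)))) * h ^ ((q : ℝ) + 1 + κ⁻¹) := by gcongr
    _ = C * c ^ (q + 1) * (h ^ (-(α * ((q : ℝ) + 1))) * h ^ ((q : ℝ) + 1 + κ⁻¹)) := by ring
    _ = C * c ^ (q + 1) * h ^ (1 / κ + ((q : ℝ) + 1) * (1 - α)) := by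
      rw [← Real.rpow_add hh0, one_div]
      congr 2
      ring
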